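/- **Theorem (Decay of spin-spin correlations).** Let $\alpha>0$, $\delta>0$ and $K,A\in\mathbb R$. Then there are constants $0<\tilde\alpha<\alpha$ and $C$, depending only on $\alpha,\delta,K,A$, such that the following holds. Let $(\psi_i)_{i\in\mathbb Z}$ be functions $\psi_i:\mathbb R\to\mathbb R$ which admit splittings $\psi_i=\psi_i^c+\psi_i^b$ with $\psi_i^c$ twice differentiable, $\psi_i^b$ differentiable, and $$(\psi_i^c)''(z)\ge 0,\qquad |\psi_i^b(z)|+|(\psi_i^b)'(z)|\le K\qquad\text{for all } i\in\mathbb Z,\ z\in\mathbb R,$$ and let $M=(M_{ij})_{i,j\in\mathbb Z}$ be a real matrix such that for all $i,j\in\mathbb Z$ $$M_{ij}=M_{ji},\qquad \sum_{k\in\mathbb Z,\,k\ne i}|M_{ik}|+\delta\le M_{ii},\qquad |M_{ij}|\le \frac{A}{|i-j|^{2+\alpha}+1}.$$ Consider the formal Hamiltonian $H(x)=\sum_{i\in\mathbb Z}\psi_i(x_i)+\frac12\sum_{i,j\in\mathbb Z}M_{ij}x_ix_j$. Let $\Lambda\subset\mathbb Z$ be finite and let $x^{\mathbb Z\setminus\Lambda}=(x_j)_{j\in\mathbb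 Z\setminus\Lambda}$ be real boundary values that are tempered, i.e. $\sum_{j\in\mathbb Z\setminus\Lambda}|M_{ij}|\,|x_j|<\infty$ for all $i\in\Lambda$. Let $\mu_\Lambda$ be the associated finite-volume Gibbs measure on $\mathbb R^\Lambda$, $$\mu_\Lambda(dx^\Lambda)=\frac1Z\,e^{-H(x^\Lambda,x^{\mathbb Z\setminus\Lambda})}\,dx^\Lambda,$$ where only the terms of $H$ that depend on $x^\Lambda$ are kept (the other ones cancel against the normalization constant $Z$). Then $\mu_\Lambda$ is a well-defined probability measure with finite second moments, and $$|\operatorname{cov}_{\mu_\Lambda}(x_i,x_j)|\le\frac{C}{|i-j|^{2+\tilde\alpha}+1}\qquad\text{for all } i,j\in\Lambda.$$ -/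

import Mathlib

noncomputable section

namespace SpinLattice

open MeasureTheory

/-- The single-site potentials `ψ i` are perturbed convex with constant `K`: there is a splitting
`ψ i = ψc i + ψb i` with `(ψc i)'' ≥ 0` and `|ψb i| + |(ψb i)'| ≤ K`. -/
def PerturbedConvex (K : ℝ) (ψ : ℤ → ℝ → ℝ) : Prop :=
  ∃ ψc ψb : ℤ → ℝ → ℝ, ∀ i : ℤ,
    (∀ z : ℝ, ψ i z = ψc i z + ψb i z) ∧
    Differentiable ℝ (ψc i) ∧ Differentiable ℝ (deriv (ψc i)) ∧
    (∀ z : ℝ, 0 ≤ deriv (deriv (ψc i)) z) ∧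
    Differentiable ℝ (ψb i) ∧
    (∀ z : ℝ, |ψb i z| + |deriv (ψb i) z| ≤ K)

/-- The interaction is symmetric. -/
def SymmetricInteraction (M : ℤ → ℤ → ℝ) : Prop :=
  ∀ i j : ℤ, M i j = M j i

/-- Strict diagonal dominance: `∑_{j ≠ i} |M i j| + δ ≤ M i i` for every `i`, where the series is
required to converge. -/
def StrictlyDiagDominant (δ : ℝ) (M : ℤ → ℤ → ℝ) : Prop :=
  ∀ i : ℤ, Summable (fun j : {j : ℤ // j ≠ i} => |M i j|) ∧
    ∑' j : {j : ℤ // j ≠ i}, |M i j| + δ ≤ M i i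

/-- Algebraic decay of the interaction: `|M i j| ≤ A / (|i - j|^(2 + α) + 1)` for all `i`, `j`. -/
def AlgebraicDecay (A α : ℝ) (M : ℤ → ℤ → ℝ) : Prop :=
  ∀ i j : ℤ, |M i j| ≤ A / (|(i : ℝ) - (j : ℝ)| ^ (2 + α) + 1)

/-- The spin values `y` outside of `Λ` are tempered. -/
def Tempered (M : ℤ → ℤ → ℝ) (Λ : Finset ℤ) (y : {j : ℤ // j ∉ Λ} → ℝ) : Prop :=
  ∀ i ∈ Λ, Summable (fun j : {j : ℤ // j ∉ Λ} => |M i j| * |y j|)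

/-- The part of the formal Hamiltonian
`H(x) = ∑_i ψ_i(x_i) + (1/2) ∑_{i,j} M_ij x_i x_j` which depends on the spins in `Λ`: the first sum
runs over `i ∈ Λ`, the second one over all pairs `(i, j)` with `i ∈ Λ` or `j ∈ Λ`. The remaining
terms are functions of the boundary values `y` only and cancel in the normalized Gibbs measure. -/
def hamiltonian (ψ : ℤ → ℝ → ℝ) (M : ℤ → ℤ → ℝ) (Λ : Finset ℤ) (y : {j : ℤ // j ∉ Λ} → ℝ)
    (x : Λ → ℝ) : ℝ :=
  ∑ i : Λ, ψ i (x i) + (1 / 2) * ∑ i : Λ, ∑ j : Λ, M i j * x i * x j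
    + (1 / 2) * ∑ i : Λ, ∑' j : {j : ℤ // j ∉ Λ}, (M i j + M j i) * x i * y j

/-- The finite-volume Gibbs measure on `ℝ^Λ` with boundary values `y`: the measure with density
`Z⁻¹ exp(-H(x, y))` with respect to Lebesgue measure, where `Z = ∫ exp(-H(x, y)) dx`. -/
def gibbsMeasure (ψ : ℤ → ℝ → ℝ) (M : ℤ → ℤ → ℝ) (Λ : Finset ℤ) (y : {j : ℤ // j ∉ Λ} → ℝ) :
    Measure (Λ → ℝ) :=
  (volume : Measure (Λ → ℝ)).tilted (fun x => -hamiltonian ψ M Λ y x)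

end SpinLattice

end

/-!
# Decay of correlations for perturbed convex potentials

Set `s = 2 + α / 2`; the covariances decay like `|i - j| ^ (-s)`, uniformly in the finite set, the
boundary values and the potentials. The boundary values only add linear terms to the potentials, so
they are absorbed into the convex parts.

**Duplication.** The covariance is `1 / 2` times the expectation of `(x i - y i) * (x j - y j)` for two
independent copies `x`, `y`. In terms of the mean `q` and the difference `p` of the copies, the
variables `p` form for each fixed `q` a system with even single-site weights and the couplings `-M / 4`
(`siteDensity_mul_siteDensity`). The dependence on `q` and on the boundary values remains only in these
weights. Since the potentials are perturbed convex, the ratio of `exp (K |r| - m r ^ 2)` and the weight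
increases with `|r|`, where `m = M k k / 4`.

**Comparison.** Ginibre's inequality (`abs_integral_coord_mul_le`) compares two-point functions of two
systems, by expanding the coupling energies of a pair of configurations `p'`, `p` in powers of `p' + p`
and `p' - p`. It requires moment inequalities for each single site (`SiteDominates`). They hold if the
ratio of the single-site weights increases with `|r|`, which leads to the weights
`exp (K |r| - m r ^ 2)`, and also for the passage from these to `exp (-m r ^ 2) * cosh (β r)` with large
`β` (`exists_siteDominates_coshWeight`). The couplings are replaced by their absolute values on the way,
which preserves diagonal dominance.

**Gaussian spins in an Ising field.** The weight `exp (-m r ^ 2) * cosh (β r)` is a Gaussian weight in a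
field `±β` of random sign. Completing the square, the two-point function becomes a combination of
Green's function `G` of a diagonally dominant matrix and of the two-point function of an Ising model
whose couplings are proportional to `G` (`Dominant.integral_coord_mul_cosh`).

**Algebraic decay.** Substochastic equations with an algebraically decaying kernel have solutions with
the same decay (`exists_decay_of_subsolution`). This applies to `G`, whose decay is hence that of `M`.
It also applies to the Ising model: as `s > 2`, the total strength of the bonds crossing a point of the
line is bounded, so that domination by percolation and cut points give decay of correlations at every
temperature, without a rate (`exists_isingCorr_le`). Simon's inequality, a consequence of Lebowitz'
inequality, then yields a substochastic equation and hence the rate (`exists_isingCorr_decay`). The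
exponent is lowered by `α / 2` only at the start, where the bound on `M` is weakened to a multiple of
`(1 + |i - j|) ^ (-s)`.
-/

noncomputable section

set_option linter.unusedSectionVars false

namespace SpinLattice

/-! ### Algebraic decay on the integers -/

/-- The algebraic weight `(1 + |n|) ^ (-s)`. It is comparable to `1 / (|n| ^ s + 1)` and, unlike the
latter, comes from a submultiplicative function. -/
def algWeight (s : ℝ) (n : ℤ) : ℝ := (1 + |(n : ℝ)|) ^ (-s)

lemma one_add_abs_pos (n : ℤ) : 0 < 1 + |(n : ℝ)| := by positivity

lemma algWeight_pos (s : ℝ) (n : ℤ) : 0 < algWeight s n :=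
  Real.rpow_pos_of_pos (one_add_abs_pos n) _

lemma algWeight_le_one {s : ℝ} (hs : 0 ≤ s) (n : ℤ) : algWeight s n ≤ 1 :=
  Real.rpow_le_one_of_one_le_of_nonpos (by linarith [abs_nonneg (n : ℝ)]) (by linarith)

lemma algWeight_neg (s : ℝ) (n : ℤ) : algWeight s (-n) = algWeight s n := by
  simp [algWeight]

lemma algWeight_sub_comm (s : ℝ) (m n : ℤ) : algWeight s (m - n) = algWeight s (n - m) := by
  rw [← algWeight_neg, neg_sub]

lemma algWeight_le_mul {s c : ℝ} (hs : 0 ≤ s) (hc : 0 < c) {m n : ℤ}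
    (h : 1 + |(n : ℝ)| ≤ c * (1 + |(m : ℝ)|)) : algWeight s m ≤ c ^ s * algWeight s n := by
  have hm := one_add_abs_pos m
  have hn := one_add_abs_pos n
  have h1 : (1 + |(n : ℝ)|) ^ s ≤ c ^ s * (1 + |(m : ℝ)|) ^ s := by
    rw [← Real.mul_rpow hc.le hm.le]
    exact Real.rpow_le_rpow hn.le h hs
  unfold algWeight
  rw [Real.rpow_neg hm.le, Real.rpow_neg hn.le, ← div_eq_mul_inv, inv_eq_one_div,
    div_le_div_iff₀ (Real.rpow_pos_of_pos hm _) (Real.rpow_pos_of_pos hn _)]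
  linarith

lemma summable_algWeight {s : ℝ} (hs : 1 < s) : Summable (algWeight s) := by
  have h := (Real.summable_abs_int_rpow hs).add
    (summable_of_hasFiniteSupport (f := fun n : ℤ => if n = 0 then (1 : ℝ) else 0)
      ((Set.finite_singleton (0 : ℤ)).subset (fun n hn => by
        by_contra h0
        simp only [Set.mem_singleton_iff] at h0
        simp [h0] at hn)))
  refine h.of_nonneg_of_le (fun n => (algWeight_pos s n).le) (fun n => ?_)
  by_cases hn : n = 0
  · subst hn
    have : (0 : ℝ) ≤ |((0 : ℤ) : ℝ)| ^ (-s) := Real.rpow_nonneg (abs_nonneg _) _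
    simp only [if_true]
    linarith [algWeight_le_one (by linarith : 0 ≤ s) 0]
  · simp only [hn, if_false, add_zero]
    have : 0 < |(n : ℝ)| := by simpa using hn
    exact Real.rpow_le_rpow_of_nonpos this (by linarith) (by linarith)

/-- The total mass of the algebraic weight. -/
def algMass (s : ℝ) : ℝ := ∑' n : ℤ, algWeight s n

lemma algMass_nonneg (s : ℝ) : 0 ≤ algMass s := tsum_nonneg fun n => (algWeight_pos s n).le

section Sums

variable {V : Type*} [Fintype V] {x : V → ℤ}

lemma sum_algWeight_le {s : ℝ} (hs : 1 < s) (hx : Function.Injective x) (m : ℤ) :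
    ∑ k, algWeight s (x k - m) ≤ algMass s := by
  classical
  have hinj : Function.Injective (fun k => x k - m) := fun a b hab => hx (by simpa using hab)
  have hmap := Finset.sum_map Finset.univ ⟨_, hinj⟩ (algWeight s)
  simp only [Function.Embedding.coeFn_mk] at hmap
  rw [← hmap]
  exact (summable_algWeight hs).sum_le_tsum _ (fun n _ => (algWeight_pos s n).le)

lemma sum_algWeight_le' {s : ℝ} (hs : 1 < s) (hx : Function.Injective x) (m : ℤ) :
    ∑ k, algWeight s (m - x k) ≤ algMass s := by
  simp_rw [algWeight_sub_comm s m]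
  exact sum_algWeight_le hs hx m

/-- The algebraic weight is stable under convolution: one of the two steps of `a → k → b` covers at
least half of the distance. -/
lemma sum_algWeight_mul_le {s : ℝ} (hs : 1 < s) (hx : Function.Injective x) (a b : ℤ) :
    ∑ k, algWeight s (a - x k) * algWeight s (x k - b) ≤
      2 ^ s * (2 * algMass s) * algWeight s (a - b) := by
  have key : ∀ k, algWeight s (a - x k) * algWeight s (x k - b) ≤
      2 ^ s * algWeight s (a - b) * (algWeight s (a - x k) + algWeight s (x k - b)) := by
    intro k
    have h1 := algWeight_pos s (a - x k)
    have h2 := algWeight_pos s (x k - b)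
    have h3 := algWeight_pos s (a - b)
    have h4 : (0 : ℝ) < 2 ^ s := by positivity
    have htri : |((a - b : ℤ) : ℝ)| ≤ |((a - x k : ℤ) : ℝ)| + |((x k - b : ℤ) : ℝ)| := by
      have := abs_add_le ((a - x k : ℤ) : ℝ) ((x k - b : ℤ) : ℝ)
      push_cast at this ⊢
      rwa [sub_add_sub_cancel] at this
    rcases le_total |((a - x k : ℤ) : ℝ)| |((x k - b : ℤ) : ℝ)| with h | h
    · have := algWeight_le_mul (s := s) (c := 2) (m := x k - b) (n := a - b) (by linarith)
        (by norm_num) (by linarith)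
      nlinarith [mul_pos (mul_pos h4 h3) h2]
    · have := algWeight_le_mul (s := s) (c := 2) (m := a - x k) (n := a - b) (by linarith)
        (by norm_num) (by linarith)
      nlinarith [mul_pos (mul_pos h4 h3) h1]
  calc _ ≤ ∑ k, 2 ^ s * algWeight s (a - b) * (algWeight s (a - x k) + algWeight s (x k - b)) :=
        Finset.sum_le_sum fun k _ => key k
    _ = 2 ^ s * algWeight s (a - b) *
        (∑ k, algWeight s (a - x k) + ∑ k, algWeight s (x k - b)) := by
        rw [← Finset.mul_sum, Finset.sum_add_distrib]
    _ ≤ 2 ^ s * algWeight s (a - b) * (algMass s + algMass s) := by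
        have := algWeight_pos s (a - b)
        gcongr
        · exact sum_algWeight_le' hs hx a
        · exact sum_algWeight_le hs hx b
    _ = _ := by ring

end Sums

/-- The bond `{k, l}` crosses the cut between `m` and `m + 1`. -/
def Crosses (m k l : ℤ) : Prop := (k ≤ m ∧ m < l) ∨ (l ≤ m ∧ m < k)

instance (m k l : ℤ) : Decidable (Crosses m k l) := by unfold Crosses; infer_instance

/-- Across a cut, the algebraic weight is bounded by a product; this makes the total weight of all
bonds crossing a cut finite as soon as `s > 2`. -/
lemma Crosses.algWeight_le {m k l : ℤ} (h : Crosses m k l) {s : ℝ} (hs : 0 ≤ s) :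
    algWeight s (k - l) ≤ algWeight (s / 2) (k - m) * algWeight (s / 2) (l - m) := by
  have key : (1 + |((k - m : ℤ) : ℝ)|) * (1 + |((l - m : ℤ) : ℝ)|) ≤
      (1 + |((k - l : ℤ) : ℝ)|) ^ 2 := by
    have hz : (1 + |k - m|) * (1 + |l - m|) ≤ (1 + |k - l|) ^ 2 := by
      rcases h with ⟨h1, h2⟩ | ⟨h1, h2⟩
      · rw [abs_of_nonpos (by lia : k - m ≤ 0), abs_of_pos (by lia : 0 < l - m),
          abs_of_neg (by lia : k - l < 0)]
        nlinarith [mul_nonneg (by lia : 0 ≤ m - k) (by lia : 0 ≤ l - m)]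
      · rw [abs_of_nonpos (by lia : l - m ≤ 0), abs_of_pos (by lia : 0 < k - m),
          abs_of_pos (by lia : 0 < k - l)]
        nlinarith [mul_nonneg (by lia : 0 ≤ m - l) (by lia : 0 ≤ k - m)]
    exact_mod_cast hz
  unfold algWeight
  rw [← Real.mul_rpow (one_add_abs_pos _).le (one_add_abs_pos _).le]
  calc _ = ((1 + |((k - l : ℤ) : ℝ)|) ^ 2) ^ (-(s / 2)) := by
        rw [← Real.rpow_natCast, ← Real.rpow_mul (one_add_abs_pos _).le]
        congr 1
        push_cast
        ring
    _ ≤ _ := Real.rpow_le_rpow_of_nonpos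
        (mul_pos (one_add_abs_pos _) (one_add_abs_pos _)) key (by linarith)

lemma sum_crosses_algWeight_le {V : Type*} [Fintype V] {x : V → ℤ} (hx : Function.Injective x)
    {s : ℝ} (hs : 2 < s) (m : ℤ) :
    ∑ b : V × V with Crosses m (x b.1) (x b.2), algWeight s (x b.1 - x b.2) ≤
      algMass (s / 2) ^ 2 := by
  classical
  calc _ ≤ ∑ b : V × V with Crosses m (x b.1) (x b.2),
        algWeight (s / 2) (x b.1 - m) * algWeight (s / 2) (x b.2 - m) :=
        Finset.sum_le_sum fun b hb => ((Finset.mem_filter.1 hb).2).algWeight_le (by linarith)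
    _ ≤ ∑ b : V × V, algWeight (s / 2) (x b.1 - m) * algWeight (s / 2) (x b.2 - m) :=
        Finset.sum_le_sum_of_subset_of_nonneg (Finset.filter_subset _ _) fun b _ _ =>
          (mul_pos (algWeight_pos _ _) (algWeight_pos _ _)).le
    _ = (∑ k, algWeight (s / 2) (x k - m)) ^ 2 := by
        rw [Fintype.sum_prod_type, sq, Finset.sum_mul_sum]
    _ ≤ _ := by
        have := sum_algWeight_le (s := s / 2) (by linarith) hx m
        have h0 : 0 ≤ ∑ k, algWeight (s / 2) (x k - m) :=
          Finset.sum_nonneg fun k _ => (algWeight_pos _ _).le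
        gcongr

/-- The long bonds crossing a cut have small total weight. -/
lemma sum_long_crosses_algWeight_le {V : Type*} [Fintype V] {x : V → ℤ}
    (hx : Function.Injective x) {s : ℝ} (hs : 2 < s) (m : ℤ) {N : ℝ} (hN : 0 < N) :
    ∑ b : V × V with Crosses m (x b.1) (x b.2) ∧ N ≤ |((x b.1 - x b.2 : ℤ) : ℝ)|,
      algWeight s (x b.1 - x b.2) ≤ N ^ (-((s - 2) / 2)) * algMass ((s + 2) / 4) ^ 2 := by
  classical
  have hb : ∀ n : ℤ, N ≤ |(n : ℝ)| →
      algWeight s n ≤ N ^ (-((s - 2) / 2)) * algWeight ((s + 2) / 2) n := by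
    intro n hn
    have : algWeight s n = (1 + |(n : ℝ)|) ^ (-((s - 2) / 2)) * algWeight ((s + 2) / 2) n := by
      unfold algWeight
      rw [← Real.rpow_add (one_add_abs_pos n)]
      congr 1
      ring
    rw [this]
    gcongr ?_ * _
    · exact (algWeight_pos _ _).le
    · exact Real.rpow_le_rpow_of_nonpos hN (by linarith) (by linarith)
  calc _ ≤ ∑ b : V × V with Crosses m (x b.1) (x b.2) ∧ N ≤ |((x b.1 - x b.2 : ℤ) : ℝ)|,
        N ^ (-((s - 2) / 2)) * algWeight ((s + 2) / 2) (x b.1 - x b.2) :=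
        Finset.sum_le_sum fun b hb' => hb _ (Finset.mem_filter.1 hb').2.2
    _ ≤ ∑ b : V × V with Crosses m (x b.1) (x b.2),
        N ^ (-((s - 2) / 2)) * algWeight ((s + 2) / 2) (x b.1 - x b.2) := by
        refine Finset.sum_le_sum_of_subset_of_nonneg (fun b hb' => ?_) fun b _ _ =>
          mul_nonneg (Real.rpow_nonneg hN.le _) (algWeight_pos _ _).le
        simp only [Finset.mem_filter] at hb' ⊢
        exact ⟨hb'.1, hb'.2.1⟩
    _ ≤ _ := by
        rw [← Finset.mul_sum]
        have h1 := sum_crosses_algWeight_le hx (s := (s + 2) / 2) (by linarith) m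
        rw [show (s + 2) / 2 / 2 = (s + 2) / 4 by ring] at h1
        gcongr

/-! ### Supersolutions -/

/-- For a substochastic kernel with algebraic decay, the function `(1 + ε |n|) ^ (-s)` is a strict
supersolution if `ε` is small. Jumps shorter than a small fraction `ρ` of the distance `r` to the
origin change it by a factor close to `1`. Longer jumps have weight of order `r ^ (-s)`, and the
sum of the function over all endpoints is only of order `ε ^ (-s')` for any `s' > 1`, whereas the
function at distance `r` is of order `ε ^ (-s) * r ^ (-s)`. -/
lemma exists_supersolution {θ B s : ℝ} (hθ0 : 0 ≤ θ) (hθ : θ < 1) (hB : 0 ≤ B) (hs : 1 < s) :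
    ∃ ε θ' : ℝ, 0 < ε ∧ ε ≤ 1 ∧ θ' < 1 ∧ ∀ (V : Type) [Fintype V] (x : V → ℤ),
      Function.Injective x → ∀ (m : ℤ) (i : V) (κ : V → ℝ), (∀ l, 0 ≤ κ l) → ∑ l, κ l ≤ θ →
      (∀ l, κ l ≤ B * algWeight s (x i - x l)) →
      ∑ l, κ l * (1 + ε * |((x l - m : ℤ) : ℝ)|) ^ (-s) ≤
        θ' * (1 + ε * |((x i - m : ℤ) : ℝ)|) ^ (-s) := by
  have hs0 : 0 < s := by linarith
  -- a margin `a > 0` with `θ * (1 + a) ^ s < 1`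
  obtain ⟨a, ha, haθ⟩ : ∃ a : ℝ, 0 < a ∧ θ * (1 + a) ^ s ≤ (1 + θ) / 2 := by
    have hc : ContinuousAt (fun a : ℝ => θ * (1 + a) ^ s) 0 := by
      refine continuousAt_const.mul (ContinuousAt.rpow_const (by fun_prop) (Or.inr hs0.le))
    have h1 : ∀ᶠ a in nhds (0 : ℝ), θ * (1 + a) ^ s < (1 + θ) / 2 := by
      refine hc.eventually_lt continuousAt_const ?_
      simp
      linarith
    obtain ⟨η, hη, h2⟩ := Metric.eventually_nhds_iff.1 h1
    refine ⟨η / 2, by linarith, (h2 ?_).le⟩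
    rw [Real.dist_eq, sub_zero, abs_of_pos (by linarith)]
    linarith
  set ρ : ℝ := a / (1 + a) with hρ
  have hρ0 : 0 < ρ := by positivity
  have hρ1 : 1 - ρ = (1 + a)⁻¹ := by rw [hρ]; field_simp; ring
  set s' : ℝ := (1 + s) / 2 with hs'
  set D : ℝ := B * ρ ^ (-s) * ρ ^ (-s) * algMass s' with hD
  have hD0 : 0 ≤ D := by
    have := algMass_nonneg s'
    positivity
  -- the scale `ε` makes the contribution of the long jumps small
  obtain ⟨ε, hε, hε1, hεD⟩ : ∃ ε : ℝ, 0 < ε ∧ ε ≤ 1 ∧ D * ε ^ (s - s') ≤ (1 - θ) / 4 := by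
    have hc : ContinuousAt (fun a : ℝ => D * a ^ (s - s')) 0 :=
      continuousAt_const.mul (ContinuousAt.rpow_const (by fun_prop) (Or.inr (by rw [hs']; linarith)))
    have h1 : ∀ᶠ a in nhds (0 : ℝ), D * a ^ (s - s') < (1 - θ) / 4 := by
      refine hc.eventually_lt continuousAt_const ?_
      rw [Real.zero_rpow (by rw [hs']; linarith)]
      linarith
    obtain ⟨η, hη, h2⟩ := Metric.eventually_nhds_iff.1 h1
    refine ⟨min (η / 2) 1, by positivity, min_le_right _ _, (h2 ?_).le⟩
    rw [Real.dist_eq, sub_zero, abs_of_pos (by positivity)]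
    linarith [min_le_left (η / 2) 1]
  refine ⟨ε, (3 + θ) / 4, hε, hε1, by linarith, ?_⟩
  intro V _ x hx m i κ hκ0 hκ hκB
  set r : ℝ := |((x i - m : ℤ) : ℝ)| with hr
  have hr0 : 0 ≤ r := abs_nonneg _
  have hu : 0 < 1 + ε * r := by positivity
  have hul : ∀ l, 0 < 1 + ε * |((x l - m : ℤ) : ℝ)| := fun l => by positivity
  have hup : 0 < (1 + ε * r) ^ (-s) := Real.rpow_pos_of_pos hu _
  rcases le_or_gt (ε * r) a with hcase | hcase
  · calc _ ≤ ∑ l, κ l * 1 := by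
          refine Finset.sum_le_sum fun l _ => mul_le_mul_of_nonneg_left ?_ (hκ0 l)
          exact Real.rpow_le_one_of_one_le_of_nonpos
            (by have : 0 ≤ ε * |((x l - m : ℤ) : ℝ)| := by positivity
                linarith) (by linarith)
      _ ≤ θ := by simpa using hκ
      _ = θ * (1 + ε * r) ^ s * (1 + ε * r) ^ (-s) := by
          rw [mul_assoc, ← Real.rpow_add hu]; simp
      _ ≤ θ * (1 + a) ^ s * (1 + ε * r) ^ (-s) := by gcongr
      _ ≤ _ := by gcongr; linarith
  · have hrpos : 0 < r := by
      by_contra h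
      have : r = 0 := le_antisymm (not_lt.1 h) hr0
      rw [this] at hcase
      linarith
    have hmain : ∀ l, κ l * (1 + ε * |((x l - m : ℤ) : ℝ)|) ^ (-s) ≤
        κ l * ((1 + a) ^ s * (1 + ε * r) ^ (-s)) +
          B * (ρ * r) ^ (-s) * (ε ^ (-s') * algWeight s' (x l - m)) := by
      intro l
      have hE : (1 + ε * |((x l - m : ℤ) : ℝ)|) ^ (-s) ≤ ε ^ (-s') * algWeight s' (x l - m) := by
        unfold algWeight
        rw [← Real.mul_rpow hε.le (one_add_abs_pos _).le]
        calc _ ≤ (1 + ε * |((x l - m : ℤ) : ℝ)|) ^ (-s') :=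
              Real.rpow_le_rpow_of_exponent_le
                (by have : 0 ≤ ε * |((x l - m : ℤ) : ℝ)| := by positivity
                    linarith) (by rw [hs']; linarith)
          _ ≤ _ := Real.rpow_le_rpow_of_nonpos (by have := one_add_abs_pos (x l - m); positivity)
              (by rw [mul_add]; linarith) (by rw [hs']; linarith)
      have hA := algWeight_pos s' (x l - m)
      rcases le_or_gt |((x i - x l : ℤ) : ℝ)| (ρ * r) with hd | hd
      · have htri : r ≤ |((x i - x l : ℤ) : ℝ)| + |((x l - m : ℤ) : ℝ)| := by
          have := abs_add_le ((x i - x l : ℤ) : ℝ) ((x l - m : ℤ) : ℝ)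
          rw [hr]
          push_cast at this ⊢
          rwa [sub_add_sub_cancel] at this
        have h1 : (1 + a)⁻¹ * (1 + ε * r) ≤ 1 + ε * |((x l - m : ℤ) : ℝ)| := by
          rw [← hρ1]
          have : (1 - ρ) * r ≤ |((x l - m : ℤ) : ℝ)| := by linarith
          nlinarith
        have h2 : (1 + ε * |((x l - m : ℤ) : ℝ)|) ^ (-s) ≤ (1 + a) ^ s * (1 + ε * r) ^ (-s) := by
          calc _ ≤ ((1 + a)⁻¹ * (1 + ε * r)) ^ (-s) :=
                Real.rpow_le_rpow_of_nonpos (by positivity) h1 (by linarith)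
            _ = _ := by
                rw [Real.mul_rpow (by positivity) hu.le, Real.inv_rpow (by positivity),
                  Real.rpow_neg (by positivity) s, inv_inv]
        have h3 : 0 ≤ B * (ρ * r) ^ (-s) * (ε ^ (-s') * algWeight s' (x l - m)) := by positivity
        linarith [mul_le_mul_of_nonneg_left h2 (hκ0 l)]
      · have h1 : κ l ≤ B * (ρ * r) ^ (-s) := by
          refine (hκB l).trans (mul_le_mul_of_nonneg_left ?_ hB)
          exact Real.rpow_le_rpow_of_nonpos (by positivity) (by linarith) (by linarith)
        have h3 : 0 ≤ κ l * ((1 + a) ^ s * (1 + ε * r) ^ (-s)) := by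
          have := hκ0 l
          positivity
        have h4 : κ l * (1 + ε * |((x l - m : ℤ) : ℝ)|) ^ (-s) ≤
            B * (ρ * r) ^ (-s) * (ε ^ (-s') * algWeight s' (x l - m)) :=
          mul_le_mul h1 hE (Real.rpow_pos_of_pos (hul l) _).le (by positivity)
        linarith
    have hfar : B * (ρ * r) ^ (-s) * (ε ^ (-s') * algMass s') ≤
        D * ε ^ (s - s') * (1 + ε * r) ^ (-s) := by
      have h1 : r ^ (-s) ≤ ρ ^ (-s) * ε ^ s * (1 + ε * r) ^ (-s) := by
        have h2 : 1 + ε * r ≤ ρ⁻¹ * (ε * r) := by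
          have : ρ⁻¹ * (ε * r) = ε * r + ε * r / a := by rw [hρ]; field_simp; ring
          rw [this]
          have : 1 ≤ ε * r / a := by rw [le_div_iff₀ ha]; linarith
          linarith
        have h3 : (ρ⁻¹ * (ε * r)) ^ (-s) ≤ (1 + ε * r) ^ (-s) :=
          Real.rpow_le_rpow_of_nonpos hu h2 (by linarith)
        calc r ^ (-s) = ρ ^ (-s) * ε ^ s * (ρ⁻¹ * (ε * r)) ^ (-s) := by
              rw [Real.mul_rpow (by positivity) (by positivity), Real.mul_rpow hε.le hr0,
                Real.inv_rpow hρ0.le, Real.rpow_neg hε.le]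
              have e1 : ρ ^ (-s) ≠ 0 := (Real.rpow_pos_of_pos hρ0 _).ne'
              have e2 : ε ^ s ≠ 0 := (Real.rpow_pos_of_pos hε _).ne'
              field_simp
          _ ≤ _ := by gcongr
      have h5 : ε ^ (s - s') = ε ^ s * ε ^ (-s') := by
        rw [← Real.rpow_add hε]; congr 1
      rw [Real.mul_rpow hρ0.le hr0, hD, h5]
      have := algMass_nonneg s'
      calc _ = B * ρ ^ (-s) * ε ^ (-s') * algMass s' * r ^ (-s) := by ring
        _ ≤ B * ρ ^ (-s) * ε ^ (-s') * algMass s' * (ρ ^ (-s) * ε ^ s * (1 + ε * r) ^ (-s)) := by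
            gcongr
        _ = _ := by ring
    calc _ ≤ ∑ l, (κ l * ((1 + a) ^ s * (1 + ε * r) ^ (-s)) +
          B * (ρ * r) ^ (-s) * (ε ^ (-s') * algWeight s' (x l - m))) :=
          Finset.sum_le_sum fun l _ => hmain l
      _ = (∑ l, κ l) * ((1 + a) ^ s * (1 + ε * r) ^ (-s)) +
          B * (ρ * r) ^ (-s) * (ε ^ (-s') * ∑ l, algWeight s' (x l - m)) := by
          rw [Finset.sum_add_distrib, Finset.sum_mul, Finset.mul_sum, Finset.mul_sum]
      _ ≤ θ * ((1 + a) ^ s * (1 + ε * r) ^ (-s)) +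
          B * (ρ * r) ^ (-s) * (ε ^ (-s') * algMass s') := by
          have := sum_algWeight_le (s := s') (by rw [hs']; linarith) hx m
          gcongr
      _ ≤ (1 + θ) / 2 * (1 + ε * r) ^ (-s) + (1 - θ) / 4 * (1 + ε * r) ^ (-s) := by
          rw [← mul_assoc]
          have := mul_le_mul_of_nonneg_right haθ hup.le
          have := mul_le_mul_of_nonneg_right hεD hup.le
          linarith
      _ = _ := by ring

/-- A bounded subsolution `g ≤ ∑ κ g` of a substochastic equation away from a site `j` inherits the
algebraic decay of the kernel, uniformly in the finite set of sites. -/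
theorem exists_decay_of_subsolution {θ B s : ℝ} (L : ℝ) (hθ0 : 0 ≤ θ) (hθ : θ < 1) (hB : 0 ≤ B)
    (hs : 1 < s) :
    ∃ C : ℝ, 0 < C ∧ ∀ (V : Type) [Fintype V] (x : V → ℤ), Function.Injective x →
      ∀ (j : V) (κ : V → V → ℝ) (g : V → ℝ), (∀ i l, 0 ≤ κ i l) → (∀ i, ∑ l, κ i l ≤ θ) →
      (∀ i l, κ i l ≤ B * algWeight s (x i - x l)) → (∀ i, g i ≤ 1) →
      (∀ i, L < |((x i - x j : ℤ) : ℝ)| → g i ≤ ∑ l, κ i l * g l) →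
      ∀ i, g i ≤ C * algWeight s (x i - x j) := by
  obtain ⟨ε, θ', hε, hε1, hθ', hsup⟩ := exists_supersolution hθ0 hθ hB hs
  have hs0 : 0 < s := by linarith
  refine ⟨(1 + |L|) ^ s * ε ^ (-s), by positivity, ?_⟩
  intro V _ x hx j κ g hκ0 hκ hκB hg1 hg i
  set u : V → ℝ := fun l => (1 + ε * |((x l - x j : ℤ) : ℝ)|) ^ (-s) with hu
  have hu0 : ∀ l, 0 < u l := fun l => Real.rpow_pos_of_pos (by positivity) _
  -- the site where `g / u` is maximal
  obtain ⟨p, -, hp⟩ := Finset.exists_max_image Finset.univ (fun l => g l / u l) ⟨i, by simp⟩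
  have hΓ : ∀ l, g l ≤ g p / u p * u l := fun l => by
    have := hp l (by simp)
    rwa [div_le_iff₀ (hu0 l)] at this
  have hΓle : g p / u p ≤ (1 + |L|) ^ s := by
    rcases le_or_gt |((x p - x j : ℤ) : ℝ)| L with h | h
    · have h1 : ((1 + |L|) ^ s)⁻¹ ≤ u p := by
        rw [← Real.rpow_neg (by positivity)]
        refine Real.rpow_le_rpow_of_nonpos (by positivity) ?_ (by linarith)
        have := mul_le_mul_of_nonneg_right hε1 (abs_nonneg ((x p - x j : ℤ) : ℝ))
        linarith [le_abs_self L]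
      rw [div_le_iff₀ (hu0 p)]
      have h2 : 0 < (1 + |L|) ^ s := by positivity
      have := mul_le_mul_of_nonneg_left h1 h2.le
      rw [mul_inv_cancel₀ h2.ne'] at this
      exact (hg1 p).trans this
    · have h0 : g p / u p ≤ 0 := by
        by_contra hneg
        push Not at hneg
        have h1 : g p ≤ g p / u p * (θ' * u p) := by
          calc g p ≤ ∑ l, κ p l * g l := hg p h
            _ ≤ ∑ l, κ p l * (g p / u p * u l) :=
                Finset.sum_le_sum fun l _ => mul_le_mul_of_nonneg_left (hΓ l) (hκ0 p l)
            _ = g p / u p * ∑ l, κ p l * u l := by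
                rw [Finset.mul_sum]
                exact Finset.sum_congr rfl fun l _ => by ring
            _ ≤ _ := mul_le_mul_of_nonneg_left
                (hsup V x hx (x j) p (κ p) (hκ0 p) (hκ p) (hκB p)) hneg.le
        have h2 : g p / u p * u p = g p := div_mul_cancel₀ _ (hu0 p).ne'
        have h3 : 0 < g p := by rw [← h2]; exact mul_pos hneg (hu0 p)
        have h4 : g p / u p * (θ' * u p) = θ' * g p := by rw [← h2]; field_simp
        rw [h4] at h1
        nlinarith
      exact h0.trans (by positivity)
  have hui : u i ≤ ε ^ (-s) * algWeight s (x i - x j) := by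
    unfold algWeight
    rw [← Real.mul_rpow hε.le (one_add_abs_pos _).le]
    refine Real.rpow_le_rpow_of_nonpos (by have := one_add_abs_pos (x i - x j); positivity) ?_
      (by linarith)
    rw [mul_add]
    linarith
  calc g i ≤ g p / u p * u i := hΓ i
    _ ≤ (1 + |L|) ^ s * u i := mul_le_mul_of_nonneg_right hΓle (hu0 i).le
    _ ≤ (1 + |L|) ^ s * (ε ^ (-s) * algWeight s (x i - x j)) := by gcongr
    _ = _ := by ring

/-! ### Ising systems and Griffiths inequalities -/

section Ising

variable {V : Type}

/-- The spin of the configuration `σ` at the site `k`, as a real number. -/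
def spin (σ : V → ℤˣ) (k : V) : ℝ := ((σ k : ℤ) : ℝ)

lemma spin_mul (σ τ : V → ℤˣ) (k : V) : spin (σ * τ) k = spin σ k * spin τ k := by
  simp [spin]

lemma spin_eq (σ : V → ℤˣ) (k : V) : spin σ k = 1 ∨ spin σ k = -1 := by
  rcases Int.units_eq_one_or (σ k) with h | h <;> simp [spin, h]

/-- The product of the two spins of a bond. -/
def bondSpin (b : V × V) (σ : V → ℤˣ) : ℝ := spin σ b.1 * spin σ b.2

lemma bondSpin_mul (b : V × V) (σ τ : V → ℤˣ) :
    bondSpin b (σ * τ) = bondSpin b σ * bondSpin b τ := by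
  simp only [bondSpin, spin_mul]; ring

lemma bondSpin_eq (b : V × V) (σ : V → ℤˣ) : bondSpin b σ = 1 ∨ bondSpin b σ = -1 := by
  rcases spin_eq σ b.1 with h | h <;> rcases spin_eq σ b.2 with h' | h' <;> simp [bondSpin, h, h']

lemma bondSpin_mul_self (b : V × V) (σ : V → ℤˣ) : bondSpin b σ * bondSpin b σ = 1 := by
  rcases bondSpin_eq b σ with h | h <;> simp [h]

variable [Fintype V] [DecidableEq V]

/-- All mixed moments of the spins against `G` are nonnegative. -/
def PosMoments (G : (V → ℤˣ) → ℝ) : Prop :=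
  ∀ n : V → ℕ, 0 ≤ ∑ σ, G σ * ∏ k, spin σ k ^ n k

/-- The Griffiths cone: functions which preserve nonnegativity of all moments. It is closed under
sums and products and contains the spins. -/
def GriffithsCone (F : (V → ℤˣ) → ℝ) : Prop :=
  ∀ G, PosMoments G → PosMoments (fun σ => F σ * G σ)

lemma posMoments_one : PosMoments (fun _ : V → ℤˣ => (1 : ℝ)) := by
  intro n
  have h := Finset.prod_univ_sum (fun _ : V => (Finset.univ : Finset ℤˣ))
    (fun k u => (((u : ℤ) : ℝ)) ^ n k)
  rw [Fintype.piFinset_univ] at h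
  simp only [one_mul, spin]
  rw [← h]
  refine Finset.prod_nonneg fun k _ => ?_
  have : (Finset.univ : Finset ℤˣ) = {1, -1} := rfl
  rw [this, Finset.sum_insert (by decide), Finset.sum_singleton]
  simp only [Units.val_one, Int.cast_one, one_pow, Units.val_neg, Int.cast_neg]
  rcases neg_one_pow_eq_or ℝ (n k) with h | h <;> simp [h]

namespace GriffithsCone

lemma const {c : ℝ} (hc : 0 ≤ c) : GriffithsCone (fun _ : V → ℤˣ => c) := by
  intro G hG n
  simp_rw [mul_assoc]
  rw [← Finset.mul_sum]
  exact mul_nonneg hc (hG n)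

lemma add {F F' : (V → ℤˣ) → ℝ} (h : GriffithsCone F) (h' : GriffithsCone F') :
    GriffithsCone (fun σ => F σ + F' σ) := by
  intro G hG n
  simp_rw [add_mul]
  rw [Finset.sum_add_distrib]
  exact add_nonneg (h G hG n) (h' G hG n)

lemma mul {F F' : (V → ℤˣ) → ℝ} (h : GriffithsCone F) (h' : GriffithsCone F') :
    GriffithsCone (fun σ => F σ * F' σ) := by
  intro G hG
  simp_rw [mul_assoc]
  exact h _ (h' G hG)

lemma spin (k : V) : GriffithsCone (fun σ => spin σ k) := by
  intro G hG n
  have := hG (n + Pi.single k 1)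
  refine this.trans_eq (Finset.sum_congr rfl fun σ _ => ?_)
  simp only [Pi.add_apply, pow_add, Finset.prod_mul_distrib]
  have h1 : ∏ l, SpinLattice.spin σ l ^ (Pi.single k 1 : V → ℕ) l = SpinLattice.spin σ k := by
    rw [Finset.prod_eq_single k]
    · simp
    · intro l _ hl
      simp [hl]
    · simp
  rw [h1]
  ring

lemma bondSpin (b : V × V) : GriffithsCone (bondSpin b) := (spin b.1).mul (spin b.2)

lemma prod {ι : Type*} (s : Finset ι) {F : ι → (V → ℤˣ) → ℝ}
    (h : ∀ b ∈ s, GriffithsCone (F b)) : GriffithsCone (fun σ => ∏ b ∈ s, F b σ) := by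
  classical
  induction s using Finset.induction_on with
  | empty => simpa using const (zero_le_one)
  | insert b s hb ih =>
    simp_rw [Finset.prod_insert hb]
    exact (h b (by simp)).mul (ih fun c hc => h c (by simp [hc]))

/-- Griffiths' first inequality. -/
lemma sum_nonneg {F : (V → ℤˣ) → ℝ} (h : GriffithsCone F) : 0 ≤ ∑ σ, F σ := by
  simpa using h _ posMoments_one 0

end GriffithsCone

/-- The Ising weight `∏ b, (1 + t b * σ_b)`, proportional to `exp (∑ b, J b * σ_b)` for
`t b = tanh (J b)`. The value `t b = 1` is an infinite coupling, and `t b = 0` removes the bond.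
Bonds are ordered pairs of sites. -/
def isingWeight (t : V × V → ℝ) (σ : V → ℤˣ) : ℝ := ∏ b, (1 + t b * bondSpin b σ)

/-- The unnormalized expectation of `F` in the Ising system with bond parameters `t`. -/
def isingSum (t : V × V → ℝ) (F : (V → ℤˣ) → ℝ) : ℝ := ∑ σ, F σ * isingWeight t σ

/-- The partition function. -/
def isingZ (t : V × V → ℝ) : ℝ := ∑ σ, isingWeight t σ

/-- The expectation of the product of the two spins of a bond. -/
def isingCorr (t : V × V → ℝ) (b : V × V) : ℝ := isingSum t (bondSpin b) / isingZ t

/-- Admissible bond parameters. -/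
def Admissible (t : V × V → ℝ) : Prop := ∀ b, 0 ≤ t b ∧ t b ≤ 1

lemma isingWeight_nonneg {t : V × V → ℝ} (ht : Admissible t) (σ : V → ℤˣ) :
    0 ≤ isingWeight t σ := by
  refine Finset.prod_nonneg fun b _ => ?_
  rcases bondSpin_eq b σ with h | h <;> rw [h] <;> linarith [(ht b).1, (ht b).2]

lemma isingWeight_one_pos {t : V × V → ℝ} (ht : Admissible t) : 0 < isingWeight t 1 := by
  refine Finset.prod_pos fun b _ => ?_
  have : bondSpin b (1 : V → ℤˣ) = 1 := by simp [bondSpin, spin]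
  rw [this]
  linarith [(ht b).1]

lemma isingZ_pos {t : V × V → ℝ} (ht : Admissible t) : 0 < isingZ t :=
  Finset.sum_pos' (fun σ _ => isingWeight_nonneg ht σ) ⟨1, by simp, isingWeight_one_pos ht⟩

lemma isingSum_one (t : V × V → ℝ) : isingSum t (fun _ => 1) = isingZ t := by
  simp [isingSum, isingZ]

lemma isingWeight_cone {t : V × V → ℝ} (ht : Admissible t) : GriffithsCone (isingWeight t) :=
  GriffithsCone.prod _ fun b _ => (GriffithsCone.const zero_le_one).add
    ((GriffithsCone.const (ht b).1).mul (GriffithsCone.bondSpin b))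

lemma isingSum_nonneg {t : V × V → ℝ} (ht : Admissible t) {F : (V → ℤˣ) → ℝ}
    (hF : GriffithsCone F) : 0 ≤ isingSum t F :=
  (hF.mul (isingWeight_cone ht)).sum_nonneg

lemma isingCorr_nonneg {t : V × V → ℝ} (ht : Admissible t) (b : V × V) : 0 ≤ isingCorr t b :=
  div_nonneg (isingSum_nonneg ht (GriffithsCone.bondSpin b)) (isingZ_pos ht).le

lemma isingSum_bondSpin_le {t : V × V → ℝ} (ht : Admissible t) (b : V × V) :
    isingSum t (bondSpin b) ≤ isingZ t := by
  refine Finset.sum_le_sum fun σ _ => ?_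
  have := isingWeight_nonneg ht σ
  rcases bondSpin_eq b σ with h | h <;> rw [h] <;> linarith

lemma isingCorr_le_one {t : V × V → ℝ} (ht : Admissible t) (b : V × V) : isingCorr t b ≤ 1 :=
  div_le_one_of_le₀ (isingSum_bondSpin_le ht b) (isingZ_pos ht).le

lemma isingCorr_swap (t : V × V → ℝ) (i j : V) : isingCorr t (i, j) = isingCorr t (j, i) := by
  have : (bondSpin (i, j) : (V → ℤˣ) → ℝ) = bondSpin (j, i) := by
    funext σ; simp [bondSpin, mul_comm]
  rw [isingCorr, this, isingCorr]

lemma sum_sum_eq_sum_sum_mul (f : (V → ℤˣ) → (V → ℤˣ) → ℝ) :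
    ∑ σ, ∑ σ', f σ σ' = ∑ τ, ∑ σ, f σ (σ * τ) := by
  rw [Finset.sum_comm (f := fun τ σ => f σ (σ * τ))]
  exact Finset.sum_congr rfl fun σ _ => (Equiv.sum_comp (Equiv.mulLeft σ) (f σ)).symm

/-- Griffiths' second inequality, in Ginibre's form: with two different sets of bond parameters it
contains both the positivity of correlations and their monotonicity. With `σ' = σ * τ` the weight of
a pair of configurations is `(1 + t' σ_b) (1 + t τ_b σ_b) = 1 + t t' τ_b + (t' + t τ_b) σ_b`, which
has nonnegative coefficients. -/
theorem isingSum_mul_le {t t' : V × V → ℝ} (ht : Admissible t) (ht' : Admissible t')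
    (h : ∀ b, t b ≤ t' b) {F : (V → ℤˣ) → ℝ} (hF : GriffithsCone F) (c : V × V) :
    isingSum t' F * isingSum t (bondSpin c) ≤
      isingSum t' (fun σ => F σ * bondSpin c σ) * isingZ t := by
  have key : isingSum t' (fun σ => F σ * bondSpin c σ) * isingZ t -
      isingSum t' F * isingSum t (bondSpin c) =
      ∑ τ, (1 - bondSpin c τ) *
        ∑ σ, F σ * bondSpin c σ * (isingWeight t' σ * isingWeight t (σ * τ)) := by
    simp only [isingSum, isingZ, Finset.sum_mul_sum]
    rw [← Finset.sum_sub_distrib]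
    simp_rw [← Finset.sum_sub_distrib, Finset.mul_sum]
    rw [sum_sum_eq_sum_sum_mul (fun σ σ' => F σ * bondSpin c σ * isingWeight t' σ * isingWeight t σ'
      - F σ * isingWeight t' σ * (bondSpin c σ' * isingWeight t σ'))]
    refine Finset.sum_congr rfl fun τ _ => Finset.sum_congr rfl fun σ _ => ?_
    rw [bondSpin_mul]
    ring
  have hnn : 0 ≤ ∑ τ, (1 - bondSpin c τ) *
        ∑ σ, F σ * bondSpin c σ * (isingWeight t' σ * isingWeight t (σ * τ)) := by
    refine Finset.sum_nonneg fun τ _ => mul_nonneg ?_ ?_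
    · rcases bondSpin_eq c τ with h | h <;> rw [h] <;> norm_num
    · refine ((hF.mul (GriffithsCone.bondSpin c)).mul (F' := fun σ => isingWeight t' σ *
        isingWeight t (σ * τ)) ?_).sum_nonneg
      have hw : ∀ σ, isingWeight t' σ * isingWeight t (σ * τ) =
          ∏ b, (1 + t' b * t b * bondSpin b τ + (t' b + t b * bondSpin b τ) * bondSpin b σ) := by
        intro σ
        rw [isingWeight, isingWeight, ← Finset.prod_mul_distrib]
        refine Finset.prod_congr rfl fun b _ => ?_
        rw [bondSpin_mul]
        linear_combination (t' b * t b * bondSpin b τ) * bondSpin_mul_self b σ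
      simp_rw [hw]
      refine GriffithsCone.prod _ fun b _ => (GriffithsCone.const ?_).add
        ((GriffithsCone.const ?_).mul (GriffithsCone.bondSpin b))
      · have h1 := ht b; have h2 := ht' b
        have : t' b * t b ≤ 1 := mul_le_one₀ h2.2 h1.1 h1.2
        have h0 : 0 ≤ t' b * t b := mul_nonneg h2.1 h1.1
        rcases bondSpin_eq b τ with h | h <;> rw [h] <;> linarith
      · have h1 := ht b; have h2 := ht' b
        rcases bondSpin_eq b τ with h3 | h3 <;> rw [h3] <;> linarith [h b]
  linarith

lemma isingCorr_mono {t t' : V × V → ℝ} (ht : Admissible t) (ht' : Admissible t')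
    (h : ∀ b, t b ≤ t' b) (c : V × V) : isingCorr t c ≤ isingCorr t' c := by
  have := isingSum_mul_le ht ht' h (GriffithsCone.const zero_le_one) c
  simp only [isingSum_one, one_mul] at this
  rw [isingCorr, isingCorr, div_le_div_iff₀ (isingZ_pos ht) (isingZ_pos ht')]
  linarith

end Ising

/-! ### Removing and contracting bonds -/

section Bonds

variable {V : Type} [Fintype V] [DecidableEq V]

/-- Bond parameters with the bonds in `B` removed. -/
def removeBonds (B : Finset (V × V)) (t : V × V → ℝ) (b : V × V) : ℝ := if b ∈ B then 0 else t b

/-- Bond parameters with the bonds in `B` contracted, i.e. with infinite coupling. -/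
def contractBonds (B : Finset (V × V)) (t : V × V → ℝ) (b : V × V) : ℝ := if b ∈ B then 1 else t b

lemma admissible_removeBonds {t : V × V → ℝ} (ht : Admissible t) (B : Finset (V × V)) :
    Admissible (removeBonds B t) := fun b => by
  unfold removeBonds; split_ifs
  · norm_num
  · exact ht b

lemma admissible_contractBonds {t : V × V → ℝ} (ht : Admissible t) (B : Finset (V × V)) :
    Admissible (contractBonds B t) := fun b => by
  unfold contractBonds; split_ifs
  · norm_num
  · exact ht b

lemma removeBonds_le {t : V × V → ℝ} (ht : Admissible t) (B : Finset (V × V)) (b : V × V) :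
    removeBonds B t b ≤ t b := by
  unfold removeBonds; split_ifs
  · exact (ht b).1
  · exact le_rfl

/-- The probability that a bond is closed in the random cluster representation; it equals
`exp (-2 J)` for `t = tanh J`. -/
def closedProb (r : ℝ) : ℝ := (1 - r) / (1 + r)

lemma closedProb_zero : closedProb 0 = 1 := by simp [closedProb]

lemma closedProb_nonneg {r : ℝ} (h : 0 ≤ r ∧ r ≤ 1) : 0 ≤ closedProb r :=
  div_nonneg (by linarith) (by linarith)

lemma closedProb_le_one {r : ℝ} (h : 0 ≤ r ∧ r ≤ 1) : closedProb r ≤ 1 :=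
  div_le_one_of_le₀ (by linarith) (by linarith)

lemma le_one_sub_closedProb {r : ℝ} (h : 0 ≤ r ∧ r ≤ 1) : r ≤ 1 - closedProb r := by
  have h1 : 0 < 1 + r := by linarith
  have : 1 - closedProb r = 2 * r / (1 + r) := by rw [closedProb]; field_simp; ring
  rw [this, le_div_iff₀ h1]
  nlinarith

/-- The weight is affine in each bond parameter. -/
lemma isingSum_update (t : V × V → ℝ) (c : V × V) (r : ℝ) (F : (V → ℤˣ) → ℝ) :
    isingSum (Function.update t c r) F =
      isingSum (Function.update t c 0) F +
        r * isingSum (Function.update t c 0) (fun σ => F σ * bondSpin c σ) := by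
  have hw : ∀ (r : ℝ) (σ : V → ℤˣ), isingWeight (Function.update t c r) σ =
      (1 + r * bondSpin c σ) * ∏ b ∈ Finset.univ.erase c, (1 + t b * bondSpin b σ) := by
    intro r σ
    rw [isingWeight, ← Finset.mul_prod_erase _ _ (Finset.mem_univ c)]
    congr 1
    · simp
    · refine Finset.prod_congr rfl fun b hb => ?_
      rw [Function.update_of_ne (Finset.ne_of_mem_erase hb)]
  simp only [isingSum, hw]
  rw [Finset.mul_sum, ← Finset.sum_add_distrib]
  exact Finset.sum_congr rfl fun σ _ => by ring

lemma admissible_update {t : V × V → ℝ} (ht : Admissible t) (c : V × V) {r : ℝ}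
    (hr : 0 ≤ r ∧ r ≤ 1) : Admissible (Function.update t c r) := fun b => by
  by_cases hb : b = c
  · subst hb; simpa using hr
  · rw [Function.update_of_ne hb]; exact ht b

/-- Domination by independent bond percolation, one bond at a time: the correlation is at most the
average over closing and contracting the bond independently of everything else. -/
lemma isingCorr_le_update {t : V × V → ℝ} (ht : Admissible t) (c e : V × V) :
    isingCorr t e ≤ closedProb (t c) * isingCorr (Function.update t c 0) e +
      (1 - closedProb (t c)) * isingCorr (Function.update t c 1) e := by
  set t₀ := Function.update t c 0 with ht₀
  have hadm : Admissible t₀ := admissible_update ht c (by norm_num)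
  set z := isingZ t₀
  set a := isingSum t₀ (bondSpin e)
  set d := isingSum t₀ (bondSpin c)
  set q := isingSum t₀ (fun σ => bondSpin e σ * bondSpin c σ)
  have hz : 0 < z := isingZ_pos hadm
  have hd0 : 0 ≤ d := isingSum_nonneg hadm (GriffithsCone.bondSpin c)
  have hdz : d ≤ z := isingSum_bondSpin_le hadm c
  have hgks : a * d ≤ q * z :=
    isingSum_mul_le hadm hadm (fun _ => le_rfl) (GriffithsCone.bondSpin e) c
  have hS : ∀ r, isingCorr (Function.update t c r) e = (a + r * q) / (z + r * d) := by
    intro r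
    have hZ : isingZ (Function.update t c r) = z + r * d := by
      have := isingSum_update t c r (fun _ => 1)
      simp only [one_mul, isingSum_one] at this
      exact this
    rw [isingCorr, isingSum_update, hZ]
  have hr := ht c
  have h1 := hS (t c)
  rw [Function.update_eq_self] at h1
  rw [h1, hS 1]
  have h0 : isingCorr t₀ e = a / z := rfl
  rw [h0]
  set r := t c
  have hden : 0 < z + r * d := by nlinarith
  have hden1 : 0 < z + 1 * d := by linarith
  have hr1 : 0 < 1 + r := by linarith
  rw [closedProb]
  have e1 : (1 - r) / (1 + r) * (a / z) + (1 - (1 - r) / (1 + r)) * ((a + 1 * q) / (z + 1 * d)) -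
      (a + r * q) / (z + r * d) =
      r * (1 - r) * (z - d) * (q * z - a * d) / ((1 + r) * z * (z + d) * (z + r * d)) := by
    have : z + d ≠ 0 := by linarith
    field_simp
    ring
  have e2 : 0 ≤ r * (1 - r) * (z - d) * (q * z - a * d) /
      ((1 + r) * z * (z + d) * (z + r * d)) := by
    refine div_nonneg ?_ (by positivity)
    refine mul_nonneg (mul_nonneg (mul_nonneg hr.1 (by linarith [hr.2])) (by linarith))
      (by linarith)
  linarith

lemma removeBonds_insert (B : Finset (V × V)) (c : V × V) (t : V × V → ℝ) :
    removeBonds (insert c B) t = removeBonds B (Function.update t c 0) := by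
  funext b
  by_cases hb : b = c
  · subst hb; simp [removeBonds]
  · simp [removeBonds, hb]

/-- Domination by independent bond percolation for a set of bonds, distinguishing only whether all
of them are closed. -/
lemma isingCorr_le_removeBonds (B : Finset (V × V)) {t : V × V → ℝ} (ht : Admissible t)
    (e : V × V) :
    isingCorr t e ≤ (∏ b ∈ B, closedProb (t b)) * isingCorr (removeBonds B t) e +
      (1 - ∏ b ∈ B, closedProb (t b)) * isingCorr (contractBonds B t) e := by
  induction B using Finset.induction_on generalizing t with
  | empty =>
    have : removeBonds ∅ t = t := by funext b; simp [removeBonds]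
    simp [this]
  | insert c B hc ih =>
    have h0 : Admissible (Function.update t c 0) := admissible_update ht c (by norm_num)
    have hp : ∏ b ∈ B, closedProb (Function.update t c 0 b) = ∏ b ∈ B, closedProb (t b) :=
      Finset.prod_congr rfl fun b hb => by
        rw [Function.update_of_ne (ne_of_mem_of_not_mem hb hc)]
    have h1 := isingCorr_le_update ht c e
    have h2 := ih h0
    rw [hp, ← removeBonds_insert] at h2
    have hP1 : ∏ b ∈ B, closedProb (t b) ≤ 1 :=
      Finset.prod_le_one (fun b _ => closedProb_nonneg (ht b)) fun b _ => closedProb_le_one (ht b)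
    have hk0 := closedProb_nonneg (ht c)
    have hk1 := closedProb_le_one (ht c)
    have hadm := admissible_contractBonds ht (insert c B)
    have h3 : isingCorr (contractBonds B (Function.update t c 0)) e ≤
        isingCorr (contractBonds (insert c B) t) e := by
      refine isingCorr_mono (admissible_contractBonds h0 B) hadm (fun b => ?_) e
      by_cases hb : b = c
      · subst hb
        simp only [contractBonds, Finset.mem_insert_self, if_true]
        exact (admissible_contractBonds h0 B b).2
      · simp [contractBonds, hb]
    have h4 : isingCorr (Function.update t c 1) e ≤
        isingCorr (contractBonds (insert c B) t) e := by
      refine isingCorr_mono (admissible_update ht c (by norm_num)) hadm (fun b => ?_) e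
      by_cases hb : b = c
      · subst hb; simp [contractBonds]
      · rw [Function.update_of_ne hb]
        simp only [contractBonds, Finset.mem_insert, hb, false_or]
        split_ifs
        · exact (ht b).2
        · exact le_rfl
    rw [Finset.prod_insert hc]
    set P := ∏ b ∈ B, closedProb (t b)
    set k := closedProb (t c)
    set X := isingCorr (contractBonds (insert c B) t) e
    set Y := isingCorr (removeBonds (insert c B) t) e
    have h5 : (1 - P) * isingCorr (contractBonds B (Function.update t c 0)) e ≤ (1 - P) * X :=
      mul_le_mul_of_nonneg_left h3 (by linarith)
    have h6 : (1 - k) * isingCorr (Function.update t c 1) e ≤ (1 - k) * X :=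
      mul_le_mul_of_nonneg_left h4 (by linarith)
    have h7 : k * isingCorr (Function.update t c 0) e ≤ k * (P * Y + (1 - P) * X) :=
      mul_le_mul_of_nonneg_left (h2.trans (by linarith)) hk0
    calc _ ≤ k * (P * Y + (1 - P) * X) + (1 - k) * X := h1.trans (by linarith)
      _ = _ := by ring

/-- Two sites which are separated by a set of removed bonds are uncorrelated: flip all spins on one
side. -/
lemma isingSum_eq_zero_of_separated {t : V × V → ℝ} (P : V → Prop) [DecidablePred P]
    (h : ∀ b : V × V, ¬ (P b.1 ↔ P b.2) → t b = 0) {e : V × V} (he : ¬ (P e.1 ↔ P e.2)) :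
    isingSum t (bondSpin e) = 0 := by
  let τ : V → ℤˣ := fun k => if P k then -1 else 1
  have hτ : ∀ b : V × V, bondSpin b τ = if (P b.1 ↔ P b.2) then 1 else -1 := by
    intro b
    by_cases h1 : P b.1 <;> by_cases h2 : P b.2 <;> simp [bondSpin, spin, τ, h1, h2]
  have hw : ∀ σ : V → ℤˣ, isingWeight t (σ * τ) = isingWeight t σ := by
    intro σ
    refine Finset.prod_congr rfl fun b _ => ?_
    rw [bondSpin_mul, hτ]
    split_ifs with hb
    · simp
    · simp [h b hb]
  have hflip : isingSum t (bondSpin e) = -isingSum t (bondSpin e) := by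
    conv_lhs => rw [isingSum, ← Equiv.sum_comp (Equiv.mulRight τ)]
    rw [isingSum, ← Finset.sum_neg_distrib]
    refine Finset.sum_congr rfl fun σ _ => ?_
    rw [Equiv.coe_mulRight, hw, bondSpin_mul, hτ, if_neg he]
    ring
  linarith

lemma isingCorr_eq_zero_of_separated {t : V × V → ℝ} (P : V → Prop) [DecidablePred P]
    (h : ∀ b : V × V, ¬ (P b.1 ↔ P b.2) → t b = 0) {e : V × V} (he : ¬ (P e.1 ↔ P e.2)) :
    isingCorr t e = 0 := by
  rw [isingCorr, isingSum_eq_zero_of_separated P h he, zero_div]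

/-! ### Cut points -/

lemma crosses_iff (m k l : ℤ) : Crosses m k l ↔ ¬ (k ≤ m ↔ l ≤ m) := by
  unfold Crosses
  constructor
  · rintro (⟨h1, h2⟩ | ⟨h1, h2⟩) <;> lia
  · intro h
    by_cases h1 : k ≤ m <;> by_cases h2 : l ≤ m
    · exact absurd ⟨fun _ => h2, fun _ => h1⟩ h
    · exact Or.inl ⟨h1, by lia⟩
    · exact Or.inr ⟨h2, by lia⟩
    · exact absurd ⟨fun h => absurd h h1, fun h => absurd h h2⟩ h

/-- If no bond crosses two of the given cuts between `i` and `j`, each cut contributes a factor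
`1 - c`, where `c` is a lower bound for the probability that no bond crosses the cut. -/
lemma isingCorr_le_pow_of_cuts (x : V → ℤ) {c : ℝ} (hc1 : c ≤ 1) (e : V × V)
    (ms : Finset ℤ) {t : V × V → ℝ} (ht : Admissible t)
    (hsep : ∀ b, t b ≠ 0 → ∀ m ∈ ms, ∀ m' ∈ ms, Crosses m (x b.1) (x b.2) →
      Crosses m' (x b.1) (x b.2) → m = m')
    (hc : ∀ m ∈ ms, c ≤ ∏ b : V × V with Crosses m (x b.1) (x b.2), closedProb (t b))
    (he : ∀ m ∈ ms, Crosses m (x e.1) (x e.2)) :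
    isingCorr t e ≤ (1 - c) ^ ms.card := by
  induction ms using Finset.induction_on generalizing t with
  | empty => simpa using isingCorr_le_one ht e
  | insert m ms hm ih =>
    set B : Finset (V × V) :=
      Finset.univ.filter (fun b : V × V => Crosses m (x b.1) (x b.2) ∧ t b ≠ 0) with hB
    have hprod : ∏ b ∈ B, closedProb (t b) =
        ∏ b : V × V with Crosses m (x b.1) (x b.2), closedProb (t b) := by
      refine Finset.prod_subset (fun b hb => ?_) (fun b hb hb' => ?_)
      · simp only [hB, Finset.mem_filter] at hb ⊢
        exact ⟨hb.1, hb.2.1⟩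
      · have h0 : t b = 0 := by
          by_contra h0
          simp only [hB, Finset.mem_filter] at hb hb'
          exact hb' ⟨hb.1, hb.2, h0⟩
        rw [h0, closedProb_zero]
    have h1 := isingCorr_le_removeBonds B ht e
    have h2 : isingCorr (removeBonds B t) e = 0 := by
      refine isingCorr_eq_zero_of_separated (fun k => x k ≤ m) (fun b hb => ?_) ?_
      · by_cases h0 : t b = 0
        · simp [removeBonds, h0]
        · have : b ∈ B := by
            simp only [hB, Finset.mem_filter, Finset.mem_univ, true_and]
            exact ⟨(crosses_iff _ _ _).2 hb, h0⟩
          simp [removeBonds, this]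
      · exact (crosses_iff _ _ _).1 (he m (by simp))
    have hne : ∀ b, contractBonds B t b ≠ 0 → t b ≠ 0 := by
      intro b hb h0
      apply hb
      have : b ∉ B := by simp [hB, h0]
      simp [contractBonds, this, h0]
    have h3 := ih (admissible_contractBonds ht B)
      (fun b hb m₁ hm₁ m₂ hm₂ => hsep b (hne b hb) m₁ (by simp [hm₁]) m₂ (by simp [hm₂]))
      (fun m' hm' => by
        refine (hc m' (by simp [hm'])).trans_eq (Finset.prod_congr rfl fun b hb => ?_)
        have : b ∉ B := by
          intro hbB
          simp only [hB, Finset.mem_filter] at hb hbB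
          exact hm (hsep b hbB.2.2 m (by simp) m' (by simp [hm']) hbB.2.1 hb.2 ▸ hm')
        simp [contractBonds, this])
      (fun m' hm' => he m' (by simp [hm']))
    rw [h2, mul_zero, zero_add, hprod] at h1
    rw [Finset.card_insert_of_notMem hm, pow_succ]
    have hcm := hc m (by simp)
    have hP1 : ∏ b : V × V with Crosses m (x b.1) (x b.2), closedProb (t b) ≤ 1 :=
      Finset.prod_le_one (fun b _ => closedProb_nonneg (ht b)) fun b _ => closedProb_le_one (ht b)
    have h4 : 0 ≤ isingCorr (contractBonds B t) e :=
      isingCorr_nonneg (admissible_contractBonds ht B) e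
    calc isingCorr t e ≤ _ := h1
      _ ≤ (1 - c) * isingCorr (contractBonds B t) e := by gcongr
      _ ≤ (1 - c) * (1 - c) ^ ms.card := by
          have : 0 ≤ 1 - c := by linarith
          gcongr
      _ = _ := mul_comm _ _

/-- The bond parameters decay algebraically. In terms of `t = tanh J` the condition says
`2 * J b ≤ B * (1 + |x k - x l|) ^ (-s)` for the bond `b = (k, l)`. -/
structure AlgBonds (s B : ℝ) (x : V → ℤ) (t : V × V → ℝ) : Prop where
  admissible : Admissible t
  exp_le : ∀ b, Real.exp (-(B * algWeight s (x b.1 - x b.2))) ≤ closedProb (t b)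

lemma AlgBonds.one_sub_le {s B : ℝ} {x : V → ℤ} {t : V × V → ℝ} (h : AlgBonds s B x t)
    (b : V × V) : 1 - closedProb (t b) ≤ B * algWeight s (x b.1 - x b.2) := by
  have h1 := h.exp_le b
  have h2 := Real.add_one_le_exp (-(B * algWeight s (x b.1 - x b.2)))
  linarith

lemma AlgBonds.le {s B : ℝ} {x : V → ℤ} {t : V × V → ℝ} (h : AlgBonds s B x t) (b : V × V) :
    t b ≤ B * algWeight s (x b.1 - x b.2) :=
  (le_one_sub_closedProb (h.admissible b)).trans (h.one_sub_le b)

lemma AlgBonds.exp_le_prod {s B : ℝ} {x : V → ℤ} {t : V × V → ℝ} (h : AlgBonds s B x t)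
    (S : Finset (V × V)) : Real.exp (-(B * ∑ b ∈ S, algWeight s (x b.1 - x b.2))) ≤
      ∏ b ∈ S, closedProb (t b) := by
  rw [Finset.mul_sum, ← Finset.sum_neg_distrib, Real.exp_sum]
  exact Finset.prod_le_prod (fun b _ => (Real.exp_pos _).le) fun b _ => h.exp_le b

lemma algBonds_removeBonds {s B : ℝ} (hB : 0 ≤ B) {x : V → ℤ} {t : V × V → ℝ}
    (h : AlgBonds s B x t) (S : Finset (V × V)) : AlgBonds s B x (removeBonds S t) := by
  refine ⟨admissible_removeBonds h.admissible S, fun b => ?_⟩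
  unfold removeBonds
  split_ifs
  · rw [closedProb_zero, Real.exp_le_one_iff]
    have := mul_nonneg hB (algWeight_pos s (x b.1 - x b.2)).le
    linarith
  · exact h.exp_le b

/-- In one dimension, correlations tend to zero at every temperature if `s > 2`, uniformly in the
system: among many far apart cuts one is crossed by no bond, except for a small probability. -/
theorem exists_isingCorr_le {s B ε : ℝ} (hs : 2 < s) (hB : 0 ≤ B) (hε : 0 < ε) :
    ∃ R : ℝ, 0 < R ∧ ∀ (V : Type) [Fintype V] [DecidableEq V] (x : V → ℤ), Function.Injective x →
      ∀ t : V × V → ℝ, AlgBonds s B x t → ∀ e : V × V, R ≤ |((x e.1 - x e.2 : ℤ) : ℝ)| →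
      isingCorr t e ≤ ε := by
  set W := algMass (s / 2) ^ 2 with hW
  set c := Real.exp (-(B * W)) with hc
  have hc0 : 0 < c := Real.exp_pos _
  have hc1 : c ≤ 1 := by
    rw [hc, Real.exp_le_one_iff]
    have : 0 ≤ B * W := by positivity
    linarith
  obtain ⟨n, hn⟩ := exists_pow_lt_of_lt_one (show 0 < ε / 2 by linarith)
    (show 1 - c < 1 by linarith)
  obtain ⟨N, hN0, hN⟩ : ∃ N : ℕ, 0 < N ∧
      n * (B * ((N : ℝ) ^ (-((s - 2) / 2)) * algMass ((s + 2) / 4) ^ 2)) < ε / 2 := by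
    have h1 : Filter.Tendsto (fun N : ℕ => (N : ℝ) ^ (-((s - 2) / 2))) Filter.atTop (nhds 0) :=
      (tendsto_rpow_neg_atTop (by linarith)).comp tendsto_natCast_atTop_atTop
    have h2 : Filter.Tendsto (fun N : ℕ =>
        n * (B * ((N : ℝ) ^ (-((s - 2) / 2)) * algMass ((s + 2) / 4) ^ 2)))
        Filter.atTop (nhds (n * (B * (0 * algMass ((s + 2) / 4) ^ 2)))) :=
      ((h1.mul_const _).const_mul _).const_mul _
    have h3 : (n * (B * (0 * algMass ((s + 2) / 4) ^ 2)) : ℝ) < ε / 2 := by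
      simp; linarith
    have h4 := ((h2.eventually_lt_const h3).and (Filter.eventually_gt_atTop 0)).exists
    obtain ⟨N, hN⟩ := h4
    exact ⟨N, hN.2, hN.1⟩
  refine ⟨n * N + 1, by positivity, ?_⟩
  intro V _ _ x hx t ht e he
  wlog hle : x e.1 ≤ x e.2 generalizing e
  · have h1 := this e.swap (by
      rw [Prod.fst_swap, Prod.snd_swap]
      push_cast at he ⊢
      rwa [abs_sub_comm]) (by simp only [Prod.fst_swap, Prod.snd_swap]; lia)
    rwa [show e.swap = (e.2, e.1) from rfl, isingCorr_swap] at h1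
  set ms : Finset ℤ := (Finset.range n).image (fun a : ℕ => x e.1 + N * a) with hms
  have hcard : ms.card = n := by
    rw [hms, Finset.card_image_of_injective, Finset.card_range]
    intro a b hab
    have : (N : ℤ) * a = N * b := by linarith
    have h0 : (N : ℤ) ≠ 0 := by exact_mod_cast hN0.ne'
    exact_mod_cast mul_left_cancel₀ h0 this
  have hfar : x e.1 + n * N < x e.2 := by
    have h1 : (n * N + 1 : ℤ) ≤ |x e.1 - x e.2| := by exact_mod_cast he
    rw [abs_of_nonpos (by lia)] at h1
    lia
  have hes : ∀ m ∈ ms, Crosses m (x e.1) (x e.2) := by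
    intro m hm
    obtain ⟨a, ha, rfl⟩ := Finset.mem_image.1 hm
    have han : (a : ℤ) ≤ n := by exact_mod_cast (Finset.mem_range.1 ha).le
    have h1 : (N : ℤ) * a ≤ N * n := mul_le_mul_of_nonneg_left han (by positivity)
    have h2 : (0 : ℤ) ≤ N * a := by positivity
    exact Or.inl ⟨by lia, by nlinarith⟩
  set S : Finset (V × V) := Finset.univ.filter (fun b : V × V =>
    ∃ m ∈ ms, Crosses m (x b.1) (x b.2) ∧ (N : ℝ) ≤ |((x b.1 - x b.2 : ℤ) : ℝ)|) with hS
  have hSsum : ∑ b ∈ S, algWeight s (x b.1 - x b.2) ≤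
      n * ((N : ℝ) ^ (-((s - 2) / 2)) * algMass ((s + 2) / 4) ^ 2) := by
    have hSsub : S = ms.biUnion (fun m => Finset.univ.filter (fun b : V × V =>
        Crosses m (x b.1) (x b.2) ∧ (N : ℝ) ≤ |((x b.1 - x b.2 : ℤ) : ℝ)|)) := by
      ext b
      simp [hS]
    have hbi : ∀ (ms : Finset ℤ), ∑ b ∈ ms.biUnion (fun m => Finset.univ.filter (fun b : V × V =>
        Crosses m (x b.1) (x b.2) ∧ (N : ℝ) ≤ |((x b.1 - x b.2 : ℤ) : ℝ)|)),
        algWeight s (x b.1 - x b.2) ≤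
        ms.card * ((N : ℝ) ^ (-((s - 2) / 2)) * algMass ((s + 2) / 4) ^ 2) := by
      intro ms
      induction ms using Finset.induction_on with
      | empty => simp
      | insert m ms hm ih =>
        rw [Finset.biUnion_insert, Finset.card_insert_of_notMem hm]
        have h1 := sum_long_crosses_algWeight_le hx hs m
          (show (0 : ℝ) < N by exact_mod_cast hN0)
        have h2 := Finset.sum_union_inter (s₁ := Finset.univ.filter (fun b : V × V =>
          Crosses m (x b.1) (x b.2) ∧ (N : ℝ) ≤ |((x b.1 - x b.2 : ℤ) : ℝ)|))
          (s₂ := ms.biUnion (fun m => Finset.univ.filter (fun b : V × V =>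
          Crosses m (x b.1) (x b.2) ∧ (N : ℝ) ≤ |((x b.1 - x b.2 : ℤ) : ℝ)|)))
          (f := fun b => algWeight s (x b.1 - x b.2))
        have h3 : 0 ≤ ∑ b ∈ Finset.univ.filter (fun b : V × V =>
          Crosses m (x b.1) (x b.2) ∧ (N : ℝ) ≤ |((x b.1 - x b.2 : ℤ) : ℝ)|) ∩
          ms.biUnion (fun m => Finset.univ.filter (fun b : V × V =>
          Crosses m (x b.1) (x b.2) ∧ (N : ℝ) ≤ |((x b.1 - x b.2 : ℤ) : ℝ)|)),
          algWeight s (x b.1 - x b.2) := Finset.sum_nonneg fun b _ => (algWeight_pos _ _).le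
        rw [Nat.cast_succ]
        linarith
    rw [hSsub, ← hcard]
    exact hbi ms
  have hSprod : 1 - ∏ b ∈ S, closedProb (t b) ≤ ε / 2 := by
    have h1 := ht.exp_le_prod S
    have h2 := Real.add_one_le_exp (-(B * ∑ b ∈ S, algWeight s (x b.1 - x b.2)))
    have h3 := mul_le_mul_of_nonneg_left hSsum hB
    have h4 : B * (n * ((N : ℝ) ^ (-((s - 2) / 2)) * algMass ((s + 2) / 4) ^ 2)) =
      n * (B * ((N : ℝ) ^ (-((s - 2) / 2)) * algMass ((s + 2) / 4) ^ 2)) := by ring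
    linarith
  have hP1 : ∏ b ∈ S, closedProb (t b) ≤ 1 :=
    Finset.prod_le_one (fun b _ => closedProb_nonneg (ht.admissible b))
      fun b _ => closedProb_le_one (ht.admissible b)
  have hP0 : 0 ≤ ∏ b ∈ S, closedProb (t b) :=
    Finset.prod_nonneg (fun b _ => closedProb_nonneg (ht.admissible b))
  have ht' := algBonds_removeBonds hB ht S
  have hcut : isingCorr (removeBonds S t) e ≤ (1 - c) ^ n := by
    rw [← hcard]
    refine isingCorr_le_pow_of_cuts x hc1 e ms ht'.admissible ?_ ?_ hes
    · intro b hb m hm m' hm' h h'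
      have hbS : b ∉ S := by
        intro hbS
        apply hb
        simp [removeBonds, hbS]
      by_contra hne
      apply hbS
      simp only [hS, Finset.mem_filter, Finset.mem_univ, true_and]
      refine ⟨m, hm, h, ?_⟩
      have hN1 : (N : ℤ) ≤ |m - m'| := by
        obtain ⟨a, ha, rfl⟩ := Finset.mem_image.1 hm
        obtain ⟨a', ha', rfl⟩ := Finset.mem_image.1 hm'
        have hne' : (a : ℤ) - a' ≠ 0 := by
          intro h0
          apply hne
          have : (a : ℤ) = a' := by lia
          rw [this]
        rw [show x e.1 + N * a - (x e.1 + N * a') = N * ((a : ℤ) - a') by ring, abs_mul]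
        have h1 : 1 ≤ |(a : ℤ) - a'| := Int.one_le_abs hne'
        rw [abs_of_nonneg (by positivity : (0 : ℤ) ≤ N)]
        nlinarith
      have hN2 : (N : ℤ) ≤ |x b.1 - x b.2| := by
        unfold Crosses at h h'
        rw [le_abs] at hN1 ⊢
        lia
      exact_mod_cast hN2
    · intro m _
      refine le_trans ?_ (ht'.exp_le_prod _)
      rw [hc, Real.exp_le_exp]
      have := mul_le_mul_of_nonneg_left (sum_crosses_algWeight_le hx hs m) hB
      linarith
  calc isingCorr t e ≤ _ := isingCorr_le_removeBonds S ht.admissible e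
    _ ≤ 1 * (1 - c) ^ n + ε / 2 * 1 := by
        have h1 := isingCorr_nonneg ht'.admissible e
        have h2 := isingCorr_nonneg (admissible_contractBonds ht.admissible S) e
        have h3 := isingCorr_le_one (admissible_contractBonds ht.admissible S) e
        have : 0 ≤ 1 - ∏ b ∈ S, closedProb (t b) := by linarith
        gcongr
    _ ≤ ε := by linarith

end Bonds

/-! ### Lebowitz' inequality -/

section Lebowitz

variable {V : Type} [Fintype V] [DecidableEq V]

/-- The configuration which is `1` on `T` and `-1` elsewhere. -/
def signOf (T : Finset V) : V → ℤˣ := fun k => if k ∈ T then 1 else -1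

lemma spin_signOf (T : Finset V) (k : V) : spin (signOf T) k = if k ∈ T then 1 else -1 := by
  unfold spin signOf; split_ifs <;> simp

lemma bondSpin_signOf (T : Finset V) (b : V × V) :
    bondSpin b (signOf T) = if (b.1 ∈ T ↔ b.2 ∈ T) then 1 else -1 := by
  by_cases h1 : b.1 ∈ T <;> by_cases h2 : b.2 ∈ T <;> simp [bondSpin, spin_signOf, h1, h2]

lemma sum_signOf (f : (V → ℤˣ) → ℝ) : ∑ T : Finset V, f (signOf T) = ∑ τ, f τ := by
  refine Fintype.sum_bijective signOf ⟨?_, ?_⟩ _ _ fun _ => rfl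
  · intro T T' h
    ext k
    have := congrFun h k
    unfold signOf at this
    by_cases h1 : k ∈ T <;> by_cases h2 : k ∈ T' <;> simp_all
  · intro τ
    refine ⟨Finset.univ.filter (fun k => τ k = 1), ?_⟩
    funext k
    rcases Int.units_eq_one_or (τ k) with h | h <;> simp [signOf, h]

/-- Bond parameters of the system on `T` with all couplings doubled: `2 r / (1 + r ^ 2)` is
`tanh (2 J)` for `r = tanh J`. -/
def doubledOn (t : V × V → ℝ) (T : Finset V) (b : V × V) : ℝ :=
  if b.1 ∈ T ∧ b.2 ∈ T then 2 * t b / (1 + t b ^ 2) else 0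

lemma doubled_mem {r : ℝ} (h : 0 ≤ r ∧ r ≤ 1) :
    0 ≤ 2 * r / (1 + r ^ 2) ∧ 2 * r / (1 + r ^ 2) ≤ 1 := by
  have : 0 < 1 + r ^ 2 := by positivity
  refine ⟨div_nonneg (by linarith) this.le, ?_⟩
  rw [div_le_one this]
  nlinarith [sq_nonneg (1 - r)]

lemma admissible_doubledOn {t : V × V → ℝ} (ht : Admissible t) (T : Finset V) :
    Admissible (doubledOn t T) := fun b => by
  unfold doubledOn
  split_ifs
  · exact doubled_mem (ht b)
  · norm_num

lemma doubledOn_mono {t : V × V → ℝ} (ht : Admissible t) {T T' : Finset V} (h : T ⊆ T')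
    (b : V × V) : doubledOn t T b ≤ doubledOn t T' b := by
  unfold doubledOn
  split_ifs with h1 h2 h2
  · exact le_rfl
  · exact absurd ⟨h h1.1, h h1.2⟩ h2
  · exact (doubled_mem (ht b)).1
  · exact le_rfl

/-- The part of the weight of a pair of configurations which depends only on the set `T` where they
agree. -/
def sideFactor (t : V × V → ℝ) (T : Finset V) : ℝ :=
  ∏ b : V × V, if (b.1 ∈ T ↔ b.2 ∈ T) then 1 + t b ^ 2 else 1 - t b ^ 2

/-- Two copies of an Ising system, conditioned on the set `T` where they agree, are a pair of
independent Ising systems with doubled couplings on `T` and on its complement. -/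
lemma isingWeight_mul_signOf (t : V × V → ℝ) (T : Finset V) (σ : V → ℤˣ) :
    isingWeight t σ * isingWeight t (σ * signOf T) =
      sideFactor t T * (isingWeight (doubledOn t T) σ * isingWeight (doubledOn t Tᶜ) σ) := by
  simp only [isingWeight, sideFactor, ← Finset.prod_mul_distrib]
  refine Finset.prod_congr rfl fun b _ => ?_
  have h0 : 1 + t b ^ 2 ≠ 0 := by positivity
  have hs := bondSpin_mul_self b σ
  rw [bondSpin_mul, bondSpin_signOf]
  unfold doubledOn
  by_cases h1 : b.1 ∈ T <;> by_cases h2 : b.2 ∈ T <;> simp [h1, h2] <;> field_simp <;>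
    first | linear_combination (t b ^ 2) * hs | linear_combination (-t b ^ 2) * hs

lemma sideFactor_nonneg {t : V × V → ℝ} (ht : Admissible t) (T : Finset V) :
    0 ≤ sideFactor t T := by
  refine Finset.prod_nonneg fun b _ => ?_
  have h := ht b
  split_ifs
  · positivity
  · nlinarith

/-- The set of bonds joining `T` to its complement is a submodular function of `T`. -/
lemma sideFactor_mul_le {t : V × V → ℝ} (ht : Admissible t) (T T' : Finset V) :
    sideFactor t T * sideFactor t T' ≤ sideFactor t (T ∩ T') * sideFactor t (T ∪ T') := by
  simp only [sideFactor, ← Finset.prod_mul_distrib]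
  refine Finset.prod_le_prod (fun b _ => ?_) (fun b _ => ?_)
  · have h := ht b
    have h1 : 0 ≤ 1 - t b ^ 2 := by nlinarith
    refine mul_nonneg ?_ ?_ <;> split_ifs <;> first | exact h1 | positivity
  · have h := ht b
    have h1 : 0 ≤ 1 - t b ^ 2 := by nlinarith
    by_cases a1 : b.1 ∈ T <;> by_cases a2 : b.2 ∈ T <;> by_cases a3 : b.1 ∈ T' <;>
      by_cases a4 : b.2 ∈ T' <;> simp [a1, a2, a3, a4] <;> nlinarith [sq_nonneg (t b)]

/-- Functions of disjoint sets of spins are independent under the uniform measure: exchange the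
spins outside `T` between two copies. -/
lemma sum_mul_card_of_disjoint (T : Finset V) {F G : (V → ℤˣ) → ℝ}
    (hF : ∀ σ σ' : V → ℤˣ, (∀ k ∈ T, σ k = σ' k) → F σ = F σ')
    (hG : ∀ σ σ' : V → ℤˣ, (∀ k ∉ T, σ k = σ' k) → G σ = G σ') :
    (∑ σ, F σ * G σ) * Fintype.card (V → ℤˣ) = (∑ σ, F σ) * ∑ σ, G σ := by
  let m : (V → ℤˣ) × (V → ℤˣ) → (V → ℤˣ) × (V → ℤˣ) := fun p =>
    (fun k => if k ∈ T then p.1 k else p.2 k, fun k => if k ∈ T then p.2 k else p.1 k)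
  have hm : Function.Involutive m := by
    rintro ⟨σ, σ'⟩
    simp only [m, Prod.mk.injEq]
    constructor <;> funext k <;> split_ifs <;> rfl
  calc _ = ∑ p : (V → ℤˣ) × (V → ℤˣ), F p.1 * G p.1 := by
        rw [Fintype.sum_prod_type, Finset.sum_mul]
        simp [mul_comm]
    _ = ∑ p : (V → ℤˣ) × (V → ℤˣ), F (m p).1 * G (m p).1 :=
        (Equiv.sum_comp (hm.toPerm m) (fun p => F p.1 * G p.1)).symm
    _ = ∑ p : (V → ℤˣ) × (V → ℤˣ), F p.1 * G p.2 := by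
        refine Finset.sum_congr rfl fun p _ => ?_
        rw [hF (m p).1 p.1 fun k hk => by simp [m, hk], hG (m p).1 p.2 fun k hk => by simp [m, hk]]
    _ = _ := by
        rw [Fintype.sum_prod_type, Finset.sum_mul_sum]

lemma isingWeight_doubledOn_congr (t : V × V → ℝ) (T : Finset V) {σ σ' : V → ℤˣ}
    (h : ∀ k ∈ T, σ k = σ' k) :
    isingWeight (doubledOn t T) σ = isingWeight (doubledOn t T) σ' := by
  refine Finset.prod_congr rfl fun b _ => ?_
  unfold doubledOn
  split_ifs with hb
  · simp only [bondSpin, spin, h _ hb.1, h _ hb.2]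
  · simp

lemma card_mul_sum_pair (t : V × V → ℝ) (T : Finset V) {F G : (V → ℤˣ) → ℝ}
    (hF : ∀ σ σ' : V → ℤˣ, (∀ k ∈ T, σ k = σ' k) → F σ = F σ')
    (hG : ∀ σ σ' : V → ℤˣ, (∀ k ∉ T, σ k = σ' k) → G σ = G σ') :
    Fintype.card (V → ℤˣ) *
      ∑ σ, F σ * G σ * (isingWeight t σ * isingWeight t (σ * signOf T)) =
      sideFactor t T * (isingSum (doubledOn t T) F * isingSum (doubledOn t Tᶜ) G) := by
  have h := sum_mul_card_of_disjoint T (F := fun σ => F σ * isingWeight (doubledOn t T) σ)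
    (G := fun σ => G σ * isingWeight (doubledOn t Tᶜ) σ)
    (fun σ σ' hσ => by rw [hF σ σ' hσ, isingWeight_doubledOn_congr t T hσ])
    (fun σ σ' hσ => by
      rw [hG σ σ' hσ, isingWeight_doubledOn_congr t Tᶜ fun k hk => hσ k (by simpa using hk)])
  simp only [isingSum]
  rw [← h, mul_comm (Fintype.card (V → ℤˣ) : ℝ), ← mul_assoc, Finset.mul_sum]
  congr 1
  refine Finset.sum_congr rfl fun σ _ => ?_
  rw [isingWeight_mul_signOf]
  ring

lemma isingZ_mono {t t' : V × V → ℝ} (ht : Admissible t) (ht' : Admissible t')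
    (h : ∀ b, t b ≤ t' b) : isingZ t ≤ isingZ t' := by
  have key : ∀ S : Finset (V × V), GriffithsCone (fun σ : V → ℤˣ =>
      ∏ b ∈ S, (1 + t' b * bondSpin b σ) - ∏ b ∈ S, (1 + t b * bondSpin b σ)) := by
    intro S
    induction S using Finset.induction_on with
    | empty => simpa using GriffithsCone.const (V := V) le_rfl
    | insert c S hc ih =>
      have hp : ∀ b, GriffithsCone (fun σ : V → ℤˣ => 1 + t' b * bondSpin b σ) := fun b =>
        (GriffithsCone.const zero_le_one).add
          ((GriffithsCone.const (ht' b).1).mul (GriffithsCone.bondSpin b))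
      have hq : GriffithsCone (fun σ : V → ℤˣ => 1 + t c * bondSpin c σ) :=
        (GriffithsCone.const zero_le_one).add
          ((GriffithsCone.const (ht c).1).mul (GriffithsCone.bondSpin c))
      have hr : GriffithsCone (fun σ : V → ℤˣ => (t' c - t c) * bondSpin c σ) :=
        (GriffithsCone.const (by linarith [h c])).mul (GriffithsCone.bondSpin c)
      have := (hq.mul ih).add (hr.mul (GriffithsCone.prod S fun b _ => hp b))
      convert this using 2 with σ
      rw [Finset.prod_insert hc, Finset.prod_insert hc]
      ring
  have := (key Finset.univ).sum_nonneg
  rw [Finset.sum_sub_distrib] at this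
  simp only [isingZ, isingWeight]
  linarith

lemma isingZ_update (t : V × V → ℝ) (c : V × V) (hc : t c = 0) (r : ℝ) :
    isingZ (Function.update t c r) = isingZ t + r * isingSum t (bondSpin c) := by
  have := isingSum_update t c r (fun _ => 1)
  rw [show Function.update t c 0 = t by rw [← hc, Function.update_eq_self]] at this
  simpa only [one_mul, isingSum_one] using this

/-- Switching on the same bonds increases the partition function by a larger factor in the system
with the larger bond parameters. -/
lemma isingZ_mul_le {t t' u : V × V → ℝ} (ht : Admissible t) (ht' : Admissible t')
    (hu : Admissible u) (h : ∀ b, t b ≤ t' b) (R : Finset (V × V)) (hR : ∀ b ∈ R, t' b = 0) :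
    isingZ (fun b => if b ∈ R then u b else t b) * isingZ t' ≤
      isingZ t * isingZ (fun b => if b ∈ R then u b else t' b) := by
  induction R using Finset.induction_on with
  | empty => simp
  | insert c R hc ih =>
    have hup : ∀ s : V × V → ℝ, (fun b => if b ∈ insert c R then u b else s b) =
        Function.update (fun b => if b ∈ R then u b else s b) c (u c) := by
      intro s
      funext b
      by_cases hb : b = c
      · subst hb; simp
      · simp [hb]
    have h1 : t' c = 0 := hR c (by simp)
    have h0 : t c = 0 := le_antisymm ((h c).trans_eq h1) (ht c).1
    have hadm : ∀ s : V × V → ℝ, Admissible s →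
        Admissible (fun b => if b ∈ R then u b else s b) := by
      intro s hs b
      by_cases hb : b ∈ R
      · simpa [hb] using hu b
      · simpa [hb] using hs b
    rw [hup, hup, isingZ_update _ _ (by simp [hc, h0]), isingZ_update _ _ (by simp [hc, h1])]
    have ih' := ih fun b hb => hR b (by simp [hb])
    have hm := isingCorr_mono (hadm t ht) (hadm t' ht')
      (fun b => by by_cases hb : b ∈ R <;> simp [hb, h b]) c
    have hz := isingZ_pos (hadm t ht)
    have hz' := isingZ_pos (hadm t' ht')
    have hzt := isingZ_pos ht
    have hzt' := isingZ_pos ht'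
    have hnn := isingCorr_nonneg (hadm t ht) c
    set a := isingZ (fun b => if b ∈ R then u b else t b)
    set a' := isingZ (fun b => if b ∈ R then u b else t' b)
    have e1 : isingSum (fun b => if b ∈ R then u b else t b) (bondSpin c) =
        a * isingCorr (fun b => if b ∈ R then u b else t b) c := by
      rw [isingCorr, mul_div_cancel₀ _ hz.ne']
    have e2 : isingSum (fun b => if b ∈ R then u b else t' b) (bondSpin c) =
        a' * isingCorr (fun b => if b ∈ R then u b else t' b) c := by
      rw [isingCorr, mul_div_cancel₀ _ hz'.ne']
    rw [e1, e2]
    set p := isingCorr (fun b => if b ∈ R then u b else t b) c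
    set p' := isingCorr (fun b => if b ∈ R then u b else t' b) c
    have hu0 := (hu c).1
    calc (a + u c * (a * p)) * isingZ t' = (a * isingZ t') * (1 + u c * p) := by ring
      _ ≤ (isingZ t * a') * (1 + u c * p') := by gcongr
      _ = _ := by ring

lemma isingZ_doubledOn_mul_le {t : V × V → ℝ} (ht : Admissible t) (T T' : Finset V) :
    isingZ (doubledOn t T) * isingZ (doubledOn t T') ≤
      isingZ (doubledOn t (T ∩ T')) * isingZ (doubledOn t (T ∪ T')) := by
  set R : Finset (V × V) :=
    Finset.univ.filter (fun b => (b.1 ∈ T ∧ b.2 ∈ T) ∧ ¬ (b.1 ∈ T' ∧ b.2 ∈ T')) with hR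
  set u : V × V → ℝ := fun b => 2 * t b / (1 + t b ^ 2) with hu
  have hadm : Admissible u := fun b => doubled_mem (ht b)
  have h1 := isingZ_mul_le (admissible_doubledOn ht (T ∩ T')) (admissible_doubledOn ht T') hadm
    (doubledOn_mono ht Finset.inter_subset_right) R (fun b hb => by
      simp only [hR, Finset.mem_filter] at hb
      rw [doubledOn, if_neg hb.2.2])
  have e1 : (fun b => if b ∈ R then u b else doubledOn t (T ∩ T') b) = doubledOn t T := by
    funext b
    simp only [hR, Finset.mem_filter, Finset.mem_univ, true_and, doubledOn, Finset.mem_inter, hu]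
    by_cases a1 : b.1 ∈ T <;> by_cases a2 : b.2 ∈ T <;> by_cases a3 : b.1 ∈ T' <;>
      by_cases a4 : b.2 ∈ T' <;> simp [a1, a2, a3, a4]
  rw [e1] at h1
  refine h1.trans (mul_le_mul_of_nonneg_left ?_ (isingZ_pos (admissible_doubledOn ht _)).le)
  refine isingZ_mono (fun b => ?_) (admissible_doubledOn ht _) fun b => ?_
  · by_cases hb : b ∈ R
    · simpa [hb] using hadm b
    · simpa [hb] using admissible_doubledOn ht T' b
  · by_cases hb : b ∈ R
    · simp only [hb, if_true]
      simp only [hR, Finset.mem_filter] at hb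
      rw [doubledOn, if_pos ⟨Finset.mem_union_left _ hb.2.1.1, Finset.mem_union_left _ hb.2.1.2⟩]
    · simp only [hb, if_false]
      exact doubledOn_mono ht Finset.subset_union_right b

/-- The weight of the event that two copies agree exactly on `T`. -/
def agreeWeight (t : V × V → ℝ) (T : Finset V) : ℝ :=
  sideFactor t T * (isingZ (doubledOn t T) * isingZ (doubledOn t Tᶜ))

lemma agreeWeight_mul_le {t : V × V → ℝ} (ht : Admissible t) (T T' : Finset V) :
    agreeWeight t T * agreeWeight t T' ≤ agreeWeight t (T ∩ T') * agreeWeight t (T ∪ T') := by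
  have h1 := sideFactor_mul_le ht T T'
  have h2 := isingZ_doubledOn_mul_le ht T T'
  have h3 := isingZ_doubledOn_mul_le ht Tᶜ T'ᶜ
  rw [← Finset.compl_union, ← Finset.compl_inter] at h3
  have p := fun T => (isingZ_pos (admissible_doubledOn ht T)).le
  have q := sideFactor_nonneg ht
  unfold agreeWeight
  calc _ = (sideFactor t T * sideFactor t T') *
        ((isingZ (doubledOn t T) * isingZ (doubledOn t T')) *
          (isingZ (doubledOn t Tᶜ) * isingZ (doubledOn t T'ᶜ))) := by ring
    _ ≤ (sideFactor t (T ∩ T') * sideFactor t (T ∪ T')) *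
        ((isingZ (doubledOn t (T ∩ T')) * isingZ (doubledOn t (T ∪ T'))) *
          (isingZ (doubledOn t (T ∪ T')ᶜ) * isingZ (doubledOn t (T ∩ T')ᶜ))) :=
        mul_le_mul h1 (mul_le_mul h2 h3 (mul_nonneg (p _) (p _)) (mul_nonneg (p _) (p _)))
          (mul_nonneg (mul_nonneg (p _) (p _)) (mul_nonneg (p _) (p _)))
          (mul_nonneg (q _) (q _))
    _ = _ := by ring

/-- The conditional correlation given that two copies agree exactly on `T`; it vanishes unless both
sites lie in `T`. -/
def agreeCorr (t : V × V → ℝ) (e : V × V) (T : Finset V) : ℝ :=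
  if e.1 ∈ T ∧ e.2 ∈ T then isingCorr (doubledOn t T) e else 0

lemma agreeCorr_nonneg {t : V × V → ℝ} (ht : Admissible t) (e : V × V) (T : Finset V) :
    0 ≤ agreeCorr t e T := by
  unfold agreeCorr
  split_ifs
  · exact isingCorr_nonneg (admissible_doubledOn ht T) e
  · exact le_rfl

lemma agreeCorr_le_one {t : V × V → ℝ} (ht : Admissible t) (e : V × V) (T : Finset V) :
    agreeCorr t e T ≤ 1 := by
  unfold agreeCorr
  split_ifs
  · exact isingCorr_le_one (admissible_doubledOn ht T) e
  · exact zero_le_one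

lemma agreeCorr_mono {t : V × V → ℝ} (ht : Admissible t) (e : V × V) :
    Monotone (agreeCorr t e) := by
  intro T T' h
  unfold agreeCorr
  split_ifs with h1 h2 h2
  · exact isingCorr_mono (admissible_doubledOn ht T) (admissible_doubledOn ht T')
      (doubledOn_mono ht h) e
  · exact absurd ⟨h h1.1, h h1.2⟩ h2
  · exact isingCorr_nonneg (admissible_doubledOn ht T') e
  · exact le_rfl

/-- Correlations on the set `T` where two copies agree are increasing in `T` and those on the
complement are decreasing, so the FKG inequality makes them negatively correlated. -/
lemma sum_agreeWeight_mul_le {t : V × V → ℝ} (ht : Admissible t) (e e' : V × V) :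
    (∑ T, agreeWeight t T) * ∑ T, agreeWeight t T * (agreeCorr t e T * agreeCorr t e' Tᶜ) ≤
      (∑ T, agreeWeight t T * agreeCorr t e T) * ∑ T, agreeWeight t T * agreeCorr t e' Tᶜ := by
  have h := fkg (agreeCorr t e) (fun T => 1 - agreeCorr t e' Tᶜ) (agreeWeight t)
    (fun T => mul_nonneg (sideFactor_nonneg ht T) (mul_nonneg
      (isingZ_pos (admissible_doubledOn ht T)).le (isingZ_pos (admissible_doubledOn ht Tᶜ)).le))
    (agreeCorr_nonneg ht e) (fun T => sub_nonneg.2 (agreeCorr_le_one ht e' Tᶜ))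
    (agreeCorr_mono ht e)
    (fun T T' hT => sub_le_sub_left (agreeCorr_mono ht e' (Finset.compl_subset_compl.2 hT)) 1)
    (agreeWeight_mul_le ht)
  simp only [mul_sub, mul_one, Finset.sum_sub_distrib] at h
  linarith

/-- The sum over two independent copies. -/
def pairSum (t : V × V → ℝ) (H : (V → ℤˣ) → (V → ℤˣ) → ℝ) : ℝ :=
  ∑ σ, ∑ σ', H σ σ' * (isingWeight t σ * isingWeight t σ')

lemma pairSum_add (t : V × V → ℝ) (H H' : (V → ℤˣ) → (V → ℤˣ) → ℝ) :
    pairSum t (fun σ σ' => H σ σ' + H' σ σ') = pairSum t H + pairSum t H' := by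
  simp only [pairSum, add_mul, Finset.sum_add_distrib]

lemma pairSum_sub (t : V × V → ℝ) (H H' : (V → ℤˣ) → (V → ℤˣ) → ℝ) :
    pairSum t (fun σ σ' => H σ σ' - H' σ σ') = pairSum t H - pairSum t H' := by
  simp only [pairSum, sub_mul, Finset.sum_sub_distrib]

lemma pairSum_mul (t : V × V → ℝ) (F G : (V → ℤˣ) → ℝ) :
    pairSum t (fun σ σ' => F σ * G σ') = isingSum t F * isingSum t G := by
  simp only [pairSum, isingSum, Finset.sum_mul_sum]
  exact Finset.sum_congr rfl fun σ _ => Finset.sum_congr rfl fun σ' _ => by ring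

lemma pairSum_eq_sum_signOf (t : V × V → ℝ) (H : (V → ℤˣ) → (V → ℤˣ) → ℝ) :
    pairSum t H = ∑ T : Finset V, ∑ σ, H σ (σ * signOf T) *
      (isingWeight t σ * isingWeight t (σ * signOf T)) := by
  rw [pairSum, sum_sum_eq_sum_sum_mul
    (fun σ σ' => H σ σ' * (isingWeight t σ * isingWeight t σ'))]
  exact (sum_signOf (fun τ => ∑ σ, H σ (σ * τ) * (isingWeight t σ * isingWeight t (σ * τ)))).symm

lemma isingSum_spin (t : V × V → ℝ) (k : V) : isingSum t (fun σ => spin σ k) = 0 := by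
  have hflip : isingSum t (fun σ => spin σ k) = -isingSum t (fun σ => spin σ k) := by
    conv_lhs => rw [isingSum, ← Equiv.sum_comp (Equiv.mulRight (signOf (∅ : Finset V)))]
    rw [isingSum, ← Finset.sum_neg_distrib]
    refine Finset.sum_congr rfl fun σ _ => ?_
    have : isingWeight t (σ * signOf ∅) = isingWeight t σ :=
      Finset.prod_congr rfl fun b _ => by rw [bondSpin_mul, bondSpin_signOf]; simp
    rw [Equiv.coe_mulRight, this, spin_mul, spin_signOf]
    simp
  linarith

/-- The agreement observable `(σ_i + σ'_i) (σ_j + σ'_j) / 4`. -/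
def agreeObs (e : V × V) (σ σ' : V → ℤˣ) : ℝ :=
  (spin σ e.1 + spin σ' e.1) * (spin σ e.2 + spin σ' e.2) / 4

/-- The disagreement observable `(σ_i - σ'_i) (σ_j - σ'_j) / 4`. -/
def disagreeObs (e : V × V) (σ σ' : V → ℤˣ) : ℝ :=
  (spin σ e.1 - spin σ' e.1) * (spin σ e.2 - spin σ' e.2) / 4

lemma agreeObs_signOf (e : V × V) (σ : V → ℤˣ) (T : Finset V) :
    agreeObs e σ (σ * signOf T) = if e.1 ∈ T ∧ e.2 ∈ T then bondSpin e σ else 0 := by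
  simp only [agreeObs, spin_mul, spin_signOf, bondSpin]
  by_cases h1 : e.1 ∈ T <;> by_cases h2 : e.2 ∈ T <;> simp [h1, h2]
  ring

lemma disagreeObs_signOf (e : V × V) (σ : V → ℤˣ) (T : Finset V) :
    disagreeObs e σ (σ * signOf T) = if e.1 ∈ Tᶜ ∧ e.2 ∈ Tᶜ then bondSpin e σ else 0 := by
  simp only [disagreeObs, spin_mul, spin_signOf, bondSpin, Finset.mem_compl]
  by_cases h1 : e.1 ∈ T <;> by_cases h2 : e.2 ∈ T <;> simp [h1, h2]
  ring

lemma card_mul_pairSum {t : V × V → ℝ} (ht : Admissible t) (e e' : V × V) :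
    (Fintype.card (V → ℤˣ) * pairSum t (fun _ _ => 1) = ∑ T, agreeWeight t T) ∧
    (Fintype.card (V → ℤˣ) * pairSum t (agreeObs e) =
      ∑ T, agreeWeight t T * agreeCorr t e T) ∧
    (Fintype.card (V → ℤˣ) * pairSum t (disagreeObs e') =
      ∑ T, agreeWeight t T * agreeCorr t e' Tᶜ) ∧
    (Fintype.card (V → ℤˣ) * pairSum t (fun σ σ' => agreeObs e σ σ' * disagreeObs e' σ σ') =
      ∑ T, agreeWeight t T * (agreeCorr t e T * agreeCorr t e' Tᶜ)) := by
  have hz := fun T => (isingZ_pos (admissible_doubledOn ht T)).ne'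
  have hdep : ∀ (e : V × V) (T : Finset V), e.1 ∈ T ∧ e.2 ∈ T →
      ∀ σ σ' : V → ℤˣ, (∀ k ∈ T, σ k = σ' k) → bondSpin e σ = bondSpin e σ' := by
    intro e T he σ σ' h
    simp only [bondSpin, spin, h _ he.1, h _ he.2]
  have hdep' : ∀ (e : V × V) (T : Finset V), e.1 ∈ Tᶜ ∧ e.2 ∈ Tᶜ →
      ∀ σ σ' : V → ℤˣ, (∀ k ∉ T, σ k = σ' k) → bondSpin e σ = bondSpin e σ' := by
    intro e T he σ σ' h
    exact hdep e Tᶜ he σ σ' fun k hk => h k (by simpa using hk)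
  refine ⟨?_, ?_, ?_, ?_⟩ <;> rw [pairSum_eq_sum_signOf, Finset.mul_sum] <;>
    refine Finset.sum_congr rfl fun T _ => ?_
  · have := card_mul_sum_pair t T (F := fun _ => 1) (G := fun _ => 1) (by simp) (by simp)
    simp only [one_mul, isingSum_one] at this
    simp only [one_mul]
    rw [this, agreeWeight]
  · simp only [agreeObs_signOf, agreeCorr]
    split_ifs with h1
    · have := card_mul_sum_pair t T (F := bondSpin e) (G := fun _ => 1) (hdep e T h1) (by simp)
      simp only [mul_one, isingSum_one] at this
      rw [this, agreeWeight, isingCorr]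
      have := hz T
      field_simp
    · simp
  · simp only [disagreeObs_signOf, agreeCorr]
    split_ifs with h2
    · have := card_mul_sum_pair t T (F := fun _ => 1) (G := bondSpin e') (by simp) (hdep' e' T h2)
      simp only [one_mul, isingSum_one] at this
      rw [this, agreeWeight, isingCorr]
      have := hz Tᶜ
      field_simp
    · simp
  · simp only [agreeObs_signOf, disagreeObs_signOf, agreeCorr]
    by_cases h1 : e.1 ∈ T ∧ e.2 ∈ T
    · by_cases h2 : e'.1 ∈ Tᶜ ∧ e'.2 ∈ Tᶜ
      · simp only [if_pos h1, if_pos h2]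
        rw [card_mul_sum_pair t T (hdep e T h1) (hdep' e' T h2), agreeWeight, isingCorr, isingCorr]
        have := hz T
        have := hz Tᶜ
        field_simp
      · simp only [if_neg h2]; simp
    · simp only [if_neg h1]; simp

/-- Lebowitz' inequality: the truncated four-point function is nonpositive. It expresses the negative
correlation of `agreeObs` and `disagreeObs` for two copies of the system. -/
theorem isingSum_four_le {t : V × V → ℝ} (ht : Admissible t) (i j k l : V) :
    isingZ t * isingSum t (fun σ => bondSpin (i, j) σ * bondSpin (k, l) σ) ≤
      isingSum t (bondSpin (i, j)) * isingSum t (bondSpin (k, l)) +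
      isingSum t (bondSpin (i, k)) * isingSum t (bondSpin (j, l)) +
      isingSum t (bondSpin (i, l)) * isingSum t (bondSpin (j, k)) := by
  obtain ⟨h1, h2, h3, h4⟩ := card_mul_pairSum ht (i, j) (k, l)
  have hfkg := sum_agreeWeight_mul_le ht (i, j) (k, l)
  rw [← h1, ← h2, ← h3, ← h4] at hfkg
  have hN : (0 : ℝ) < Fintype.card (V → ℤˣ) := by exact_mod_cast Fintype.card_pos
  set N : ℝ := ((Fintype.card (V → ℤˣ) : ℕ) : ℝ)
  have hmain : pairSum t (fun _ _ => 1) *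
      pairSum t (fun σ σ' => agreeObs (i, j) σ σ' * disagreeObs (k, l) σ σ') ≤
      pairSum t (agreeObs (i, j)) * pairSum t (disagreeObs (k, l)) := by
    have hN2 : 0 < N * N := mul_pos hN hN
    refine le_of_mul_le_mul_left ?_ hN2
    linarith
  set Z := isingZ t
  have s0 := fun k => isingSum_spin t k
  have hbs : ∀ a b : V, isingSum t (fun σ => spin σ a * spin σ b) = isingSum t (bondSpin (a, b)) :=
    fun a b => rfl
  have e1 : pairSum t (fun _ _ => 1) = Z * Z := by
    have := pairSum_mul t (fun _ => 1) (fun _ => 1)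
    simpa [isingSum_one] using this
  have e2 : ∀ a b, pairSum t (agreeObs (a, b)) = Z * isingSum t (bondSpin (a, b)) / 2 := by
    intro a b
    have hH : (agreeObs (a, b) : (V → ℤˣ) → _) = fun σ σ' =>
        (spin σ a * spin σ b) * (fun _ => 1 / 4) σ' + (spin σ a) * (spin σ' b / 4) +
        (spin σ b) * (spin σ' a / 4) + (fun _ => 1 / 4) σ * (spin σ' a * spin σ' b) := by
      funext σ σ'; simp only [agreeObs]; ring
    have hq : isingSum t (fun _ => 1 / 4) = Z / 4 := by
      simp only [isingSum, Z, isingZ]; rw [← Finset.mul_sum]; ring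
    rw [hH, pairSum_add, pairSum_add, pairSum_add, pairSum_mul, pairSum_mul, pairSum_mul,
      pairSum_mul, s0, s0, hbs, hq]
    ring
  have e3 : ∀ a b, pairSum t (disagreeObs (a, b)) = Z * isingSum t (bondSpin (a, b)) / 2 := by
    intro a b
    have hH : (disagreeObs (a, b) : (V → ℤˣ) → _) = fun σ σ' =>
        (spin σ a * spin σ b) * (fun _ => 1 / 4) σ' - (spin σ a) * (spin σ' b / 4) -
        (spin σ b) * (spin σ' a / 4) + (fun _ => 1 / 4) σ * (spin σ' a * spin σ' b) := by
      funext σ σ'; simp only [disagreeObs]; ring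
    have hq : isingSum t (fun _ => 1 / 4) = Z / 4 := by
      simp only [isingSum, Z, isingZ]; rw [← Finset.mul_sum]; ring
    rw [hH, pairSum_add, pairSum_sub, pairSum_sub, pairSum_mul, pairSum_mul, pairSum_mul,
      pairSum_mul, s0, s0, hbs, hq]
    ring
  set S4 := isingSum t (fun σ => bondSpin (i, j) σ * bondSpin (k, l) σ) with hS4
  have e4 : pairSum t (fun σ σ' => agreeObs (i, j) σ σ' * disagreeObs (k, l) σ σ') =
      (Z * S4 + isingSum t (bondSpin (i, j)) * isingSum t (bondSpin (k, l)) -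
      isingSum t (bondSpin (i, k)) * isingSum t (bondSpin (j, l)) -
      isingSum t (bondSpin (i, l)) * isingSum t (bondSpin (j, k))) / 8 := by
    have hH : (fun σ σ' : V → ℤˣ => agreeObs (i, j) σ σ' * disagreeObs (k, l) σ σ') = fun σ σ' =>
        (bondSpin (i, j) σ * bondSpin (k, l) σ) * (fun _ => 1 / 16) σ' +
        (fun _ => 1 / 16) σ * (bondSpin (i, j) σ' * bondSpin (k, l) σ') +
        bondSpin (i, j) σ * (bondSpin (k, l) σ' * (1 / 16)) +
        bondSpin (k, l) σ * (bondSpin (i, j) σ' * (1 / 16)) -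
        bondSpin (i, k) σ * (bondSpin (j, l) σ' * (1 / 16)) -
        bondSpin (j, l) σ * (bondSpin (i, k) σ' * (1 / 16)) -
        bondSpin (i, l) σ * (bondSpin (j, k) σ' * (1 / 16)) -
        bondSpin (j, k) σ * (bondSpin (i, l) σ' * (1 / 16)) +
        (spin σ j * bondSpin (k, l) σ / 16) * spin σ' i +
        (spin σ i * bondSpin (k, l) σ / 16) * spin σ' j -
        (spin σ l * bondSpin (i, j) σ / 16) * spin σ' k -
        (spin σ k * bondSpin (i, j) σ / 16) * spin σ' l +
        spin σ i * (spin σ' j * bondSpin (k, l) σ' / 16) +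
        spin σ j * (spin σ' i * bondSpin (k, l) σ' / 16) -
        spin σ k * (spin σ' l * bondSpin (i, j) σ' / 16) -
        spin σ l * (spin σ' k * bondSpin (i, j) σ' / 16) := by
      funext σ σ'; simp only [agreeObs, disagreeObs, bondSpin]; ring
    have hq : isingSum t (fun _ => 1 / 16) = Z / 16 := by
      simp only [isingSum, Z, isingZ]; rw [← Finset.mul_sum]; ring
    have hq' : ∀ F, isingSum t (fun σ => F σ * (1 / 16)) = isingSum t F / 16 := by
      intro F
      simp only [isingSum]; rw [Finset.sum_div]
      exact Finset.sum_congr rfl fun σ _ => by ring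
    rw [hH]
    simp only [pairSum_add, pairSum_sub]
    simp only [pairSum_mul, s0, hq, hq', mul_zero, zero_mul]
    ring
  rw [e1, e2, e3, e4] at hmain
  have hZ : 0 < Z * Z := mul_pos (isingZ_pos ht) (isingZ_pos ht)
  have : Z * S4 + isingSum t (bondSpin (i, j)) * isingSum t (bondSpin (k, l)) -
      isingSum t (bondSpin (i, k)) * isingSum t (bondSpin (j, l)) -
      isingSum t (bondSpin (i, l)) * isingSum t (bondSpin (j, k)) ≤
      2 * (isingSum t (bondSpin (i, j)) * isingSum t (bondSpin (k, l))) := by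
    refine le_of_mul_le_mul_left ?_ hZ
    linarith
  linarith

end Lebowitz

/-! ### Simon's inequality and decay of Ising correlations -/

section Simon

variable {V : Type} [Fintype V] [DecidableEq V]

/-- Switching on a single bond `c`: the four-point function in the increment of the correlation is
bounded by Lebowitz' inequality. -/
lemma isingCorr_le_update_zero_add {t : V × V → ℝ} (ht : Admissible t) (c e : V × V) :
    isingCorr t e ≤ isingCorr (Function.update t c 0) e +
      t c * (isingCorr t (e.1, c.1) * isingCorr t (e.2, c.2) +
        isingCorr t (e.1, c.2) * isingCorr t (e.2, c.1)) := by
  set t₀ := Function.update t c 0 with ht₀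
  have hadm : Admissible t₀ := admissible_update ht c (by norm_num)
  have hle : ∀ b, t₀ b ≤ t b := fun b => by
    by_cases hb : b = c
    · subst hb; simpa [ht₀] using (ht b).1
    · rw [ht₀, Function.update_of_ne hb]
  have hleb := isingSum_four_le hadm e.1 e.2 c.1 c.2
  have hgks := isingSum_mul_le hadm hadm (fun _ => le_rfl) (GriffithsCone.bondSpin e) c
  have hz : 0 < isingZ t₀ := isingZ_pos hadm
  have hd0 : 0 ≤ isingSum t₀ (bondSpin c) := isingSum_nonneg hadm (GriffithsCone.bondSpin c)
  have hmono : ∀ b, isingCorr t₀ b ≤ isingCorr t b := isingCorr_mono hadm ht hle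
  have hnn : ∀ b, 0 ≤ isingCorr t₀ b := isingCorr_nonneg hadm
  have hS : isingCorr t e = (isingSum t₀ (bondSpin e) +
      t c * isingSum t₀ (fun σ => bondSpin e σ * bondSpin c σ)) /
      (isingZ t₀ + t c * isingSum t₀ (bondSpin c)) := by
    have hZ : isingZ (Function.update t c (t c)) =
        isingZ t₀ + t c * isingSum t₀ (bondSpin c) := by
      have := isingSum_update t c (t c) (fun _ => 1)
      simp only [one_mul, isingSum_one] at this
      exact this
    have hA := isingSum_update t c (t c) (bondSpin e)
    rw [Function.update_eq_self] at hZ hA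
    rw [isingCorr, hZ, hA]
  have hr := ht c
  set z := isingZ t₀
  set a := isingSum t₀ (bondSpin e)
  set d := isingSum t₀ (bondSpin c)
  set q := isingSum t₀ (fun σ => bondSpin e σ * bondSpin c σ)
  set r := t c
  have hgks' : a * d ≤ q * z := hgks
  have hleb' : z * q ≤ a * d + isingSum t₀ (bondSpin (e.1, c.1)) * isingSum t₀ (bondSpin (e.2, c.2))
      + isingSum t₀ (bondSpin (e.1, c.2)) * isingSum t₀ (bondSpin (e.2, c.1)) := hleb
  have hcorr : ∀ b, isingSum t₀ (bondSpin b) = z * isingCorr t₀ b := fun b => by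
    rw [isingCorr, mul_div_cancel₀ _ hz.ne']
  rw [hcorr, hcorr, hcorr, hcorr] at hleb'
  have h0 : isingCorr t₀ e = a / z := rfl
  have hden : 0 < z + r * d := by nlinarith [mul_nonneg hr.1 hd0]
  have h1 : (a + r * q) / (z + r * d) ≤ a / z + r * ((q * z - a * d) / (z * z)) := by
    have e1 : a / z + r * ((q * z - a * d) / (z * z)) - (a + r * q) / (z + r * d) =
        r * r * d * (q * z - a * d) / (z * z * (z + r * d)) := by
      field_simp
      ring
    have : 0 ≤ r * r * d * (q * z - a * d) / (z * z * (z + r * d)) :=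
      div_nonneg (mul_nonneg (mul_nonneg (mul_nonneg hr.1 hr.1) hd0) (by linarith))
        (by positivity)
    linarith
  have h2 : (q * z - a * d) / (z * z) ≤ isingCorr t₀ (e.1, c.1) * isingCorr t₀ (e.2, c.2) +
      isingCorr t₀ (e.1, c.2) * isingCorr t₀ (e.2, c.1) := by
    rw [div_le_iff₀ (mul_pos hz hz)]
    linarith
  have h3 : isingCorr t₀ (e.1, c.1) * isingCorr t₀ (e.2, c.2) +
      isingCorr t₀ (e.1, c.2) * isingCorr t₀ (e.2, c.1) ≤
      isingCorr t (e.1, c.1) * isingCorr t (e.2, c.2) +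
      isingCorr t (e.1, c.2) * isingCorr t (e.2, c.1) :=
    add_le_add
      (mul_le_mul (hmono _) (hmono _) (hnn _) (isingCorr_nonneg ht _))
      (mul_le_mul (hmono _) (hmono _) (hnn _) (isingCorr_nonneg ht _))
  rw [hS, h0]
  have := mul_le_mul_of_nonneg_left (h2.trans h3) hr.1
  linarith

/-- Simon's inequality: correlations between the two sides of a set are bounded through the bonds
crossing its boundary. -/
theorem isingCorr_le_sum_boundary {t : V × V → ℝ} (ht : Admissible t) (P : V → Prop)
    [DecidablePred P] {i j : V} (hij : ¬ (P i ↔ P j)) :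
    isingCorr t (i, j) ≤ ∑ b : V × V with ¬ (P b.1 ↔ P b.2),
      t b * (isingCorr t (i, b.1) * isingCorr t (b.2, j) +
        isingCorr t (i, b.2) * isingCorr t (b.1, j)) := by
  have key : ∀ B : Finset (V × V), isingCorr t (i, j) ≤ isingCorr (removeBonds B t) (i, j) +
      ∑ b ∈ B, t b * (isingCorr t (i, b.1) * isingCorr t (b.2, j) +
        isingCorr t (i, b.2) * isingCorr t (b.1, j)) := by
    intro B
    induction B using Finset.induction_on with
    | empty =>
      have : removeBonds ∅ t = t := by funext b; simp [removeBonds]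
      simp [this]
    | insert c B hc ih =>
      have hadm := admissible_removeBonds ht B
      have h1 := isingCorr_le_update_zero_add hadm c (i, j)
      have h2 : Function.update (removeBonds B t) c 0 = removeBonds (insert c B) t := by
        funext b
        by_cases hb : b = c
        · subst hb; simp [removeBonds]
        · simp [removeBonds, hb]
      have h3 : removeBonds B t c = t c := by simp [removeBonds, hc]
      rw [h2, h3] at h1
      have hm : ∀ b, isingCorr (removeBonds B t) b ≤ isingCorr t b :=
        isingCorr_mono hadm ht (removeBonds_le ht B)
      have hn : ∀ b, 0 ≤ isingCorr (removeBonds B t) b := isingCorr_nonneg hadm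
      have h4 : t c * (isingCorr (removeBonds B t) (i, c.1) *
            isingCorr (removeBonds B t) (j, c.2) +
          isingCorr (removeBonds B t) (i, c.2) * isingCorr (removeBonds B t) (j, c.1)) ≤
          t c * (isingCorr t (i, c.1) * isingCorr t (c.2, j) +
            isingCorr t (i, c.2) * isingCorr t (c.1, j)) := by
        rw [isingCorr_swap t c.2 j, isingCorr_swap t c.1 j]
        exact mul_le_mul_of_nonneg_left (add_le_add
          (mul_le_mul (hm _) (hm _) (hn _) (isingCorr_nonneg ht _))
          (mul_le_mul (hm _) (hm _) (hn _) (isingCorr_nonneg ht _))) (ht c).1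
      rw [Finset.sum_insert hc]
      linarith
  refine (key (Finset.univ.filter fun b => ¬ (P b.1 ↔ P b.2))).trans_eq ?_
  rw [isingCorr_eq_zero_of_separated P (fun b hb => ?_) hij, zero_add]
  simp [removeBonds, hb]

lemma one_le_mul_algWeight {s : ℝ} (hs : 0 ≤ s) {L : ℝ} (hL : 0 ≤ L) {n : ℤ}
    (hn : |(n : ℝ)| ≤ L) : 1 ≤ (1 + L) ^ s * algWeight s n := by
  have := algWeight_le_mul (s := s) (c := 1 + L) (m := 0) (n := n) hs (by linarith) (by simpa)
  simpa [algWeight] using this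

lemma algWeight_sub_le {s : ℝ} (hs : 0 ≤ s) {L : ℝ} (hL : 0 ≤ L) {i k l : ℤ}
    (h : |((k - i : ℤ) : ℝ)| ≤ L) : algWeight s (k - l) ≤ (1 + L) ^ s * algWeight s (i - l) := by
  refine algWeight_le_mul hs (by linarith) ?_
  have h1 : |((i - l : ℤ) : ℝ)| ≤ |((k - i : ℤ) : ℝ)| + |((k - l : ℤ) : ℝ)| := by
    have := abs_add_le (-((k - i : ℤ) : ℝ)) ((k - l : ℤ) : ℝ)
    rw [abs_neg] at this
    refine le_trans (le_of_eq ?_) this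
    congr 1
    push_cast
    ring
  nlinarith [abs_nonneg ((k - l : ℤ) : ℝ)]

/-- If one end of the bond `{k, l}` is within distance `L` of `i`, then its weight is bounded, up to a
constant, by the weight of the bond `{i, l}` times a factor which is summable over `k`. -/
lemma algWeight_le_of_leaves {s : ℝ} (hs : 0 ≤ s) {L : ℝ} (hL : 0 ≤ L) {i k l : ℤ}
    (h : |((k - i : ℤ) : ℝ)| ≤ L ∨ |((l - i : ℤ) : ℝ)| ≤ L) :
    algWeight s (k - l) ≤ (1 + L) ^ s * (1 + L) ^ s * algWeight s (i - l) *
      (algWeight s (k - i) + algWeight s (k - l)) := by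
  have p1 := algWeight_pos s (k - l)
  have p2 := algWeight_pos s (k - i)
  have p3 := algWeight_pos s (i - l)
  have hq : 1 ≤ (1 + L) ^ s := Real.one_le_rpow (by linarith) hs
  rcases h with h | h
  · have h1 := algWeight_sub_le (l := l) hs hL h
    have h2 := one_le_mul_algWeight hs hL h
    calc algWeight s (k - l) ≤ ((1 + L) ^ s * algWeight s (i - l)) * 1 := by linarith
      _ ≤ ((1 + L) ^ s * algWeight s (i - l)) * ((1 + L) ^ s * algWeight s (k - i)) := by gcongr
      _ = (1 + L) ^ s * (1 + L) ^ s * algWeight s (i - l) * algWeight s (k - i) := by ring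
      _ ≤ _ := by gcongr; linarith
  · have h2 := one_le_mul_algWeight hs hL h
    rw [algWeight_sub_comm] at h2
    calc algWeight s (k - l) = 1 * 1 * algWeight s (k - l) := by ring
      _ ≤ (1 + L) ^ s * ((1 + L) ^ s * algWeight s (i - l)) * algWeight s (k - l) := by gcongr
      _ = (1 + L) ^ s * (1 + L) ^ s * algWeight s (i - l) * algWeight s (k - l) := by ring
      _ ≤ _ := by gcongr; linarith

/-- A bond leaving the interval of radius `L` around `i` crosses one of the two ends of it. -/
lemma crosses_of_leaves {i k l : ℤ} {L : ℕ} (h : ¬ (|k - i| ≤ L ↔ |l - i| ≤ L)) :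
    Crosses (i + L) k l ∨ Crosses (i - L - 1) k l := by
  simp only [abs_le] at h
  unfold Crosses
  lia

/-- At every temperature, the two-point function of a one-dimensional Ising model has the same
algebraic decay `s > 2` as its couplings. Simon's inequality for a large interval around `i`
is a substochastic subsolution inequality: bonds leaving the interval which start close to `i` are
long and hence weak, and for all others the correlation with `i` is small. -/
theorem exists_isingCorr_decay {s B : ℝ} (hs : 2 < s) (hB : 0 ≤ B) :
    ∃ C : ℝ, 0 < C ∧ ∀ (V : Type) [Fintype V] [DecidableEq V] (x : V → ℤ), Function.Injective x →
      ∀ t : V × V → ℝ, AlgBonds s B x t → ∀ i j, isingCorr t (i, j) ≤ C * algWeight s (x i - x j) := by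
  have hs0 : 0 ≤ s := by linarith
  set W := algMass (s / 2) ^ 2 with hW
  have hW0 : 0 ≤ W := sq_nonneg _
  set ε := 1 / (16 * (B * W + 1)) with hε
  have hBW : 0 ≤ B * W := mul_nonneg hB hW0
  have hε0 : 0 < ε := by positivity
  have hεW : ε * (B * W) ≤ 1 / 16 := by
    rw [hε, div_mul_eq_mul_div, div_le_div_iff₀ (by positivity) (by norm_num)]
    linarith
  obtain ⟨R', hR'0, hR'⟩ := exists_isingCorr_le hs hB hε0
  obtain ⟨R, hR⟩ := exists_nat_ge R'
  set D := algMass ((s + 2) / 4) ^ 2 with hD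
  obtain ⟨N, hN0, hN⟩ : ∃ N : ℕ, 0 < N ∧ B * ((N : ℝ) ^ (-((s - 2) / 2)) * D) < 1 / 16 := by
    have h1 : Filter.Tendsto (fun N : ℕ => (N : ℝ) ^ (-((s - 2) / 2))) Filter.atTop (nhds 0) :=
      (tendsto_rpow_neg_atTop (by linarith)).comp tendsto_natCast_atTop_atTop
    have h2 : Filter.Tendsto (fun N : ℕ => B * ((N : ℝ) ^ (-((s - 2) / 2)) * D))
        Filter.atTop (nhds (B * (0 * D))) := (h1.mul_const _).const_mul _
    have h3 : B * (0 * D) < 1 / 16 := by simp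
    obtain ⟨N, hN⟩ := ((h2.eventually_lt_const h3).and (Filter.eventually_gt_atTop 0)).exists
    exact ⟨N, hN.2, hN.1⟩
  set L : ℕ := R + N with hL
  have hL0 : (0 : ℝ) ≤ L := by positivity
  set Q := (1 + (L : ℝ)) ^ s * (1 + (L : ℝ)) ^ s with hQ
  have hQ0 : 0 ≤ Q := by positivity
  have hm0 := algMass_nonneg s
  obtain ⟨C, hC, hdec⟩ := exists_decay_of_subsolution (θ := 1 / 2) (B := 4 * (B * Q * algMass s))
    (s := s) (L : ℝ) (by norm_num) (by norm_num) (by positivity) (by linarith)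
  refine ⟨C, hC, ?_⟩
  intro V _ _ x hx t ht i j
  have hadm := ht.admissible
  let sep : V → V × V → Prop := fun i b => ¬ (|x b.1 - x i| ≤ L ↔ |x b.2 - x i| ≤ L)
  let κ : V → V → ℝ := fun i l => ∑ b : V × V with sep i b,
    t b * ((if b.2 = l then isingCorr t (i, b.1) else 0) +
      (if b.1 = l then isingCorr t (i, b.2) else 0))
  have hc0 := isingCorr_nonneg hadm
  have hc1 := isingCorr_le_one hadm
  have hw0 := algWeight_pos s
  refine hdec V x hx j κ (fun i => isingCorr t (i, j)) ?_ ?_ ?_ (fun i => hc1 _) ?_ i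
  · intro i l
    refine Finset.sum_nonneg fun b _ => mul_nonneg (hadm b).1 (add_nonneg ?_ ?_) <;>
      split_ifs <;> first | exact hc0 _ | exact le_rfl
  · intro i
    have hrow : ∑ l, κ i l =
        ∑ b : V × V with sep i b, t b * (isingCorr t (i, b.1) + isingCorr t (i, b.2)) := by
      simp only [κ]
      rw [Finset.sum_comm]
      refine Finset.sum_congr rfl fun b _ => ?_
      rw [← Finset.mul_sum, Finset.sum_add_distrib]
      simp
    set f : V × V → ℝ := fun b => 2 * (ε * (B * algWeight s (x b.1 - x b.2))) +
      if (N : ℝ) ≤ |((x b.1 - x b.2 : ℤ) : ℝ)| then 2 * (B * algWeight s (x b.1 - x b.2)) else 0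
      with hf
    have hf0 : ∀ b, 0 ≤ f b := fun b => by
      have := (hw0 (x b.1 - x b.2)).le
      simp only [hf]
      split_ifs <;> positivity
    have hterm : ∀ b, sep i b → t b * (isingCorr t (i, b.1) + isingCorr t (i, b.2)) ≤ f b := by
      intro b hb
      have hw := mul_nonneg hB (hw0 (x b.1 - x b.2)).le
      by_cases hlong : (N : ℝ) ≤ |((x b.1 - x b.2 : ℤ) : ℝ)|
      · simp only [hf, if_pos hlong]
        have h1 : t b * (isingCorr t (i, b.1) + isingCorr t (i, b.2)) ≤
            B * algWeight s (x b.1 - x b.2) * 2 :=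
          mul_le_mul (ht.le b) (by linarith [hc1 (i, b.1), hc1 (i, b.2)])
            (add_nonneg (hc0 _) (hc0 _)) hw
        have h2 := mul_nonneg hε0.le hw
        linarith
      · simp only [hf, if_neg hlong, add_zero]
        have hfar : (R : ℤ) ≤ |x i - x b.1| ∧ (R : ℤ) ≤ |x i - x b.2| := by
          have hlong' : |x b.1 - x b.2| < N := by
            have := not_le.1 hlong
            exact_mod_cast this
          simp only [sep, abs_le, hL] at hb
          rw [abs_lt] at hlong'
          simp only [le_abs]
          push_cast at hb
          constructor <;> lia
        have h1 := hR' V x hx t ht (i, b.1) (hR.trans (by exact_mod_cast hfar.1))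
        have h2 := hR' V x hx t ht (i, b.2) (hR.trans (by exact_mod_cast hfar.2))
        have h3 : t b * (isingCorr t (i, b.1) + isingCorr t (i, b.2)) ≤
            B * algWeight s (x b.1 - x b.2) * (2 * ε) :=
          mul_le_mul (ht.le b) (by linarith) (add_nonneg (hc0 _) (hc0 _)) hw
        linarith
    have hcut : ∀ m : ℤ, ∑ b : V × V with Crosses m (x b.1) (x b.2), f b ≤ 1 / 4 := by
      intro m
      simp only [hf]
      rw [Finset.sum_add_distrib, ← Finset.sum_filter, Finset.filter_filter, ← Finset.mul_sum,
        ← Finset.mul_sum, ← Finset.mul_sum, ← Finset.mul_sum, ← Finset.mul_sum]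
      have h1 := mul_le_mul_of_nonneg_left
        (mul_le_mul_of_nonneg_left (sum_crosses_algWeight_le hx hs m) hB) hε0.le
      have h2 := mul_le_mul_of_nonneg_left (sum_long_crosses_algWeight_le hx hs m
        (show (0 : ℝ) < N by exact_mod_cast hN0)) hB
      linarith
    rw [hrow]
    calc _ ≤ ∑ b : V × V with sep i b, f b :=
          Finset.sum_le_sum fun b hb => hterm b (Finset.mem_filter.1 hb).2
      _ ≤ ∑ b : V × V with Crosses (x i + L) (x b.1) (x b.2), f b +
          ∑ b : V × V with Crosses (x i - L - 1) (x b.1) (x b.2), f b := by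
          simp only [Finset.sum_filter]
          rw [← Finset.sum_add_distrib]
          refine Finset.sum_le_sum fun b _ => ?_
          have := hf0 b
          by_cases hb : sep i b
          · rw [if_pos hb]
            rcases crosses_of_leaves hb with h | h
            · rw [if_pos h]; split_ifs <;> linarith
            · rw [if_pos h]; split_ifs <;> linarith
          · rw [if_neg hb]; split_ifs <;> linarith
      _ ≤ 1 / 4 + 1 / 4 := add_le_add (hcut _) (hcut _)
      _ = _ := by norm_num
  · intro i l
    have hbound : ∀ k, |x k - x i| ≤ L ∨ |x l - x i| ≤ L → B * algWeight s (x k - x l) ≤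
        B * (Q * algWeight s (x i - x l) *
          (algWeight s (x k - x i) + algWeight s (x k - x l))) := by
      intro k hk
      refine mul_le_mul_of_nonneg_left (algWeight_le_of_leaves hs0 hL0 ?_) hB
      rcases hk with h | h
      · exact Or.inl (by exact_mod_cast h)
      · exact Or.inr (by exact_mod_cast h)
    have hsum : ∑ k, B * (Q * algWeight s (x i - x l) *
        (algWeight s (x k - x i) + algWeight s (x k - x l))) ≤
        2 * (B * Q * algMass s) * algWeight s (x i - x l) := by
      have h1 := sum_algWeight_le (s := s) (by linarith) hx (x i)
      have h2 := sum_algWeight_le (s := s) (by linarith) hx (x l)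
      rw [← Finset.mul_sum, ← Finset.mul_sum, Finset.sum_add_distrib]
      have h3 : 0 ≤ B * (Q * algWeight s (x i - x l)) := by
        have := (hw0 (x i - x l)).le
        positivity
      have := mul_le_mul_of_nonneg_left (add_le_add h1 h2) h3
      linarith
    have hnn : ∀ k, 0 ≤ B * (Q * algWeight s (x i - x l) *
        (algWeight s (x k - x i) + algWeight s (x k - x l))) := fun k => by
      have h1 := (hw0 (x i - x l)).le
      have h2 := (hw0 (x k - x i)).le
      have h3 := (hw0 (x k - x l)).le
      positivity
    have hsep : ∀ k k', sep i (k, k') → |x k - x i| ≤ L ∨ |x k' - x i| ≤ L := by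
      intro k k' h
      simp only [sep] at h
      tauto
    calc κ i l ≤ ∑ b : V × V with sep i b, ((if b.2 = l then t b else 0) +
          (if b.1 = l then t b else 0)) := by
          refine Finset.sum_le_sum fun b _ => ?_
          rw [mul_add]
          refine add_le_add ?_ ?_
          · split_ifs
            · exact mul_le_of_le_one_right (hadm b).1 (hc1 _)
            · simp
          · split_ifs
            · exact mul_le_of_le_one_right (hadm b).1 (hc1 _)
            · simp
      _ = ∑ k, (if sep i (k, l) then t (k, l) else 0) +
          ∑ k, (if sep i (l, k) then t (l, k) else 0) := by
          rw [Finset.sum_add_distrib]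
          congr 1
          · rw [Finset.sum_filter, Fintype.sum_prod_type]
            refine Finset.sum_congr rfl fun k _ => ?_
            rw [Finset.sum_eq_single l]
            · simp
            · intro b _ hb; simp [hb]
            · simp
          · rw [Finset.sum_filter, Fintype.sum_prod_type, Finset.sum_eq_single l]
            · simp
            · intro b _ hb; simp [hb]
            · simp
      _ ≤ ∑ k, B * (Q * algWeight s (x i - x l) *
            (algWeight s (x k - x i) + algWeight s (x k - x l))) +
          ∑ k, B * (Q * algWeight s (x i - x l) *
            (algWeight s (x k - x i) + algWeight s (x k - x l))) := by
          refine add_le_add (Finset.sum_le_sum fun k _ => ?_) (Finset.sum_le_sum fun k _ => ?_)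
          · split_ifs with h
            · exact (ht.le (k, l)).trans (hbound k (hsep _ _ h))
            · exact hnn k
          · split_ifs with h
            · have h1 := ht.le (l, k)
              simp only at h1
              rw [algWeight_sub_comm] at h1
              exact h1.trans (hbound k (hsep _ _ h).symm)
            · exact hnn k
      _ ≤ _ := by linarith
  · intro i hij
    have hP : ¬ (|x i - x i| ≤ (L : ℤ) ↔ |x j - x i| ≤ (L : ℤ)) := by
      intro h
      have h1 : |x j - x i| ≤ (L : ℤ) := h.1 (by simp)
      rw [abs_sub_comm] at h1
      have h2 : |((x i - x j : ℤ) : ℝ)| ≤ L := by exact_mod_cast h1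
      linarith
    refine (isingCorr_le_sum_boundary hadm (fun k => |x k - x i| ≤ (L : ℤ)) hP).trans_eq ?_
    simp only [κ, Finset.sum_mul]
    rw [Finset.sum_comm]
    refine Finset.sum_congr rfl fun b _ => ?_
    simp [add_mul, mul_add, mul_assoc, Finset.sum_add_distrib]

end Simon

open MeasureTheory

/-! ### Green's function of a diagonally dominant matrix -/

section Green

variable {V : Type} [Fintype V]

/-- The symmetric matrix with diagonal `m` and off-diagonal part `-J`, where `J` may have both signs,
is strictly diagonally dominant with margin `d`. -/
structure Dominant (d : ℝ) (m : V → ℝ) (J : V → V → ℝ) : Prop where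
  symm : ∀ k l, J k l = J l k
  diag : ∀ k, J k k = 0
  row : ∀ k, ∑ l, |J k l| + d ≤ m k

/-- The operator with matrix `diag m - J`. -/
def latticeOp (m : V → ℝ) (J : V → V → ℝ) (p : V → ℝ) (k : V) : ℝ := m k * p k - ∑ l, J k l * p l

lemma latticeOp_add (m : V → ℝ) (J : V → V → ℝ) (p s : V → ℝ) (k : V) :
    latticeOp m J (p + s) k = latticeOp m J p k + latticeOp m J s k := by
  simp only [latticeOp, Pi.add_apply, mul_add, Finset.sum_add_distrib]; ring

lemma latticeOp_smul (m : V → ℝ) (J : V → V → ℝ) (r : ℝ) (p : V → ℝ) (k : V) :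
    latticeOp m J (r • p) k = r * latticeOp m J p k := by
  simp only [latticeOp, Pi.smul_apply, smul_eq_mul, mul_sub, Finset.mul_sum]
  congr 1
  · ring
  · exact Finset.sum_congr rfl fun l _ => by ring

variable {d : ℝ} {m : V → ℝ} {J : V → V → ℝ}

/-- The minimum principle. -/
lemma Dominant.nonneg_of_latticeOp_nonneg (h : Dominant d m J) (hd : 0 < d) (hJ : ∀ k l, 0 ≤ J k l)
    {p : V → ℝ} (hp : ∀ k, 0 ≤ latticeOp m J p k) (k : V) : 0 ≤ p k := by
  obtain ⟨q, -, hq⟩ := Finset.exists_min_image Finset.univ p ⟨k, by simp⟩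
  refine le_trans ?_ (hq k (by simp))
  by_contra hneg
  push Not at hneg
  have h1 := hp q
  have h2 : ∑ l, J q l * p q ≤ ∑ l, J q l * p l :=
    Finset.sum_le_sum fun l _ => mul_le_mul_of_nonneg_left (hq l (by simp)) (hJ q l)
  rw [← Finset.sum_mul] at h2
  have h3 := h.row q
  simp only [abs_of_nonneg (hJ q _)] at h3
  unfold latticeOp at h1
  nlinarith

lemma Dominant.eq_of_latticeOp_eq (h : Dominant d m J) (hd : 0 < d) (hJ : ∀ k l, 0 ≤ J k l)
    {p p' : V → ℝ} (hp : ∀ k, latticeOp m J p k = latticeOp m J p' k) : p = p' := by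
  have hsub : ∀ p p' : V → ℝ, (∀ k, latticeOp m J p k = latticeOp m J p' k) → ∀ k, p' k ≤ p k := by
    intro p p' hp k
    have := h.nonneg_of_latticeOp_nonneg hd hJ (p := p + (-1 : ℝ) • p') (fun k => by
      rw [latticeOp_add, latticeOp_smul, hp]; linarith) k
    simp only [Pi.add_apply, Pi.smul_apply, smul_eq_mul] at this
    linarith
  exact funext fun k => le_antisymm (hsub p' p (fun k => (hp k).symm) k) (hsub p p' hp k)

lemma Dominant.exists_green [DecidableEq V] (h : Dominant d m J) (hd : 0 < d) :
    ∃ G : V → V → ℝ, ∀ j k, latticeOp m J (fun l => G l j) k = if k = j then 1 else 0 := by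
  let Q : Matrix V V ℝ := Matrix.diagonal m - Matrix.of J
  have hdet : Q.det ≠ 0 := by
    refine det_ne_zero_of_sum_row_lt_diag fun k => ?_
    have h1 : ∑ j ∈ Finset.univ.erase k, ‖Q k j‖ = ∑ j ∈ Finset.univ.erase k, |J k j| :=
      Finset.sum_congr rfl fun j hj => by
        simp [Q, Matrix.diagonal_apply_ne _ (Finset.ne_of_mem_erase hj).symm]
    have h2 : ‖Q k k‖ = m k := by
      have : 0 ≤ ∑ l, |J k l| := Finset.sum_nonneg fun l _ => abs_nonneg _
      have h3 := h.row k
      simp only [Q, Matrix.sub_apply, Matrix.diagonal_apply_eq, Matrix.of_apply, h.diag, sub_zero]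
      exact abs_of_nonneg (by linarith)
    have h3 : ∑ j ∈ Finset.univ.erase k, |J k j| ≤ ∑ j, |J k j| :=
      Finset.sum_le_sum_of_subset_of_nonneg (Finset.subset_univ _) fun _ _ _ => abs_nonneg _
    rw [h1, h2]
    linarith [h.row k]
  refine ⟨fun l j => Q⁻¹ l j, fun j k => ?_⟩
  have h1 : Q * Q⁻¹ = 1 := Matrix.mul_nonsing_inv Q (isUnit_iff_ne_zero.2 hdet)
  have h2 := congrFun (congrFun h1 k) j
  rw [Matrix.mul_apply, Matrix.one_apply] at h2
  rw [← h2]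
  simp only [latticeOp, Q, Matrix.sub_apply, Matrix.of_apply, sub_mul, Finset.sum_sub_distrib]
  congr 1
  rw [Finset.sum_eq_single k]
  · simp
  · intro l _ hl; simp [Matrix.diagonal_apply_ne _ hl.symm]
  · simp

/-- Green's function inherits the algebraic decay of the matrix. -/
theorem exists_green_decay {s d a A : ℝ} (hs : 1 < s) (hd : 0 < d) (ha : d ≤ a) (hA : 0 ≤ A) :
    ∃ C : ℝ, 0 < C ∧ ∀ (V : Type) [Fintype V] [DecidableEq V] (x : V → ℤ), Function.Injective x →
      ∀ (m : V → ℝ) (J : V → V → ℝ), Dominant d m J → (∀ k l, 0 ≤ J k l) → (∀ k, m k ≤ a) →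
      (∀ k l, J k l ≤ A * algWeight s (x k - x l)) → ∀ G : V → V → ℝ,
      (∀ j k, latticeOp m J (fun l => G l j) k = if k = j then 1 else 0) →
      ∀ k j, 0 ≤ G k j ∧ G k j ≤ C * algWeight s (x k - x j) := by
  have ha0 : 0 < a := hd.trans_le ha
  obtain ⟨C, hC, hdec⟩ := exists_decay_of_subsolution (θ := 1 - d / a) (B := A / d) (s := s) 0
    (by rw [sub_nonneg, div_le_one ha0]; exact ha) (by have := div_pos hd ha0; linarith)
    (by positivity) hs
  refine ⟨C / d, by positivity, ?_⟩
  intro V _ _ x hx m J h hJ hma hJA G hG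
  have hm : ∀ k, d ≤ m k := fun k => by
    have : 0 ≤ ∑ l, |J k l| := Finset.sum_nonneg fun l _ => abs_nonneg _
    linarith [h.row k]
  have hrow : ∀ k, ∑ l, J k l ≤ m k - d := fun k => by
    have := h.row k
    simp only [abs_of_nonneg (hJ k _)] at this
    linarith
  have h0 : ∀ k j, 0 ≤ G k j := fun k j =>
    h.nonneg_of_latticeOp_nonneg hd hJ (p := fun l => G l j)
      (fun k => by rw [hG]; split_ifs <;> norm_num) k
  -- the constant `1 / d` is a supersolution
  have h1 : ∀ k j, G k j ≤ 1 / d := fun k j => by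
    have := h.nonneg_of_latticeOp_nonneg hd hJ
      (p := (fun _ => 1 / d) + (-1 : ℝ) • (fun l => G l j)) (fun k => by
        rw [latticeOp_add, latticeOp_smul, hG, latticeOp, ← Finset.sum_mul, ← sub_mul]
        have h2 : 1 ≤ (m k - ∑ l, J k l) * (1 / d) := by
          rw [mul_one_div, le_div_iff₀ hd]
          linarith [hrow k]
        split_ifs <;> linarith) k
    simp only [Pi.add_apply, Pi.smul_apply, smul_eq_mul] at this
    linarith
  intro k j
  refine ⟨h0 k j, ?_⟩
  have hfin := hdec V x hx j (fun k l => J k l / m k) (fun k => d * G k j)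
    (fun k l => div_nonneg (hJ k l) (hd.le.trans (hm k)))
    (fun k => by
      rw [← Finset.sum_div, div_le_iff₀ (hd.trans_le (hm k))]
      have h2 : d / a * m k ≤ d := by
        rw [div_mul_eq_mul_div, div_le_iff₀ ha0]
        exact mul_le_mul_of_nonneg_left (hma k) hd.le
      linarith [hrow k])
    (fun k l => by
      have hw := algWeight_pos s (x k - x l)
      calc J k l / m k ≤ A * algWeight s (x k - x l) / d :=
            div_le_div₀ (by positivity) (hJA k l) hd (hm k)
        _ = _ := by ring)
    (fun k => by
      have := mul_le_mul_of_nonneg_left (h1 k j) hd.le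
      rwa [mul_one_div, div_self hd.ne'] at this)
    (fun k hk => by
      have hkj : k ≠ j := by rintro rfl; simp at hk
      have h2 := hG j k
      rw [if_neg hkj, latticeOp] at h2
      have hmk := hd.trans_le (hm k)
      have h3 : G k j = ∑ l, J k l / m k * G l j := by
        simp_rw [div_mul_eq_mul_div]
        rw [← Finset.sum_div, eq_div_iff hmk.ne']
        linarith
      rw [h3, Finset.mul_sum]
      exact (Finset.sum_congr rfl fun l _ => by ring).le) k
  rw [div_mul_eq_mul_div, le_div_iff₀ hd]
  simpa only [mul_comm] using hfin

end Green

/-! ### Gaussian integrals -/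

section Gaussian

variable {V : Type} [Fintype V]

/-- The coupling energy `∑ k, ∑ l, J k l * p k * p l`. -/
def coupling (J : V → V → ℝ) (p : V → ℝ) : ℝ := ∑ k, ∑ l, J k l * p k * p l

/-- The unnormalized density with single-site weights `f` and pair couplings `J`. -/
def siteDensity (f : V → ℝ → ℝ) (J : V → V → ℝ) (p : V → ℝ) : ℝ :=
  (∏ k, f k (p k)) * Real.exp (coupling J p)

variable {d : ℝ} {m : V → ℝ} {J : V → V → ℝ}

lemma Dominant.abs_coupling_le (h : Dominant d m J) (p : V → ℝ) :
    |coupling J p| ≤ ∑ k, (m k - d) * p k ^ 2 := by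
  have hb : ∀ k l, |J k l * p k * p l| ≤ |J k l| * p k ^ 2 / 2 + |J l k| * p l ^ 2 / 2 := by
    intro k l
    rw [abs_mul, abs_mul, h.symm l k, ← sq_abs (p k), ← sq_abs (p l)]
    have := mul_nonneg (abs_nonneg (J k l)) (sq_nonneg (|p k| - |p l|))
    nlinarith
  calc |coupling J p| ≤ ∑ k, ∑ l, |J k l * p k * p l| :=
        (Finset.abs_sum_le_sum_abs _ _).trans
          (Finset.sum_le_sum fun k _ => Finset.abs_sum_le_sum_abs _ _)
    _ ≤ ∑ k, ∑ l, (|J k l| * p k ^ 2 / 2 + |J l k| * p l ^ 2 / 2) :=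
        Finset.sum_le_sum fun k _ => Finset.sum_le_sum fun l _ => hb k l
    _ = ∑ k, (∑ l, |J k l|) * p k ^ 2 := by
        simp_rw [Finset.sum_add_distrib]
        rw [Finset.sum_comm (f := fun k l => |J l k| * p l ^ 2 / 2), ← Finset.sum_add_distrib]
        refine Finset.sum_congr rfl fun k _ => ?_
        rw [← Finset.sum_add_distrib, Finset.sum_mul]
        exact Finset.sum_congr rfl fun l _ => by ring
    _ ≤ _ := Finset.sum_le_sum fun k _ =>
        mul_le_mul_of_nonneg_right (by linarith [h.row k]) (sq_nonneg _)

lemma integrable_exp_abs_sub_sq (c : ℝ) {d : ℝ} (hd : 0 < d) :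
    Integrable (fun x : ℝ => Real.exp (c * |x| - d * x ^ 2)) := by
  refine Integrable.mono' ((integrable_exp_neg_mul_sq (half_pos hd)).const_mul
    (Real.exp (c ^ 2 / (2 * d)))) (by fun_prop) (Filter.Eventually.of_forall fun x => ?_)
  rw [Real.norm_of_nonneg (Real.exp_pos _).le, ← Real.exp_add, Real.exp_le_exp]
  have h1 : 0 ≤ (c - d * |x|) ^ 2 / (2 * d) := by positivity
  have h2 : (c - d * |x|) ^ 2 / (2 * d) = c ^ 2 / (2 * d) - c * |x| + d / 2 * |x| ^ 2 := by
    field_simp; ring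
  rw [sq_abs] at h2
  linarith

lemma integrable_of_abs_le_exp {F : (V → ℝ) → ℝ} (hF : AEStronglyMeasurable F) {C c d : ℝ}
    (hd : 0 < d) (h : ∀ p, |F p| ≤ C * Real.exp (c * ∑ k, |p k| - d * ∑ k, p k ^ 2)) :
    Integrable F := by
  have h1 : Integrable (fun p : V → ℝ => ∏ k, Real.exp (c * |p k| - d * p k ^ 2)) :=
    Integrable.fintype_prod fun _ => integrable_exp_abs_sub_sq c hd
  refine Integrable.mono' (h1.const_mul C) hF (Filter.Eventually.of_forall fun p => ?_)
  rw [Real.norm_eq_abs, ← Real.exp_sum, Finset.sum_sub_distrib, ← Finset.mul_sum, ← Finset.mul_sum]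
  exact h p

lemma continuous_coupling (J : V → V → ℝ) : Continuous (coupling J) := by
  unfold coupling; fun_prop

/-- The quadratic form of `latticeOp`. -/
def latticeForm (m : V → ℝ) (J : V → V → ℝ) (p : V → ℝ) : ℝ := ∑ k, m k * p k ^ 2 - coupling J p

lemma continuous_latticeForm (m : V → ℝ) (J : V → V → ℝ) : Continuous (latticeForm m J) := by
  unfold latticeForm
  have := continuous_coupling J
  fun_prop

lemma Dominant.le_latticeForm (h : Dominant d m J) (p : V → ℝ) :
    d * ∑ k, p k ^ 2 ≤ latticeForm m J p := by
  have h1 := (le_abs_self _).trans (h.abs_coupling_le p)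
  simp only [sub_mul, Finset.sum_sub_distrib, ← Finset.mul_sum] at h1
  unfold latticeForm
  linarith

lemma latticeForm_neg (m : V → ℝ) (J : V → V → ℝ) (p : V → ℝ) :
    latticeForm m J (-p) = latticeForm m J p := by
  simp [latticeForm, coupling]

lemma latticeForm_add (hJ : ∀ k l, J k l = J l k) (p s : V → ℝ) :
    latticeForm m J (p + s) = latticeForm m J p + 2 * ∑ k, s k * latticeOp m J p k +
      ∑ k, s k * latticeOp m J s k := by
  have h1 : coupling J (p + s) = coupling J p + 2 * ∑ k, ∑ l, J k l * s k * p l + coupling J s := by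
    have h2 : ∑ k, ∑ l, J k l * p k * s l = ∑ k, ∑ l, J k l * s k * p l := by
      rw [Finset.sum_comm]
      exact Finset.sum_congr rfl fun k _ => Finset.sum_congr rfl fun l _ => by rw [hJ l k]; ring
    have h3 : coupling J (p + s) = coupling J p + ∑ k, ∑ l, J k l * p k * s l +
        ∑ k, ∑ l, J k l * s k * p l + coupling J s := by
      simp only [coupling, ← Finset.sum_add_distrib, Pi.add_apply]
      exact Finset.sum_congr rfl fun k _ => Finset.sum_congr rfl fun l _ => by ring
    rw [h3, h2]; ring
  have h4 : ∀ q : V → ℝ, ∑ k, s k * latticeOp m J q k =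
      ∑ k, m k * s k * q k - ∑ k, ∑ l, J k l * s k * q l := by
    intro q
    rw [← Finset.sum_sub_distrib]
    refine Finset.sum_congr rfl fun k _ => ?_
    rw [latticeOp, mul_sub, Finset.mul_sum]
    congr 1
    · ring
    · exact Finset.sum_congr rfl fun l _ => by ring
  have h5 : ∑ k, m k * (p + s) k ^ 2 = ∑ k, m k * p k ^ 2 + 2 * ∑ k, m k * s k * p k +
      ∑ k, m k * s k * s k := by
    rw [Finset.mul_sum, ← Finset.sum_add_distrib, ← Finset.sum_add_distrib]
    exact Finset.sum_congr rfl fun k _ => by rw [Pi.add_apply]; ring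
  rw [latticeForm, h1, h5, h4, h4, latticeForm, coupling, coupling]
  ring

lemma exp_abs_le_exp_sum (p : V → ℝ) (k : V) : |p k| ≤ Real.exp (1 * ∑ k, |p k|) := by
  have h1 : |p k| ≤ ∑ k, |p k| := Finset.single_le_sum (fun l _ => abs_nonneg (p l)) (by simp)
  have h2 := Real.add_one_le_exp (∑ k, |p k|)
  rw [one_mul]
  linarith

/-- The Gaussian weight. -/
def gaussDensity (m : V → ℝ) (J : V → V → ℝ) (p : V → ℝ) : ℝ := Real.exp (-latticeForm m J p)

lemma continuous_gaussDensity (m : V → ℝ) (J : V → V → ℝ) : Continuous (gaussDensity m J) := by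
  unfold gaussDensity
  have := continuous_latticeForm m J
  fun_prop

lemma Dominant.integrable_gauss (h : Dominant d m J) (hd : 0 < d) {F : (V → ℝ) → ℝ}
    (hF : Continuous F) {C c : ℝ} (hFC : ∀ p, |F p| ≤ C * Real.exp (c * ∑ k, |p k|)) :
    Integrable (fun p => F p * gaussDensity m J p) := by
  refine integrable_of_abs_le_exp (C := C) (c := c)
    ((hF.mul (continuous_gaussDensity m J)).aestronglyMeasurable) hd fun p => ?_
  have h1 : gaussDensity m J p ≤ Real.exp (-(d * ∑ k, p k ^ 2)) :=
    Real.exp_le_exp.2 (by linarith [h.le_latticeForm p])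
  have h0 : 0 < gaussDensity m J p := Real.exp_pos _
  rw [abs_mul, abs_of_pos h0, sub_eq_add_neg, Real.exp_add, ← mul_assoc]
  exact mul_le_mul (hFC p) h1 h0.le ((abs_nonneg _).trans (hFC p))

lemma Dominant.integrable_gaussDensity (h : Dominant d m J) (hd : 0 < d) :
    Integrable (gaussDensity m J) := by
  have := h.integrable_gauss hd (F := fun _ => 1) continuous_const (C := 1) (c := 0) (by simp)
  simpa using this

lemma Dominant.integrable_coord (h : Dominant d m J) (hd : 0 < d) (i : V) :
    Integrable (fun p => p i * gaussDensity m J p) :=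
  h.integrable_gauss hd (continuous_apply i) (C := 1) (c := 1)
    (fun p => by rw [one_mul]; exact exp_abs_le_exp_sum p i)

lemma Dominant.integrable_coord_mul (h : Dominant d m J) (hd : 0 < d) (i j : V) :
    Integrable (fun p => p i * p j * gaussDensity m J p) :=
  h.integrable_gauss hd ((continuous_apply i).mul (continuous_apply j)) (C := 1) (c := 2)
    (fun p => by
      have e : Real.exp (2 * ∑ k, |p k|) = Real.exp (1 * ∑ k, |p k|) * Real.exp (1 * ∑ k, |p k|) := by
        rw [← Real.exp_add]; congr 1; ring
      rw [one_mul, e, abs_mul]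
      exact mul_le_mul (exp_abs_le_exp_sum p i) (exp_abs_le_exp_sum p j) (abs_nonneg _)
        (Real.exp_pos _).le)

lemma integral_coord_gauss (m : V → ℝ) (J : V → V → ℝ) (i : V) :
    ∫ p, p i * gaussDensity m J p = 0 := by
  have h := integral_neg_eq_self (fun p : V → ℝ => p i * gaussDensity m J p) volume
  have h2 : ∀ p : V → ℝ, (-p) i * gaussDensity m J (-p) = -(p i * gaussDensity m J p) := fun p => by
    rw [gaussDensity, latticeForm_neg, gaussDensity, Pi.neg_apply, neg_mul]
  simp_rw [h2] at h
  rw [integral_neg] at h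
  linarith

/-- The covariance of the Gaussian weight is half of Green's function, by integration by parts. -/
lemma Dominant.integral_coord_mul_gauss [DecidableEq V] (h : Dominant d m J) (hd : 0 < d)
    (hJ : ∀ k l, 0 ≤ J k l) {G : V → V → ℝ}
    (hG : ∀ j k, latticeOp m J (fun l => G l j) k = if k = j then 1 else 0) (i j : V) :
    ∫ p, p i * p j * gaussDensity m J p = G i j / 2 * ∫ p, gaussDensity m J p := by
  set Z := ∫ p, gaussDensity m J p
  have hibp : ∀ k, ∫ p : V → ℝ, p j * (-(2 * latticeOp m J p k) * gaussDensity m J p) =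
      -∫ p : V → ℝ, (if k = j then 1 else 0) * gaussDensity m J p := by
    intro k
    have hint1 : Integrable (fun p : V → ℝ => p j * (-(2 * latticeOp m J p k) *
        gaussDensity m J p)) := by
      have e : (fun p : V → ℝ => p j * (-(2 * latticeOp m J p k) * gaussDensity m J p)) =
          fun p => (-(2 * m k)) * (p j * p k * gaussDensity m J p) +
            ∑ l, (2 * J k l) * (p j * p l * gaussDensity m J p) := by
        funext p
        simp only [latticeOp]
        have e2 : ∑ l, (2 * J k l) * (p j * p l * gaussDensity m J p) =
            2 * p j * gaussDensity m J p * ∑ l, J k l * p l := by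
          rw [Finset.mul_sum]
          exact Finset.sum_congr rfl fun l _ => by ring
        rw [e2]
        ring
      rw [e]
      exact ((h.integrable_coord_mul hd j k).const_mul _).add
        (integrable_finsetSum _ fun l _ => (h.integrable_coord_mul hd j l).const_mul _)
    refine integral_bilinear_hasLineDerivAt_right_eq_neg_left_of_integrable
      (B := ContinuousLinearMap.mul ℝ ℝ) (v := Pi.single k 1)
      (f := fun p : V → ℝ => p j) (f' := fun _ => if k = j then 1 else 0)
      (g := gaussDensity m J) (g' := fun p => -(2 * latticeOp m J p k) * gaussDensity m J p)
      ((h.integrable_gaussDensity hd).const_mul _) hint1 (h.integrable_coord hd j) ?_ ?_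
    · intro p _
      have h1 : HasDerivAt (fun t : ℝ => p j + t * (Pi.single k 1 : V → ℝ) j)
          (1 * (Pi.single k 1 : V → ℝ) j) 0 := ((hasDerivAt_id (0 : ℝ)).mul_const _).const_add _
      have h2 : 1 * (Pi.single k 1 : V → ℝ) j = if k = j then 1 else 0 := by
        rw [one_mul, Pi.single_apply]
        simp [eq_comm]
      rw [h2] at h1
      exact h1
    · intro p _
      have hexp : ∀ t : ℝ, gaussDensity m J (p + t • Pi.single k 1) =
          Real.exp (-(latticeForm m J p + 2 * latticeOp m J p k * t +
            latticeOp m J (Pi.single k 1) k * t ^ 2)) := by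
        intro t
        have hsum : ∀ q : V → ℝ, ∑ l, (t • (Pi.single k 1 : V → ℝ)) l * q l = t * q k := by
          intro q
          rw [Finset.sum_eq_single k]
          · simp
          · intro l _ hl; simp [hl]
          · simp
        rw [gaussDensity, latticeForm_add h.symm, hsum, hsum, latticeOp_smul]
        congr 1
        ring
      have h1 : HasDerivAt (fun t : ℝ => -(latticeForm m J p + 2 * latticeOp m J p k * t +
            latticeOp m J (Pi.single k 1) k * t ^ 2)) (-(2 * latticeOp m J p k)) 0 := by
        refine HasDerivAt.congr_deriv (HasDerivAt.fun_neg (HasDerivAt.fun_add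
          (((hasDerivAt_id' (0 : ℝ)).const_mul (2 * latticeOp m J p k)).const_add
            (latticeForm m J p))
          (((hasDerivAt_id' (0 : ℝ)).fun_pow 2).const_mul (latticeOp m J (Pi.single k 1) k)))) ?_
        simp
      have h3 := h1.exp
      change HasDerivAt (fun t : ℝ => gaussDensity m J (p + t • Pi.single k 1)) _ 0
      rw [funext hexp]
      convert h3 using 1
      simp [gaussDensity, mul_comm]
  have hlat : ∀ k, latticeOp m J (fun l => ∫ p, p l * p j * gaussDensity m J p) k =
      latticeOp m J ((Z / 2) • fun l => G l j) k := by
    intro k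
    have h1 := hibp k
    rw [latticeOp_smul, hG]
    have e : (fun p : V → ℝ => p j * (-(2 * latticeOp m J p k) * gaussDensity m J p)) =
        fun p => (-(2 * m k)) * (p k * p j * gaussDensity m J p) +
          ∑ l, (2 * J k l) * (p l * p j * gaussDensity m J p) := by
      funext p
      simp only [latticeOp]
      have e2 : ∑ l, (2 * J k l) * (p l * p j * gaussDensity m J p) =
          2 * p j * gaussDensity m J p * ∑ l, J k l * p l := by
        rw [Finset.mul_sum]
        exact Finset.sum_congr rfl fun l _ => by ring
      rw [e2]
      ring
    rw [e, integral_add ((h.integrable_coord_mul hd k j).const_mul _)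
      (integrable_finsetSum _ fun l _ => (h.integrable_coord_mul hd l j).const_mul _),
      integral_const_mul, integral_finsetSum _
        (fun l _ => (h.integrable_coord_mul hd l j).const_mul _), integral_const_mul] at h1
    simp_rw [integral_const_mul] at h1
    have e3 : ∑ l, 2 * J k l * ∫ p, p l * p j * gaussDensity m J p =
        2 * ∑ l, J k l * ∫ p, p l * p j * gaussDensity m J p := by
      rw [Finset.mul_sum]
      exact Finset.sum_congr rfl fun l _ => by ring
    rw [e3] at h1
    rw [latticeOp]
    linarith
  have := congrFun (h.eq_of_latticeOp_eq hd hJ hlat) i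
  simp only [Pi.smul_apply, smul_eq_mul] at this
  rw [this]
  ring

end Gaussian

/-! ### Gaussian spins in a random Ising field -/

section Mixture

variable {V : Type} [Fintype V] [DecidableEq V] {d : ℝ} {m : V → ℝ} {J : V → V → ℝ}

/-- The single-site weight `exp (-m r ^ 2) * cosh (β r)`, a Gaussian in a random field `±β`. -/
def coshWeight (m : V → ℝ) (β : ℝ) (k : V) (r : ℝ) : ℝ :=
  Real.exp (-(m k * r ^ 2)) * Real.cosh (β * r)

lemma siteDensity_exp_mul (m : V → ℝ) (J : V → V → ℝ) (h : V → ℝ → ℝ) (p : V → ℝ) :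
    siteDensity (fun k r => Real.exp (-(m k * r ^ 2)) * h k r) J p =
      (∏ k, h k (p k)) * gaussDensity m J p := by
  rw [siteDensity, Finset.prod_mul_distrib, ← Real.exp_sum, gaussDensity, latticeForm, neg_sub,
    sub_eq_add_neg, Real.exp_add, Finset.sum_neg_distrib]
  ring

/-- A product of hyperbolic cosines is an average over the signs of a field. -/
lemma prod_cosh_eq (β : ℝ) (p : V → ℝ) :
    ∏ k, Real.cosh (β * p k) =
      (1 / 2) ^ Fintype.card V * ∑ σ : V → ℤˣ, Real.exp (β * ∑ k, spin σ k * p k) := by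
  have h := Finset.prod_univ_sum (fun _ : V => (Finset.univ : Finset ℤˣ))
    (fun k u => Real.exp (β * (((u : ℤ) : ℝ) * p k)))
  rw [Fintype.piFinset_univ] at h
  have h1 : ∀ σ : V → ℤˣ, Real.exp (β * ∑ k, spin σ k * p k) =
      ∏ k, Real.exp (β * (((σ k : ℤ) : ℝ) * p k)) := fun σ => by
    rw [← Real.exp_sum, Finset.mul_sum]; rfl
  simp_rw [h1]
  rw [← h, ← Finset.card_univ, ← Finset.prod_const, ← Finset.prod_mul_distrib]
  refine Finset.prod_congr rfl fun k _ => ?_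
  have h2 : (Finset.univ : Finset ℤˣ) = {1, -1} := rfl
  rw [h2, Finset.sum_insert (by decide), Finset.sum_singleton, Real.cosh_eq]
  simp
  ring

/-- The center of the Gaussian weight in the field `β σ`. -/
def fieldShift (G : V → V → ℝ) (β : ℝ) (σ : V → ℤˣ) (k : V) : ℝ := β / 2 * ∑ l, G k l * spin σ l

lemma latticeOp_fieldShift {G : V → V → ℝ}
    (hG : ∀ j k, latticeOp m J (fun l => G l j) k = if k = j then 1 else 0) (β : ℝ) (σ : V → ℤˣ)
    (k : V) : latticeOp m J (fieldShift G β σ) k = β / 2 * spin σ k := by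
  have h1 : latticeOp m J (fieldShift G β σ) k =
      β / 2 * ∑ j, spin σ j * latticeOp m J (fun l => G l j) k := by
    simp only [latticeOp, fieldShift, mul_sub, Finset.sum_sub_distrib, Finset.mul_sum]
    congr 1
    · exact Finset.sum_congr rfl fun j _ => by ring
    · rw [Finset.sum_comm]
      exact Finset.sum_congr rfl fun j _ => Finset.sum_congr rfl fun l _ => by ring
  rw [h1]
  simp [hG]

lemma latticeForm_eq (hJ : ∀ k l, J k l = J l k) (p : V → ℝ) :
    latticeForm m J p = ∑ k, p k * latticeOp m J p k := by
  have h := latticeForm_add (m := m) hJ 0 p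
  rw [zero_add] at h
  rw [h]
  simp [latticeForm, coupling, latticeOp]

/-- Completing the square: a linear field translates the Gaussian weight. -/
lemma exp_field_mul_gaussDensity (hJ : ∀ k l, J k l = J l k) {G : V → V → ℝ}
    (hG : ∀ j k, latticeOp m J (fun l => G l j) k = if k = j then 1 else 0) (β : ℝ) (σ : V → ℤˣ)
    (p : V → ℝ) :
    Real.exp (β * ∑ k, spin σ k * p k) * gaussDensity m J p =
      Real.exp (β / 2 * ∑ k, spin σ k * fieldShift G β σ k) *
        gaussDensity m J (p - fieldShift G β σ) := by
  set s := fieldShift G β σ with hs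
  have h1 := latticeForm_add (m := m) hJ s (p - s)
  rw [add_sub_cancel, ← latticeForm_eq hJ (p - s), latticeForm_eq hJ s] at h1
  simp only [hs, latticeOp_fieldShift hG] at h1
  rw [← hs] at h1
  have h2 : ∑ k, (p - s) k * (β / 2 * spin σ k) =
      β / 2 * ∑ k, spin σ k * p k - β / 2 * ∑ k, spin σ k * s k := by
    rw [← mul_sub, ← Finset.sum_sub_distrib, Finset.mul_sum]
    exact Finset.sum_congr rfl fun k _ => by rw [Pi.sub_apply]; ring
  have h3 : ∑ k, s k * (β / 2 * spin σ k) = β / 2 * ∑ k, spin σ k * s k := by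
    rw [Finset.mul_sum]
    exact Finset.sum_congr rfl fun k _ => by ring
  rw [h2, h3] at h1
  rw [gaussDensity, gaussDensity, ← Real.exp_add, ← Real.exp_add, h1]
  congr 1
  ring

/-- The Ising bond parameters of the random field. -/
def fieldBonds (G : V → V → ℝ) (β : ℝ) (b : V × V) : ℝ := Real.tanh (β ^ 2 / 4 * G b.1 b.2)

lemma exp_mul_of_sq_eq_one {u : ℝ} (hu : u = 1 ∨ u = -1) (a : ℝ) :
    Real.exp (a * u) = Real.cosh a * (1 + Real.tanh a * u) := by
  have hc := (Real.cosh_pos a).ne'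
  rw [Real.tanh_eq_sinh_div_cosh]
  rcases hu with h | h <;> rw [h] <;> field_simp
  · rw [Real.cosh_add_sinh]
  · rw [← sub_eq_add_neg, Real.cosh_sub_sinh]

/-- The random field is distributed as an Ising model. -/
lemma exp_fieldShift (G : V → V → ℝ) (β : ℝ) (σ : V → ℤˣ) :
    Real.exp (β / 2 * ∑ k, spin σ k * fieldShift G β σ k) =
      (∏ b : V × V, Real.cosh (β ^ 2 / 4 * G b.1 b.2)) * isingWeight (fieldBonds G β) σ := by
  have h1 : β / 2 * ∑ k, spin σ k * fieldShift G β σ k =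
      ∑ b : V × V, β ^ 2 / 4 * G b.1 b.2 * bondSpin b σ := by
    rw [Fintype.sum_prod_type]
    simp only [fieldShift, Finset.mul_sum, bondSpin]
    exact Finset.sum_congr rfl fun k _ => Finset.sum_congr rfl fun l _ => by ring
  rw [h1, Real.exp_sum, isingWeight, ← Finset.prod_mul_distrib]
  exact Finset.prod_congr rfl fun b _ => exp_mul_of_sq_eq_one (bondSpin_eq b σ) _

lemma closedProb_tanh (a : ℝ) : closedProb (Real.tanh a) = Real.exp (-(2 * a)) := by
  have hc := (Real.cosh_pos a).ne'
  have h1 : closedProb (Real.tanh a) = Real.exp (-a) / Real.exp a := by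
    rw [closedProb, Real.tanh_eq_sinh_div_cosh, ← Real.cosh_sub_sinh, ← Real.cosh_add_sinh]
    have h2 : Real.cosh a + Real.sinh a ≠ 0 := by rw [Real.cosh_add_sinh]; exact (Real.exp_pos a).ne'
    field_simp
  rw [h1, ← Real.exp_sub]
  congr 1
  ring

lemma tanh_mem {a : ℝ} (ha : 0 ≤ a) : 0 ≤ Real.tanh a ∧ Real.tanh a ≤ 1 := by
  rw [Real.tanh_eq_sinh_div_cosh]
  have hc := Real.cosh_pos a
  refine ⟨div_nonneg (Real.sinh_nonneg_iff.2 ha) hc.le, ?_⟩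
  rw [div_le_one hc]
  have := Real.exp_pos (-a)
  rw [← Real.cosh_sub_sinh] at this
  linarith

lemma Dominant.integrable_mul_exp_field (h : Dominant d m J) (hd : 0 < d) {G : V → V → ℝ}
    (hG : ∀ j k, latticeOp m J (fun l => G l j) k = if k = j then 1 else 0) (β : ℝ) (σ : V → ℤˣ)
    (i j : V) :
    Integrable (fun p => Real.exp (β * ∑ k, spin σ k * p k) * gaussDensity m J p) ∧
    Integrable (fun p => p i * p j * (Real.exp (β * ∑ k, spin σ k * p k) * gaussDensity m J p)) ∧
    ∫ p, Real.exp (β * ∑ k, spin σ k * p k) * gaussDensity m J p =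
      Real.exp (β / 2 * ∑ k, spin σ k * fieldShift G β σ k) * ∫ p, gaussDensity m J p ∧
    ∫ p, p i * p j * (Real.exp (β * ∑ k, spin σ k * p k) * gaussDensity m J p) =
      Real.exp (β / 2 * ∑ k, spin σ k * fieldShift G β σ k) *
        ((∫ p, p i * p j * gaussDensity m J p) +
          fieldShift G β σ i * fieldShift G β σ j * ∫ p, gaussDensity m J p) := by
  simp_rw [exp_field_mul_gaussDensity h.symm hG]
  set s := fieldShift G β σ
  set E := Real.exp (β / 2 * ∑ k, spin σ k * s k)
  have hI0 := h.integrable_gaussDensity hd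
  have hI1 := h.integrable_coord hd
  have hI2 := h.integrable_coord_mul hd i j
  have hexp : ∀ p : V → ℝ, (p i + s i) * (p j + s j) * (E * gaussDensity m J p) =
      E * (p i * p j * gaussDensity m J p + s j * (p i * gaussDensity m J p) +
        s i * (p j * gaussDensity m J p) + s i * s j * gaussDensity m J p) := fun p => by ring
  have hA := (hI2.add ((hI1 i).const_mul (s j))).add ((hI1 j).const_mul (s i))
  have hB := hI0.const_mul (s i * s j)
  have hshift : (fun p : V → ℝ => p i * p j * (E * gaussDensity m J (p - s))) =
      fun p => (fun u : V → ℝ => (u i + s i) * (u j + s j) * (E * gaussDensity m J u)) (p - s) := by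
    funext p
    simp
  refine ⟨?_, ?_, ?_, ?_⟩
  · exact (hI0.comp_sub_right s).const_mul E
  · rw [hshift]
    refine Integrable.comp_sub_right (f := fun u : V → ℝ =>
      (u i + s i) * (u j + s j) * (E * gaussDensity m J u)) ?_ s
    simp_rw [hexp]
    exact (hA.add hB).const_mul E
  · rw [integral_const_mul, integral_sub_right_eq_self]
  · rw [hshift, integral_sub_right_eq_self (fun u : V → ℝ =>
      (u i + s i) * (u j + s j) * (E * gaussDensity m J u))]
    simp_rw [hexp]
    rw [integral_const_mul]
    congr 1
    have e1 := integral_add hA hB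
    have e2 := integral_add (hI2.add ((hI1 i).const_mul (s j))) ((hI1 j).const_mul (s i))
    have e3 := integral_add hI2 ((hI1 i).const_mul (s j))
    simp only [Pi.add_apply] at e1 e2 e3
    rw [e1, e2, e3, integral_const_mul, integral_const_mul, integral_const_mul,
      integral_coord_gauss, integral_coord_gauss]
    ring

/-- The two-point function of Gaussian spins in a random field in terms of Green's function and the
Ising two-point function of the field. -/
lemma Dominant.integral_coord_mul_cosh (h : Dominant d m J) (hd : 0 < d)
    (hJ : ∀ k l, 0 ≤ J k l) {G : V → V → ℝ}
    (hG : ∀ j k, latticeOp m J (fun l => G l j) k = if k = j then 1 else 0)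
    (hG0 : ∀ k l, 0 ≤ G k l) (β : ℝ) (i j : V) :
    ∫ p, p i * p j * siteDensity (coshWeight m β) J p =
      (G i j / 2 + β ^ 2 / 4 * ∑ k, ∑ l, G i k * G j l * isingCorr (fieldBonds G β) (k, l)) *
        ∫ p, siteDensity (coshWeight m β) J p := by
  have hadm : Admissible (fieldBonds G β) := fun b => tanh_mem (by have := hG0 b.1 b.2; positivity)
  have hden : ∀ p, siteDensity (coshWeight m β) J p = (1 / 2) ^ Fintype.card V *
      ∑ σ : V → ℤˣ, Real.exp (β * ∑ k, spin σ k * p k) * gaussDensity m J p := fun p => by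
    have := siteDensity_exp_mul m J (fun _ r => Real.cosh (β * r)) p
    rw [prod_cosh_eq] at this
    rw [← Finset.sum_mul, ← mul_assoc, ← this]
    rfl
  have hI := fun σ => h.integrable_mul_exp_field hd hG β σ i j
  set c := ∏ b : V × V, Real.cosh (β ^ 2 / 4 * G b.1 b.2)
  set Z0 := ∫ p, gaussDensity m J p
  have hZ : ∫ p, siteDensity (coshWeight m β) J p =
      (1 / 2) ^ Fintype.card V * (c * Z0) * isingZ (fieldBonds G β) := by
    simp_rw [hden]
    rw [integral_const_mul, integral_finsetSum _ fun σ _ => (hI σ).1, mul_assoc]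
    congr 1
    rw [isingZ, Finset.mul_sum]
    refine Finset.sum_congr rfl fun σ _ => ?_
    rw [(hI σ).2.2.1, exp_fieldShift]
    ring
  have hN : ∫ p, p i * p j * siteDensity (coshWeight m β) J p =
      (1 / 2) ^ Fintype.card V * (c * Z0) * isingSum (fieldBonds G β) (fun σ =>
        G i j / 2 + fieldShift G β σ i * fieldShift G β σ j) := by
    have e1 : ∀ p, p i * p j * siteDensity (coshWeight m β) J p = (1 / 2) ^ Fintype.card V *
        ∑ σ : V → ℤˣ, p i * p j * (Real.exp (β * ∑ k, spin σ k * p k) * gaussDensity m J p) := by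
      intro p
      rw [hden, mul_left_comm, ← Finset.mul_sum]
    simp_rw [e1]
    rw [integral_const_mul, integral_finsetSum _ fun σ _ => (hI σ).2.1, mul_assoc]
    congr 1
    rw [isingSum, Finset.mul_sum]
    refine Finset.sum_congr rfl fun σ _ => ?_
    rw [(hI σ).2.2.2, exp_fieldShift, h.integral_coord_mul_gauss hd hJ hG]
    ring
  have hfield : ∀ σ : V → ℤˣ, fieldShift G β σ i * fieldShift G β σ j =
      ∑ k, ∑ l, β ^ 2 / 4 * (G i k * G j l) * bondSpin (k, l) σ := fun σ => by
    rw [fieldShift, fieldShift, mul_mul_mul_comm, Finset.sum_mul_sum, Finset.mul_sum]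
    refine Finset.sum_congr rfl fun k _ => ?_
    rw [Finset.mul_sum]
    exact Finset.sum_congr rfl fun l _ => by rw [bondSpin]; ring
  have hS : isingSum (fieldBonds G β) (fun σ =>
        G i j / 2 + fieldShift G β σ i * fieldShift G β σ j) =
      (G i j / 2 + β ^ 2 / 4 * ∑ k, ∑ l, G i k * G j l * isingCorr (fieldBonds G β) (k, l)) *
        isingZ (fieldBonds G β) := by
    have hcorr : ∀ b, isingSum (fieldBonds G β) (bondSpin b) =
        isingCorr (fieldBonds G β) b * isingZ (fieldBonds G β) := fun b => by
      rw [isingCorr, div_mul_cancel₀ _ (isingZ_pos hadm).ne']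
    have hlin : ∀ (a : ℝ) (g : V → V → ℝ), isingSum (fieldBonds G β)
        (fun σ => a + ∑ k, ∑ l, g k l * bondSpin (k, l) σ) =
        a * isingZ (fieldBonds G β) + ∑ k, ∑ l, g k l * isingSum (fieldBonds G β) (bondSpin (k, l)) := by
      intro a g
      simp only [isingSum, isingZ, add_mul, Finset.sum_add_distrib, Finset.mul_sum, Finset.sum_mul]
      congr 1
      rw [Finset.sum_comm]
      refine Finset.sum_congr rfl fun k _ => ?_
      rw [Finset.sum_comm]
      exact Finset.sum_congr rfl fun l _ => Finset.sum_congr rfl fun σ _ => by ring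
    simp_rw [hfield, hlin, hcorr, add_mul, Finset.mul_sum, Finset.sum_mul]
    congr 1
    exact Finset.sum_congr rfl fun k _ => Finset.sum_congr rfl fun l _ => by ring
  rw [hN, hS, hZ]
  ring

end Mixture

/-- Algebraic decay of the two-point function for Gaussian spins in a random field. -/
theorem exists_cosh_decay {s d a A : ℝ} (β : ℝ) (hs : 2 < s) (hd : 0 < d) (ha : d ≤ a)
    (hA : 0 ≤ A) :
    ∃ C : ℝ, 0 < C ∧ ∀ (V : Type) [Fintype V] [DecidableEq V] (x : V → ℤ), Function.Injective x →
      ∀ (m : V → ℝ) (J : V → V → ℝ), Dominant d m J → (∀ k l, 0 ≤ J k l) → (∀ k, m k ≤ a) →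
      (∀ k l, J k l ≤ A * algWeight s (x k - x l)) → ∀ i j,
      ∫ p, p i * p j * siteDensity (coshWeight m β) J p ≤
        C * algWeight s (x i - x j) * ∫ p, siteDensity (coshWeight m β) J p := by
  have hs1 : 1 < s := by linarith
  obtain ⟨C₁, hC₁, hG⟩ := exists_green_decay hs1 hd ha hA
  obtain ⟨C₂, hC₂, hI⟩ := exists_isingCorr_decay (s := s) (B := β ^ 2 / 2 * C₁) hs (by positivity)
  set c := 2 ^ s * (2 * algMass s)
  refine ⟨C₁ / 2 + β ^ 2 / 4 * (C₁ ^ 2 * C₂ * c ^ 2), by positivity, ?_⟩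
  intro V _ _ x hx m J h hJ hma hJA i j
  obtain ⟨G, hGeq⟩ := h.exists_green hd
  have hGb := hG V x hx m J h hJ hma hJA G hGeq
  have hadm : Admissible (fieldBonds G β) := fun b =>
    tanh_mem (by have := (hGb b.1 b.2).1; positivity)
  have hIs := hI V x hx (fieldBonds G β)
    { admissible := hadm
      exp_le := fun b => by
        rw [fieldBonds, closedProb_tanh, Real.exp_le_exp, neg_le_neg_iff]
        have := mul_le_mul_of_nonneg_left (hGb b.1 b.2).2 (by positivity : 0 ≤ β ^ 2 / 2)
        linarith }
  rw [h.integral_coord_mul_cosh hd hJ hGeq (fun k l => (hGb k l).1)]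
  refine mul_le_mul_of_nonneg_right ?_ (integral_nonneg fun p => ?_)
  · rw [add_mul, mul_assoc (β ^ 2 / 4)]
    refine add_le_add (by linarith [(hGb i j).2]) (mul_le_mul_of_nonneg_left ?_ (by positivity))
    have hw := fun n => (algWeight_pos s n).le
    have hc0 : 0 ≤ isingCorr (fieldBonds G β) (i, j) := isingCorr_nonneg hadm _
    calc ∑ k, ∑ l, G i k * G j l * isingCorr (fieldBonds G β) (k, l)
        ≤ ∑ k, ∑ l, C₁ * algWeight s (x i - x k) * (C₁ * algWeight s (x j - x l)) *
            (C₂ * algWeight s (x k - x l)) := by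
          refine Finset.sum_le_sum fun k _ => Finset.sum_le_sum fun l _ => ?_
          have h1 := hw (x i - x k)
          have h2 := hw (x j - x l)
          exact mul_le_mul (mul_le_mul (hGb i k).2 (hGb j l).2 (hGb j l).1 (by positivity))
            (hIs k l) (isingCorr_nonneg hadm _) (by positivity)
      _ = C₁ ^ 2 * C₂ * ∑ k, algWeight s (x i - x k) *
            ∑ l, algWeight s (x k - x l) * algWeight s (x l - x j) := by
          simp_rw [Finset.mul_sum]
          exact Finset.sum_congr rfl fun k _ => Finset.sum_congr rfl fun l _ => by
            rw [algWeight_sub_comm s (x l) (x j)]; ring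
      _ ≤ C₁ ^ 2 * C₂ * ∑ k, algWeight s (x i - x k) * (c * algWeight s (x k - x j)) := by
          refine mul_le_mul_of_nonneg_left (Finset.sum_le_sum fun k _ =>
            mul_le_mul_of_nonneg_left (sum_algWeight_mul_le hs1 hx _ _) (hw _)) (by positivity)
      _ = C₁ ^ 2 * C₂ * c * ∑ k, algWeight s (x i - x k) * algWeight s (x k - x j) := by
          simp_rw [Finset.mul_sum]
          exact Finset.sum_congr rfl fun k _ => by ring
      _ ≤ C₁ ^ 2 * C₂ * c * (c * algWeight s (x i - x j)) := by
          have := algMass_nonneg s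
          exact mul_le_mul_of_nonneg_left (sum_algWeight_mul_le hs1 hx _ _) (by positivity)
      _ = _ := by ring
  · rw [siteDensity]
    exact mul_nonneg (Finset.prod_nonneg fun k _ => mul_nonneg (Real.exp_pos _).le
      (Real.cosh_pos _).le) (Real.exp_pos _).le

/-! ### Ginibre's comparison inequality for continuous spins -/

section Ginibre

variable {V : Type} [Fintype V]

/-- A continuous nonnegative single-site weight with the Gaussian tail `exp (-m * r ^ 2)`, up to a factor
of exponential growth. -/
structure ConfinedSite (m : ℝ) (f : ℝ → ℝ) : Prop where
  cont : Continuous f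
  nonneg : ∀ r, 0 ≤ f r
  bound : ∃ C c : ℝ, ∀ r, f r ≤ C * Real.exp (c * |r| - m * r ^ 2)

/-- A family of confined single-site weights. -/
def Confined (m : V → ℝ) (f : V → ℝ → ℝ) : Prop := ∀ k, ConfinedSite (m k) (f k)

/-- Functions on pairs of configurations of at most exponential growth. -/
def ExpGrowth (F : (V → ℝ) × (V → ℝ) → ℝ) : Prop :=
  ∃ C c : ℝ, 0 ≤ C ∧ 0 ≤ c ∧ ∀ P, |F P| ≤ C * Real.exp (c * ∑ k, |P.1 k| + c * ∑ k, |P.2 k|)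

namespace ExpGrowth

lemma const (a : ℝ) : ExpGrowth (fun _ : (V → ℝ) × (V → ℝ) => a) :=
  ⟨|a|, 0, abs_nonneg a, le_rfl, fun P => by simp⟩

lemma add {F F' : (V → ℝ) × (V → ℝ) → ℝ} (h : ExpGrowth F) (h' : ExpGrowth F') :
    ExpGrowth (fun P => F P + F' P) := by
  obtain ⟨C, c, hC, hc, h⟩ := h
  obtain ⟨C', c', hC', hc', h'⟩ := h'
  refine ⟨C + C', c + c', by positivity, by positivity, fun P => ?_⟩
  set S := ∑ k, |P.1 k|
  set T := ∑ k, |P.2 k|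
  have hS : 0 ≤ S := Finset.sum_nonneg fun k _ => abs_nonneg _
  have hT : 0 ≤ T := Finset.sum_nonneg fun k _ => abs_nonneg _
  have h1 : Real.exp (c * S + c * T) ≤ Real.exp ((c + c') * S + (c + c') * T) :=
    Real.exp_le_exp.2 (by nlinarith)
  have h2 : Real.exp (c' * S + c' * T) ≤ Real.exp ((c + c') * S + (c + c') * T) :=
    Real.exp_le_exp.2 (by nlinarith)
  calc |F P + F' P| ≤ |F P| + |F' P| := abs_add_le _ _
    _ ≤ C * Real.exp (c * S + c * T) + C' * Real.exp (c' * S + c' * T) := add_le_add (h P) (h' P)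
    _ ≤ _ := by
        rw [add_mul]
        exact add_le_add (mul_le_mul_of_nonneg_left h1 hC) (mul_le_mul_of_nonneg_left h2 hC')

lemma mul {F F' : (V → ℝ) × (V → ℝ) → ℝ} (h : ExpGrowth F) (h' : ExpGrowth F') :
    ExpGrowth (fun P => F P * F' P) := by
  obtain ⟨C, c, hC, hc, h⟩ := h
  obtain ⟨C', c', hC', hc', h'⟩ := h'
  refine ⟨C * C', c + c', by positivity, by positivity, fun P => ?_⟩
  rw [abs_mul]
  refine (mul_le_mul (h P) (h' P) (abs_nonneg _) ((abs_nonneg _).trans (h P))).trans_eq ?_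
  rw [mul_mul_mul_comm, ← Real.exp_add]
  congr 2
  ring

lemma fst (k : V) : ExpGrowth (fun P : (V → ℝ) × (V → ℝ) => P.1 k) := by
  refine ⟨1, 1, zero_le_one, zero_le_one, fun P => ?_⟩
  rw [one_mul]
  refine (exp_abs_le_exp_sum P.1 k).trans (Real.exp_le_exp.2 ?_)
  have : 0 ≤ ∑ k, |P.2 k| := Finset.sum_nonneg fun k _ => abs_nonneg _
  linarith

lemma snd (k : V) : ExpGrowth (fun P : (V → ℝ) × (V → ℝ) => P.2 k) := by
  refine ⟨1, 1, zero_le_one, zero_le_one, fun P => ?_⟩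
  rw [one_mul]
  refine (exp_abs_le_exp_sum P.2 k).trans (Real.exp_le_exp.2 ?_)
  have : 0 ≤ ∑ k, |P.1 k| := Finset.sum_nonneg fun k _ => abs_nonneg _
  linarith

end ExpGrowth

/-- The cone of polynomials in the variables `p' k + p k` and `p' k - p k` with nonnegative
coefficients. -/
inductive DuplicateCone : ((V → ℝ) × (V → ℝ) → ℝ) → Prop
  | const {a : ℝ} (ha : 0 ≤ a) : DuplicateCone (fun _ => a)
  | sum (k : V) : DuplicateCone (fun P => P.1 k + P.2 k)
  | diff (k : V) : DuplicateCone (fun P => P.1 k - P.2 k)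
  | add {F F' : (V → ℝ) × (V → ℝ) → ℝ} (h : DuplicateCone F) (h' : DuplicateCone F') :
      DuplicateCone (fun P => F P + F' P)
  | mul {F F' : (V → ℝ) × (V → ℝ) → ℝ} (h : DuplicateCone F) (h' : DuplicateCone F') :
      DuplicateCone (fun P => F P * F' P)

namespace DuplicateCone

variable {F : (V → ℝ) × (V → ℝ) → ℝ}

lemma continuous (h : DuplicateCone F) : Continuous F := by
  induction h with
  | const => exact continuous_const
  | sum k => fun_prop
  | diff k => fun_prop
  | add _ _ h h' => exact h.add h'
  | mul _ _ h h' => exact h.mul h'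

lemma expGrowth (h : DuplicateCone F) : ExpGrowth F := by
  induction h with
  | const => exact ExpGrowth.const _
  | sum k => exact (ExpGrowth.fst k).add (ExpGrowth.snd k)
  | diff k =>
    have := (ExpGrowth.fst k).add ((ExpGrowth.const (-1)).mul (ExpGrowth.snd k))
    simpa only [neg_one_mul, ← sub_eq_add_neg] using this
  | add _ _ h h' => exact h.add h'
  | mul _ _ h h' => exact h.mul h'

lemma finset_sum {ι : Type*} (s : Finset ι) {F : ι → (V → ℝ) × (V → ℝ) → ℝ}
    (h : ∀ i, DuplicateCone (F i)) : DuplicateCone (fun P => ∑ i ∈ s, F i P) := by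
  classical
  induction s using Finset.induction_on with
  | empty => simpa using const le_rfl
  | insert i s hi ih =>
    simp_rw [Finset.sum_insert hi]
    exact (h i).add ih

lemma pow (h : DuplicateCone F) (n : ℕ) : DuplicateCone (fun P => F P ^ n) := by
  induction n with
  | zero => simpa using const zero_le_one
  | succ n ih =>
    simp_rw [pow_succ]
    exact ih.mul h

/-- The sum of the products `p' i * p' j` and `p i * p j` is `(u i * u j + v i * v j) / 2` with
`u = p' + p` and `v = p' - p`. -/
lemma mul_add_mul (i j : V) : DuplicateCone (fun P => P.1 i * P.1 j + P.2 i * P.2 j) := by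
  have := (const (V := V) (a := 1 / 2) (by norm_num)).mul
    (((sum i).mul (sum j)).add ((diff i).mul (diff j)))
  convert this using 2
  ring

lemma mul_sub_mul (i j : V) : DuplicateCone (fun P => P.1 i * P.1 j - P.2 i * P.2 j) := by
  have := (const (V := V) (a := 1 / 2) (by norm_num)).mul
    (((sum i).mul (diff j)).add ((diff i).mul (sum j)))
  convert this using 2
  ring

lemma coupling_add {J J' : V → V → ℝ} (hJ : ∀ k l, |J k l| ≤ J' k l) :
    DuplicateCone (fun P => coupling J' P.1 + coupling J P.2) := by
  have h : DuplicateCone (fun P : (V → ℝ) × (V → ℝ) => ∑ k, ∑ l,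
      ((J' k l + J k l) / 2 * (P.1 k * P.1 l + P.2 k * P.2 l) +
        (J' k l - J k l) / 2 * (P.1 k * P.1 l - P.2 k * P.2 l))) :=
    finset_sum _ fun k => finset_sum _ fun l =>
      ((const (by linarith [neg_abs_le (J k l), hJ k l])).mul (mul_add_mul k l)).add
        ((const (by linarith [le_abs_self (J k l), hJ k l])).mul (mul_sub_mul k l))
  convert h using 2 with P
  simp only [coupling, ← Finset.sum_add_distrib]
  exact Finset.sum_congr rfl fun k _ => Finset.sum_congr rfl fun l _ => by ring

end DuplicateCone

/-- The product of the single-site weights of two systems. -/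
def pairWeight (f' f : V → ℝ → ℝ) (P : (V → ℝ) × (V → ℝ)) : ℝ :=
  (∏ k, f' k (P.1 k)) * ∏ k, f k (P.2 k)

variable {d : ℝ} {m : V → ℝ} {f f' : V → ℝ → ℝ} {J J' : V → V → ℝ}

lemma Confined.exists_prod_le (hf : Confined m f) : ∃ C c : ℝ, 0 ≤ C ∧ ∀ p : V → ℝ,
    ∏ k, f k (p k) ≤ C * Real.exp (c * ∑ k, |p k| - ∑ k, m k * p k ^ 2) := by
  choose C c h using fun k => (hf k).bound
  have hC : ∀ k, 0 ≤ C k := fun k =>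
    nonneg_of_mul_nonneg_left (((hf k).nonneg 0).trans (h k 0)) (Real.exp_pos _)
  refine ⟨∏ k, C k, ∑ k, |c k|, Finset.prod_nonneg fun k _ => hC k, fun p => ?_⟩
  rw [Finset.mul_sum, ← Finset.sum_sub_distrib, Real.exp_sum, ← Finset.prod_mul_distrib]
  refine Finset.prod_le_prod (fun k _ => (hf k).nonneg _) fun k _ => (h k _).trans
    (mul_le_mul_of_nonneg_left (Real.exp_le_exp.2 (sub_le_sub_right ?_ _)) (hC k))
  refine mul_le_mul_of_nonneg_right ((le_abs_self _).trans ?_) (abs_nonneg _)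
  exact Finset.single_le_sum (f := fun k => |c k|) (fun l _ => abs_nonneg _) (Finset.mem_univ k)

lemma Confined.continuous_prod (hf : Confined m f) : Continuous fun p : V → ℝ => ∏ k, f k (p k) :=
  continuous_finsetProd _ fun k _ => (hf k).cont.comp (continuous_apply k)

lemma Confined.prod_nonneg (hf : Confined m f) (p : V → ℝ) : 0 ≤ ∏ k, f k (p k) :=
  Finset.prod_nonneg fun k _ => (hf k).nonneg _

lemma Confined.pairWeight_nonneg (hf : Confined m f) (hf' : Confined m f')
    (P : (V → ℝ) × (V → ℝ)) : 0 ≤ pairWeight f' f P :=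
  mul_nonneg (hf'.prod_nonneg _) (hf.prod_nonneg _)

lemma Confined.continuous_pairWeight (hf : Confined m f) (hf' : Confined m f') :
    Continuous (pairWeight f' f) :=
  (hf'.continuous_prod.comp continuous_fst).mul (hf.continuous_prod.comp continuous_snd)

/-- Integrability with respect to two independent copies, with a quadratic form in the exponent that
is strictly smaller than the Gaussian confinement. -/
lemma Confined.integrable_pair (hd : 0 < d) (hf : Confined m f) (hf' : Confined m f')
    {F : (V → ℝ) × (V → ℝ) → ℝ} (hF : Continuous F) (hFg : ExpGrowth F)
    {g : (V → ℝ) × (V → ℝ) → ℝ} (hg : Continuous g)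
    (hgb : ∀ P, |g P| ≤ Real.exp (∑ k, (m k - d) * P.1 k ^ 2 + ∑ k, (m k - d) * P.2 k ^ 2)) :
    Integrable (fun P => F P * g P * pairWeight f' f P) := by
  obtain ⟨C, c, hC, h1⟩ := hf.exists_prod_le
  obtain ⟨C', c', hC', h1'⟩ := hf'.exists_prod_le
  obtain ⟨C₀, c₀, hC₀, -, h0⟩ := hFg
  have hint : ∀ e : ℝ, Integrable (fun p : V → ℝ =>
      Real.exp (e * ∑ k, |p k| - d * ∑ k, p k ^ 2)) := fun e =>
    integrable_of_abs_le_exp (C := 1) (c := e) (by fun_prop) hd fun p => by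
      rw [abs_of_pos (Real.exp_pos _), one_mul]
  refine Integrable.mono' (((hint (c₀ + c')).mul_prod (hint (c₀ + c))).const_mul (C₀ * (C' * C)))
    ((hF.mul hg).mul (hf.continuous_pairWeight hf')).aestronglyMeasurable
    (Filter.Eventually.of_forall fun P => ?_)
  rw [Real.norm_eq_abs, abs_mul, abs_mul, abs_of_nonneg (hf.pairWeight_nonneg hf' P)]
  have hw : pairWeight f' f P ≤
      (C' * Real.exp (c' * ∑ k, |P.1 k| - ∑ k, m k * P.1 k ^ 2)) *
        (C * Real.exp (c * ∑ k, |P.2 k| - ∑ k, m k * P.2 k ^ 2)) :=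
    mul_le_mul (h1' _) (h1 _) (hf.prod_nonneg _) (by positivity)
  calc |F P| * |g P| * pairWeight f' f P
      ≤ (C₀ * Real.exp (c₀ * ∑ k, |P.1 k| + c₀ * ∑ k, |P.2 k|)) *
          Real.exp (∑ k, (m k - d) * P.1 k ^ 2 + ∑ k, (m k - d) * P.2 k ^ 2) *
          ((C' * Real.exp (c' * ∑ k, |P.1 k| - ∑ k, m k * P.1 k ^ 2)) *
        (C * Real.exp (c * ∑ k, |P.2 k| - ∑ k, m k * P.2 k ^ 2))) :=
        mul_le_mul (mul_le_mul (h0 P) (hgb P) (abs_nonneg _) (by positivity)) hw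
          (hf.pairWeight_nonneg hf' P) (by positivity)
    _ = C₀ * (C' * C) * (Real.exp (c₀ * ∑ k, |P.1 k| + c₀ * ∑ k, |P.2 k|) *
          Real.exp (∑ k, (m k - d) * P.1 k ^ 2 + ∑ k, (m k - d) * P.2 k ^ 2) *
          Real.exp (c' * ∑ k, |P.1 k| - ∑ k, m k * P.1 k ^ 2) *
          Real.exp (c * ∑ k, |P.2 k| - ∑ k, m k * P.2 k ^ 2)) := by ring
    _ = _ := by
        rw [← Real.exp_add, ← Real.exp_add, ← Real.exp_add, ← Real.exp_add]
        simp only [sub_mul, Finset.sum_sub_distrib, ← Finset.mul_sum]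
        congr 2
        ring

/-- Ginibre's condition on a pair of single-site weights. -/
def SiteDominates (f' f : ℝ → ℝ) : Prop :=
  ∀ a b : ℕ, 0 ≤ ∫ z : ℝ × ℝ, (z.1 + z.2) ^ a * (z.1 - z.2) ^ b * (f' z.1 * f z.2)

lemma integral_monomial_nonneg (h : ∀ k, SiteDominates (f' k) (f k)) (a b : V → ℕ) :
    0 ≤ ∫ P : (V → ℝ) × (V → ℝ),
      (∏ k, (P.1 k + P.2 k) ^ a k * (P.1 k - P.2 k) ^ b k) * pairWeight f' f P := by
  have hmp := volume_measurePreserving_arrowProdEquivProdArrow ℝ ℝ V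
  rw [← hmp.integral_comp (MeasurableEquiv.measurableEmbedding _)]
  have e : ∀ z : V → ℝ × ℝ, (∏ k, ((MeasurableEquiv.arrowProdEquivProdArrow ℝ ℝ V z).1 k +
      (MeasurableEquiv.arrowProdEquivProdArrow ℝ ℝ V z).2 k) ^ a k *
      ((MeasurableEquiv.arrowProdEquivProdArrow ℝ ℝ V z).1 k -
      (MeasurableEquiv.arrowProdEquivProdArrow ℝ ℝ V z).2 k) ^ b k) *
        pairWeight f' f (MeasurableEquiv.arrowProdEquivProdArrow ℝ ℝ V z) =
      ∏ k, (fun k (z : ℝ × ℝ) => (z.1 + z.2) ^ a k * (z.1 - z.2) ^ b k *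
        (f' k z.1 * f k z.2)) k (z k) := fun z => by
    rw [pairWeight, ← Finset.prod_mul_distrib, ← Finset.prod_mul_distrib]
    rfl
  simp_rw [e]
  rw [integral_fintype_prod_volume_eq_prod (fun k (z : ℝ × ℝ) =>
    (z.1 + z.2) ^ a k * (z.1 - z.2) ^ b k * (f' k z.1 * f k z.2))]
  exact Finset.prod_nonneg fun k _ => h k _ _

lemma DuplicateCone.monomial (a b : V → ℕ) :
    DuplicateCone (fun P => ∏ k, (P.1 k + P.2 k) ^ a k * (P.1 k - P.2 k) ^ b k) := by
  classical
  have : ∀ s : Finset V,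
      DuplicateCone (fun P => ∏ k ∈ s, (P.1 k + P.2 k) ^ a k * (P.1 k - P.2 k) ^ b k) := by
    intro s
    induction s using Finset.induction_on with
    | empty => simpa using const zero_le_one
    | insert i s hi ih =>
      simp_rw [Finset.prod_insert hi]
      exact (((sum i).pow _).mul ((diff i).pow _)).mul ih
  exact this _

lemma Dominant.nonneg_sub (h : Dominant d m J) (k : V) : 0 ≤ m k - d := by
  have : 0 ≤ ∑ l, |J k l| := Finset.sum_nonneg fun l _ => abs_nonneg _
  linarith [h.row k]

lemma DuplicateCone.integral_nonneg (hd : 0 < d) (hm : ∀ k, 0 ≤ m k - d) (hf : Confined m f)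
    (hf' : Confined m f') (h : ∀ k, SiteDominates (f' k) (f k)) {F : (V → ℝ) × (V → ℝ) → ℝ}
    (hF : DuplicateCone F) : 0 ≤ ∫ P, F P * pairWeight f' f P := by
  classical
  have hint : ∀ {F : (V → ℝ) × (V → ℝ) → ℝ}, Continuous F → ExpGrowth F →
      Integrable (fun P => F P * pairWeight f' f P) := fun hc hg => by
    have := hf.integrable_pair hd hf' hc hg (g := fun _ => 1) continuous_const fun P => by
      rw [abs_one, Real.one_le_exp_iff]
      exact add_nonneg (Finset.sum_nonneg fun k _ => mul_nonneg (hm k) (sq_nonneg _))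
        (Finset.sum_nonneg fun k _ => mul_nonneg (hm k) (sq_nonneg _))
    simpa using this
  -- multiplication by an element of the cone preserves nonnegativity of all the moments
  have key : ∀ G : (V → ℝ) × (V → ℝ) → ℝ, Continuous G → ExpGrowth G →
      (∀ a b : V → ℕ, 0 ≤ ∫ P : (V → ℝ) × (V → ℝ),
        G P * (∏ k, (P.1 k + P.2 k) ^ a k * (P.1 k - P.2 k) ^ b k) * pairWeight f' f P) →
      ∀ a b : V → ℕ, 0 ≤ ∫ P : (V → ℝ) × (V → ℝ),
        F P * G P * (∏ k, (P.1 k + P.2 k) ^ a k * (P.1 k - P.2 k) ^ b k) * pairWeight f' f P := by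
    induction hF with
    | const hc =>
      intro G _ _ hG a b
      simp_rw [mul_assoc]
      rw [integral_const_mul]
      refine mul_nonneg hc ?_
      simpa only [mul_assoc] using hG a b
    | sum l =>
      intro G _ _ hG a b
      refine (hG (a + Pi.single l 1) b).trans_eq (integral_congr_ae (Filter.Eventually.of_forall
        fun P => ?_))
      simp only [Pi.add_apply, pow_add, Finset.prod_mul_distrib]
      have h1 : ∏ k, (P.1 k + P.2 k) ^ (Pi.single l 1 : V → ℕ) k = P.1 l + P.2 l := by
        rw [Finset.prod_eq_single l]
        · simp
        · intro k _ hk; simp [hk]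
        · simp
      rw [h1]
      ring
    | diff l =>
      intro G _ _ hG a b
      refine (hG a (b + Pi.single l 1)).trans_eq (integral_congr_ae (Filter.Eventually.of_forall
        fun P => ?_))
      simp only [Pi.add_apply, pow_add, Finset.prod_mul_distrib]
      have h1 : ∏ k, (P.1 k - P.2 k) ^ (Pi.single l 1 : V → ℕ) k = P.1 l - P.2 l := by
        rw [Finset.prod_eq_single l]
        · simp
        · intro k _ hk; simp [hk]
        · simp
      rw [h1]
      ring
    | @add F₁ F₂ h₁ h₂ ih₁ ih₂ =>
      intro G hc hg hG a b
      have hM := DuplicateCone.monomial (V := V) a b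
      have e := integral_add
        (hint ((h₁.continuous.mul hc).mul hM.continuous) ((h₁.expGrowth.mul hg).mul hM.expGrowth))
        (hint ((h₂.continuous.mul hc).mul hM.continuous) ((h₂.expGrowth.mul hg).mul hM.expGrowth))
      refine (add_nonneg (ih₁ G hc hg hG a b) (ih₂ G hc hg hG a b)).trans_eq (e.symm.trans ?_)
      exact integral_congr_ae (Filter.Eventually.of_forall fun P => by
        simp only [Pi.mul_apply]
        ring)
    | @mul F₁ F₂ h₁ h₂ ih₁ ih₂ =>
      intro G hc hg hG a b
      have := ih₁ _ (h₂.continuous.mul hc) (h₂.expGrowth.mul hg) (ih₂ G hc hg hG) a b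
      simpa only [mul_assoc, Pi.mul_apply] using this
  have := key (fun _ => 1) continuous_const (ExpGrowth.const 1)
    (fun a b => by simpa using integral_monomial_nonneg h a b) 0 0
  simpa using this

/-- Expanding the exponential of the coupling energies, which lie in the cone, keeps nonnegativity. -/
lemma DuplicateCone.integral_mul_exp_nonneg (hd : 0 < d) (h : Dominant d m J)
    (h' : Dominant d m J') (hf : Confined m f) (hf' : Confined m f')
    (hsite : ∀ k, SiteDominates (f' k) (f k)) (hJ : ∀ k l, |J k l| ≤ J' k l)
    {F : (V → ℝ) × (V → ℝ) → ℝ} (hF : DuplicateCone F) :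
    0 ≤ ∫ P, F P * Real.exp (coupling J' P.1 + coupling J P.2) * pairWeight f' f P := by
  set E : (V → ℝ) × (V → ℝ) → ℝ := fun P => coupling J' P.1 + coupling J P.2 with hE
  have hEc : DuplicateCone E := DuplicateCone.coupling_add hJ
  have hEabs : ∀ P, |E P| ≤ ∑ k, (m k - d) * P.1 k ^ 2 + ∑ k, (m k - d) * P.2 k ^ 2 := fun P =>
    (abs_add_le _ _).trans (add_le_add (h'.abs_coupling_le _) (h.abs_coupling_le _))
  have hcont := hEc.continuous
  have hbound := hf.integrable_pair hd hf' hF.continuous.abs (by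
      obtain ⟨C, c, hC, hc, hb⟩ := hF.expGrowth
      exact ⟨C, c, hC, hc, fun P => by rw [abs_abs]; exact hb P⟩)
    (g := fun P => Real.exp |E P|) (by fun_prop) fun P => by
      rw [abs_of_pos (Real.exp_pos _)]
      exact Real.exp_le_exp.2 (hEabs P)
  have hS : ∀ n : ℕ, DuplicateCone (fun P => ∑ i ∈ Finset.range n, E P ^ i / (i.factorial : ℝ)) :=
    fun n => DuplicateCone.finset_sum _ fun i => by
      simp_rw [div_eq_inv_mul]
      exact (DuplicateCone.const (by positivity)).mul (hEc.pow i)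
  have hlim := tendsto_integral_of_dominated_convergence
    (F := fun n P => F P * (∑ i ∈ Finset.range n, E P ^ i / (i.factorial : ℝ)) * pairWeight f' f P)
    (f := fun P => F P * Real.exp (E P) * pairWeight f' f P) _
    (fun n => ((hF.continuous.mul (hS n).continuous).mul
      (hf.continuous_pairWeight hf')).aestronglyMeasurable) hbound
    (fun n => Filter.Eventually.of_forall fun P => by
      rw [Real.norm_eq_abs, abs_mul, abs_mul, abs_of_nonneg (hf.pairWeight_nonneg hf' P)]
      refine mul_le_mul_of_nonneg_right (mul_le_mul_of_nonneg_left ?_ (abs_nonneg _))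
        (hf.pairWeight_nonneg hf' P)
      refine le_trans ?_ (Real.sum_le_exp_of_nonneg (abs_nonneg (E P)) n)
      refine (Finset.abs_sum_le_sum_abs _ _).trans (Finset.sum_le_sum fun i _ => ?_)
      rw [abs_div, abs_pow, Nat.abs_cast])
    (Filter.Eventually.of_forall fun P => by
      refine Filter.Tendsto.mul_const _ (Filter.Tendsto.const_mul _ ?_)
      rw [Real.exp_eq_exp_ℝ]
      exact (NormedSpace.expSeries_div_hasSum_exp (E P)).tendsto_sum_nat)
  exact ge_of_tendsto' hlim fun n =>
    DuplicateCone.integral_nonneg hd h.nonneg_sub hf hf' hsite (hF.mul (hS n))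

/-- **Ginibre's inequality**: the two-point function increases if the couplings are replaced by larger
nonnegative ones and the single-site weights by dominating ones. -/
theorem abs_integral_coord_mul_le (hd : 0 < d) (h : Dominant d m J) (h' : Dominant d m J')
    (hf : Confined m f) (hf' : Confined m f') (hsite : ∀ k, SiteDominates (f' k) (f k))
    (hJ : ∀ k l, |J k l| ≤ J' k l) (i j : V) :
    |∫ p, p i * p j * siteDensity f J p| * ∫ p, siteDensity f' J' p ≤
      (∫ p, p i * p j * siteDensity f' J' p) * ∫ p, siteDensity f J p := by
  have hexp : ∀ F : (V → ℝ) × (V → ℝ) → ℝ, Continuous F → ExpGrowth F →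
      Integrable (fun P => F P * Real.exp (coupling J' P.1 + coupling J P.2) * pairWeight f' f P) :=
    fun F hc hg => hf.integrable_pair hd hf' hc hg
      (Real.continuous_exp.comp (((continuous_coupling J').comp continuous_fst).add
        ((continuous_coupling J).comp continuous_snd))) fun P => by
      rw [abs_of_pos (Real.exp_pos _)]
      exact Real.exp_le_exp.2 (add_le_add ((le_abs_self _).trans (h'.abs_coupling_le _))
        ((le_abs_self _).trans (h.abs_coupling_le _)))
  have hsplit : ∀ P : (V → ℝ) × (V → ℝ), Real.exp (coupling J' P.1 + coupling J P.2) *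
      pairWeight f' f P = siteDensity f' J' P.1 * siteDensity f J P.2 := fun P => by
    rw [Real.exp_add, pairWeight, siteDensity, siteDensity]
    ring
  have h1 : ∫ P : (V → ℝ) × (V → ℝ), P.1 i * P.1 j *
      Real.exp (coupling J' P.1 + coupling J P.2) * pairWeight f' f P =
      (∫ p, p i * p j * siteDensity f' J' p) * ∫ p, siteDensity f J p := by
    rw [← integral_prod_mul]
    refine integral_congr_ae (Filter.Eventually.of_forall fun P => ?_)
    simp only
    rw [mul_assoc, hsplit]
    ring
  have h2 : ∫ P : (V → ℝ) × (V → ℝ), P.2 i * P.2 j *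
      Real.exp (coupling J' P.1 + coupling J P.2) * pairWeight f' f P =
      (∫ p, siteDensity f' J' p) * ∫ p, p i * p j * siteDensity f J p := by
    rw [← integral_prod_mul]
    refine integral_congr_ae (Filter.Eventually.of_forall fun P => ?_)
    simp only
    rw [mul_assoc, hsplit]
    ring
  have i1 := hexp (fun P => P.1 i * P.1 j) (by fun_prop) ((ExpGrowth.fst i).mul (ExpGrowth.fst j))
  have i2 := hexp (fun P => P.2 i * P.2 j) (by fun_prop) ((ExpGrowth.snd i).mul (ExpGrowth.snd j))
  have hadd := (DuplicateCone.mul_add_mul i j).integral_mul_exp_nonneg hd h h' hf hf' hsite hJ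
  have hsub := (DuplicateCone.mul_sub_mul i j).integral_mul_exp_nonneg hd h h' hf hf' hsite hJ
  simp only [add_mul, sub_mul] at hadd hsub
  rw [integral_add i1 i2, h1, h2] at hadd
  rw [integral_sub i1 i2, h1, h2] at hsub
  have hZ : 0 ≤ ∫ p, siteDensity f' J' p := integral_nonneg fun p =>
    mul_nonneg (hf'.prod_nonneg p) (Real.exp_pos _).le
  rw [← abs_of_nonneg hZ, ← abs_mul, abs_le]
  constructor <;> linarith

end Ginibre

/-! ### Domination of single-site weights -/

section Site

variable {m : ℝ} {f f' : ℝ → ℝ}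

lemma ConfinedSite.integrable_pair (hm : 0 < m) (hf' : ConfinedSite m f') (hf : ConfinedSite m f)
    (a b : ℕ) : Integrable (fun z : ℝ × ℝ =>
      (z.1 + z.2) ^ a * (z.1 - z.2) ^ b * (f' z.1 * f z.2)) := by
  obtain ⟨C, c, h⟩ := hf.bound
  obtain ⟨C', c', h'⟩ := hf'.bound
  have hcont := hf.cont
  have hcont' := hf'.cont
  refine Integrable.mono' (((integrable_exp_abs_sub_sq (c' + 2) hm).mul_prod
    (integrable_exp_abs_sub_sq (c + 2) hm)).const_mul
      ((a.factorial : ℝ) * b.factorial * (C' * C))) (by fun_prop)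
    (Filter.Eventually.of_forall fun z => ?_)
  have hpow : ∀ (n : ℕ) (t : ℝ), |t| ≤ |z.1| + |z.2| →
      |t| ^ n ≤ n.factorial * Real.exp (|z.1| + |z.2|) := fun n t ht => by
    have h1 := Real.pow_div_factorial_le_exp (x := |t|) (abs_nonneg t) n
    rw [div_le_iff₀ (by positivity)] at h1
    calc _ ≤ _ := h1
      _ ≤ Real.exp (|z.1| + |z.2|) * n.factorial :=
          mul_le_mul_of_nonneg_right (Real.exp_le_exp.2 ht) (by positivity)
      _ = _ := mul_comm _ _
  rw [Real.norm_eq_abs, abs_mul, abs_mul, abs_pow, abs_pow,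
    abs_of_nonneg (mul_nonneg (hf'.nonneg _) (hf.nonneg _))]
  calc |z.1 + z.2| ^ a * |z.1 - z.2| ^ b * (f' z.1 * f z.2)
      ≤ (a.factorial * Real.exp (|z.1| + |z.2|)) * (b.factorial * Real.exp (|z.1| + |z.2|)) *
          ((C' * Real.exp (c' * |z.1| - m * z.1 ^ 2)) * (C * Real.exp (c * |z.2| - m * z.2 ^ 2))) :=
        mul_le_mul (mul_le_mul (hpow a _ (abs_add_le _ _)) (hpow b _ (abs_sub _ _)) (by positivity)
          (by positivity)) (mul_le_mul (h' _) (h _) (hf.nonneg _) ((hf'.nonneg _).trans (h' _)))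
          (mul_nonneg (hf'.nonneg _) (hf.nonneg _)) (by positivity)
    _ = a.factorial * b.factorial * (C' * C) * (Real.exp (|z.1| + |z.2|) *
          Real.exp (|z.1| + |z.2|) * Real.exp (c' * |z.1| - m * z.1 ^ 2) *
          Real.exp (c * |z.2| - m * z.2 ^ 2)) := by ring
    _ = _ := by
        rw [← Real.exp_add, ← Real.exp_add, ← Real.exp_add, ← Real.exp_add]
        congr 2
        ring

/-- The antisymmetrized product of two single-site weights. -/
def siteGap (f' f : ℝ → ℝ) (x y : ℝ) : ℝ := f' x * f y - f' y * f x

lemma ConfinedSite.integrable_siteGap (hm : 0 < m) (hf' : ConfinedSite m f')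
    (hf : ConfinedSite m f) (a b : ℕ) : Integrable (fun z : ℝ × ℝ =>
      (z.1 + z.2) ^ a * (z.1 - z.2) ^ b * siteGap f' f z.1 z.2) := by
  have := (hf'.integrable_pair hm hf a b).sub (hf.integrable_pair hm hf' a b)
  refine this.congr (Filter.Eventually.of_forall fun z => ?_)
  simp only [Pi.sub_apply, siteGap]
  ring

/-- For even weights only odd exponents matter in Ginibre's condition, for which the integrand can be
antisymmetrized. -/
lemma siteDominates_of_siteGap (hm : 0 < m) (hf' : ConfinedSite m f') (hf : ConfinedSite m f)
    (he' : ∀ r, f' (-r) = f' r) (he : ∀ r, f (-r) = f r)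
    (h : ∀ a b : ℕ, Odd a → Odd b →
      0 ≤ ∫ z : ℝ × ℝ, (z.1 + z.2) ^ a * (z.1 - z.2) ^ b * siteGap f' f z.1 z.2) :
    SiteDominates f' f := by
  intro a b
  have hneg := integral_neg_eq_self (fun z : ℝ × ℝ =>
    (z.1 + z.2) ^ a * (z.1 - z.2) ^ b * (f' z.1 * f z.2)) volume
  have hneg2 : ∀ z : ℝ × ℝ, ((-z).1 + (-z).2) ^ a * ((-z).1 - (-z).2) ^ b *
      (f' (-z).1 * f (-z).2) = (-1) ^ (a + b) *
        ((z.1 + z.2) ^ a * (z.1 - z.2) ^ b * (f' z.1 * f z.2)) := fun z => by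
    rw [Prod.fst_neg, Prod.snd_neg, he', he, pow_add,
      show -z.1 + -z.2 = (-1) * (z.1 + z.2) by ring, show -z.1 - -z.2 = (-1) * (z.1 - z.2) by ring,
      mul_pow, mul_pow]
    ring
  rcases Nat.even_or_odd a with ha | ha <;> rcases Nat.even_or_odd b with hb | hb
  · exact integral_nonneg fun z => mul_nonneg (mul_nonneg (ha.pow_nonneg _) (hb.pow_nonneg _))
      (mul_nonneg (hf'.nonneg _) (hf.nonneg _))
  · simp_rw [hneg2, (ha.add_odd hb).neg_one_pow, neg_one_mul] at hneg
    rw [integral_neg] at hneg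
    linarith
  · simp_rw [hneg2, (ha.add_even hb).neg_one_pow, neg_one_mul] at hneg
    rw [integral_neg] at hneg
    linarith
  · have hswap : ∫ z : ℝ × ℝ, (z.1 + z.2) ^ a * (z.1 - z.2) ^ b * (f z.1 * f' z.2) =
        -∫ z : ℝ × ℝ, (z.1 + z.2) ^ a * (z.1 - z.2) ^ b * (f' z.1 * f z.2) := by
      rw [← integral_neg]
      refine (integral_prod_swap (μ := (volume : Measure ℝ)) (ν := (volume : Measure ℝ))
        fun z : ℝ × ℝ => (z.1 + z.2) ^ a * (z.1 - z.2) ^ b * (f z.1 * f' z.2)).symm.trans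
          (integral_congr_ae (Filter.Eventually.of_forall fun z => ?_))
      simp only [Prod.fst_swap, Prod.snd_swap]
      rw [add_comm z.2, ← neg_sub z.1, hb.neg_pow]
      ring
    have h1 := h a b ha hb
    have h2 := integral_sub (hf'.integrable_pair hm hf a b) (hf.integrable_pair hm hf' a b)
    have h3 : ∫ z : ℝ × ℝ, (z.1 + z.2) ^ a * (z.1 - z.2) ^ b * siteGap f' f z.1 z.2 =
        ∫ z : ℝ × ℝ, ((z.1 + z.2) ^ a * (z.1 - z.2) ^ b * (f' z.1 * f z.2) -
          (z.1 + z.2) ^ a * (z.1 - z.2) ^ b * (f z.1 * f' z.2)) :=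
      integral_congr_ae (Filter.Eventually.of_forall fun z => by
        simp only [siteGap]
        ring)
    rw [h3, h2, hswap] at h1
    linarith

lemma odd_pow_mul_nonneg {a b : ℕ} (ha : Odd a) (hb : Odd b) {x y : ℝ} (h : |y| ≤ |x|) :
    0 ≤ (x + y) ^ a * (x - y) ^ b := by
  obtain ⟨a, rfl⟩ := ha
  obtain ⟨b, rfl⟩ := hb
  have h1 : 0 ≤ x ^ 2 - y ^ 2 := sub_nonneg.2 (sq_le_sq.2 h)
  have h2 : (x + y) ^ (2 * a + 1) * (x - y) ^ (2 * b + 1) =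
      (x ^ 2 - y ^ 2) * (((x + y) ^ a) ^ 2 * ((x - y) ^ b) ^ 2) := by ring
  rw [h2]
  positivity

lemma odd_pow_mul_swap {a b : ℕ} (hb : Odd b) (x y : ℝ) :
    (y + x) ^ a * (y - x) ^ b = -((x + y) ^ a * (x - y) ^ b) := by
  rw [add_comm y, ← neg_sub x, hb.neg_pow]
  ring

lemma odd_pow_mul_siteGap_nonneg {a b : ℕ} (ha : Odd a) (hb : Odd b) {x y : ℝ}
    (h : |y| ≤ |x| → 0 ≤ siteGap f' f x y) (h' : |x| ≤ |y| → 0 ≤ siteGap f' f y x) :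
    0 ≤ (x + y) ^ a * (x - y) ^ b * siteGap f' f x y := by
  rcases le_total |y| |x| with hle | hle
  · exact mul_nonneg (odd_pow_mul_nonneg ha hb hle) (h hle)
  · have h1 := mul_nonneg (odd_pow_mul_nonneg ha hb hle) (h' hle)
    have h2 : siteGap f' f y x = -siteGap f' f x y := by simp only [siteGap]; ring
    rwa [odd_pow_mul_swap hb, h2, neg_mul_neg] at h1

/-- A weight dominates another one if their ratio increases with the modulus of the spin. -/
lemma siteDominates_of_ratio (hm : 0 < m) (hf' : ConfinedSite m f') (hf : ConfinedSite m f)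
    (he' : ∀ r, f' (-r) = f' r) (he : ∀ r, f (-r) = f r)
    (h : ∀ x y, |y| ≤ |x| → f' y * f x ≤ f' x * f y) : SiteDominates f' f :=
  siteDominates_of_siteGap hm hf' hf he' he fun _ _ ha hb => integral_nonneg fun _ =>
    odd_pow_mul_siteGap_nonneg ha hb (fun hle => sub_nonneg.2 (h _ _ hle))
      (fun hle => sub_nonneg.2 (h _ _ hle))

/-- The ratio may fail to be increasing on `[0, 1/2]` if this is compensated by the pairs of spins shifted
by `(2, 0)`. -/
lemma siteDominates_of_shift (hm : 0 < m) (hf' : ConfinedSite m f') (hf : ConfinedSite m f)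
    (he' : ∀ r, f' (-r) = f' r) (he : ∀ r, f (-r) = f r)
    (h : ∀ x y, |y| ≤ |x| → 1 / 2 ≤ |x| → 0 ≤ siteGap f' f x y)
    (hs : ∀ x y, |x| < 1 / 2 → |y| < 1 / 2 → |siteGap f' f x y| ≤ siteGap f' f (x + 2) y) :
    SiteDominates f' f := by
  refine siteDominates_of_siteGap hm hf' hf he' he fun a b ha hb => ?_
  set Φ : ℝ × ℝ → ℝ := fun z => (z.1 + z.2) ^ a * (z.1 - z.2) ^ b * siteGap f' f z.1 z.2 with hΦ
  have hI : Integrable Φ := hf'.integrable_siteGap hm hf a b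
  set S : Set (ℝ × ℝ) := {z | |z.1| < 1 / 2 ∧ |z.2| < 1 / 2} with hS
  set T : Set (ℝ × ℝ) := {z | z - (2, 0) ∈ S} with hT
  have hSm : MeasurableSet S :=
    (measurableSet_lt (continuous_fst.abs).measurable measurable_const).inter
      (measurableSet_lt (continuous_snd.abs).measurable measurable_const)
  have hTm : MeasurableSet T := hSm.preimage (by fun_prop)
  -- the integrand can be negative on the square `S` only, and the translate `T` of `S` makes up for it
  have hpos : ∀ z, z ∉ S → 0 ≤ Φ z := fun z hz => by
    have hz' : 1 / 2 ≤ |z.1| ∨ 1 / 2 ≤ |z.2| := by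
      by_contra hcon
      push Not at hcon
      exact hz hcon
    refine odd_pow_mul_siteGap_nonneg ha hb (fun hle => h _ _ hle ?_) (fun hle => h _ _ hle ?_)
    · rcases hz' with h1 | h1
      · exact h1
      · exact h1.trans hle
    · rcases hz' with h1 | h1
      · exact h1.trans hle
      · exact h1
  have hdisj : ∀ z ∈ T, z ∉ S := by
    rintro z ⟨h1, -⟩ ⟨h2, -⟩
    simp only [Prod.fst_sub] at h1
    rw [abs_lt] at h1 h2
    linarith
  have hle : ∀ z, S.indicator Φ z + T.indicator Φ z ≤ Φ z := fun z => by
    by_cases hzS : z ∈ S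
    · have : z ∉ T := fun hzT => hdisj z hzT hzS
      simp [hzS, this]
    · by_cases hzT : z ∈ T
      · simp [hzS, hzT]
      · simpa [hzS, hzT] using hpos z hzS
  have hshift : ∫ z, T.indicator Φ z = ∫ z, S.indicator (fun z => Φ (z + (2, 0))) z := by
    rw [← integral_add_right_eq_self (fun z => T.indicator Φ z) ((2, 0) : ℝ × ℝ)]
    refine integral_congr_ae (Filter.Eventually.of_forall fun z => ?_)
    have : z + (2, 0) ∈ T ↔ z ∈ S := by simp [hT]
    by_cases hz : z ∈ S
    · simp only [Set.indicator_of_mem hz, Set.indicator_of_mem (this.2 hz)]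
    · simp only [Set.indicator_of_notMem hz, Set.indicator_of_notMem (fun h => hz (this.1 h))]
  have hpair : ∀ z ∈ S, 0 ≤ Φ z + Φ (z + (2, 0)) := by
    rintro ⟨x, y⟩ ⟨hx, hy⟩
    simp only at hx hy
    have h1 := hs x y hx hy
    have hx' := abs_lt.1 hx
    have hy' := abs_lt.1 hy
    -- on `S` both `|x + y|` and `|x - y|` are at most one, and both increase to at least one
    have h2 : |(x + y) ^ a * (x - y) ^ b| ≤ (x + 2 + y) ^ a * (x + 2 - y) ^ b := by
      rw [abs_mul, abs_pow, abs_pow]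
      refine mul_le_mul (pow_le_pow_left₀ (abs_nonneg _) (abs_le.2 ⟨?_, ?_⟩) _)
        (pow_le_pow_left₀ (abs_nonneg _) (abs_le.2 ⟨?_, ?_⟩) _) (by positivity)
        (pow_nonneg ?_ _) <;> linarith
    have h3 := mul_le_mul h2 h1 (abs_nonneg _) ((abs_nonneg _).trans h2)
    rw [← abs_mul] at h3
    have h4 := neg_abs_le ((x + y) ^ a * (x - y) ^ b * siteGap f' f x y)
    simp only [hΦ, Prod.mk_add_mk, add_zero]
    linarith
  have hIs : Integrable (fun z => Φ (z + (2, 0))) := hI.comp_add_right _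
  calc (0 : ℝ) ≤ ∫ z, S.indicator (fun z => Φ z + Φ (z + (2, 0))) z :=
        integral_nonneg fun z => Set.indicator_nonneg hpair z
    _ = ∫ z, (S.indicator Φ z + S.indicator (fun z => Φ (z + (2, 0))) z) :=
        integral_congr_ae (Filter.Eventually.of_forall fun z => by
          rw [Set.indicator_add])
    _ = (∫ z, S.indicator Φ z) + ∫ z, T.indicator Φ z := by
        rw [integral_add (hI.indicator hSm) (hIs.indicator hSm), hshift]
    _ = ∫ z, (S.indicator Φ z + T.indicator Φ z) :=
        (integral_add (hI.indicator hSm) (hI.indicator hTm)).symm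
    _ ≤ ∫ z, Φ z := integral_mono ((hI.indicator hSm).add (hI.indicator hTm)) hI hle

/-- The weight `exp (κ * |r| - m * r ^ 2)`. -/
def cuspWeight (κ m r : ℝ) : ℝ := Real.exp (κ * |r| - m * r ^ 2)

lemma confinedSite_cuspWeight (κ m : ℝ) : ConfinedSite m (cuspWeight κ m) where
  cont := by unfold cuspWeight; fun_prop
  nonneg _ := (Real.exp_pos _).le
  bound := ⟨1, κ, fun r => by rw [one_mul]; rfl⟩

lemma confinedSite_coshWeight {V : Type} (m : V → ℝ) (β : ℝ) (k : V) :
    ConfinedSite (m k) (coshWeight m β k) where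
  cont := by unfold coshWeight; fun_prop
  nonneg _ := mul_nonneg (Real.exp_pos _).le (Real.cosh_pos _).le
  bound := ⟨1, |β|, fun r => by
    have h1 : Real.cosh (β * r) ≤ Real.exp |β * r| := by
      rw [← Real.cosh_abs, ← Real.cosh_add_sinh |β * r|]
      linarith [Real.sinh_nonneg_iff.2 (abs_nonneg (β * r))]
    rw [coshWeight, one_mul, sub_eq_add_neg, Real.exp_add, mul_comm, ← abs_mul]
    exact mul_le_mul_of_nonneg_right h1 (Real.exp_pos _).le⟩

/-- Beyond `1/2` the ratio of `cosh (β r)` and `exp (κ r)` exceeds all its previous values: it is a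
convex function of `r` which takes the value one at the origin and more than that at `1/2`. -/
lemma cosh_mul_exp_le {κ β x y : ℝ} (hβ : Real.exp (κ / 2) < Real.cosh (β / 2)) (hy : 0 ≤ y)
    (hyx : y ≤ x) (hx : 1 / 2 ≤ x) :
    Real.cosh (β * y) * Real.exp (κ * x) ≤ Real.cosh (β * x) * Real.exp (κ * y) := by
  set g : ℝ → ℝ := fun t => Real.cosh (β * t) * Real.exp (-(κ * t)) with hg
  have hconv : ConvexOn ℝ Set.univ g := by
    have h1 : ∀ c : ℝ, ConvexOn ℝ Set.univ fun t : ℝ => Real.exp (c * t) := fun c =>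
      convexOn_exp.comp_linearMap (LinearMap.mulLeft ℝ c)
    have h2 := ((h1 (β - κ)).add (h1 (-β - κ))).smul (c := (1 / 2 : ℝ)) (by norm_num)
    refine h2.congr fun t _ => ?_
    simp only [hg, Real.cosh_eq, Pi.add_apply, smul_eq_mul]
    rw [sub_mul, sub_mul, sub_eq_add_neg, sub_eq_add_neg, Real.exp_add, Real.exp_add, neg_mul]
    ring
  have h0 : g 0 = 1 := by simp [hg]
  have hhalf : 1 < g (1 / 2) := by
    simp only [hg]
    rw [Real.exp_neg, ← div_eq_mul_inv, lt_div_iff₀ (Real.exp_pos _), one_mul]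
    rwa [mul_one_div, mul_one_div]
  have hx1 : 1 < g x := by
    have := hconv.le_max_of_mem_Icc (Set.mem_univ 0) (Set.mem_univ x)
      (z := 1 / 2) ⟨by norm_num, hx⟩
    rw [h0] at this
    rcases le_max_iff.1 this with h1 | h1
    · linarith
    · linarith
  have hyx' : g y ≤ g x := by
    have := hconv.le_max_of_mem_Icc (Set.mem_univ 0) (Set.mem_univ x) (z := y) ⟨hy, hyx⟩
    rwa [h0, max_eq_right hx1.le] at this
  simp only [hg] at hyx'
  rw [Real.exp_neg, Real.exp_neg, ← div_eq_mul_inv, ← div_eq_mul_inv,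
    div_le_div_iff₀ (Real.exp_pos _) (Real.exp_pos _)] at hyx'
  exact hyx'

/-- In a sufficiently strong random field, the Gaussian weight dominates `cuspWeight`. -/
lemma exists_siteDominates_coshWeight {κ : ℝ} (hκ : 0 ≤ κ) (a : ℝ) :
    ∃ β : ℝ, ∀ (V : Type) (m : V → ℝ) (k : V), 0 < m k → m k ≤ a →
      SiteDominates (coshWeight m β k) (cuspWeight κ (m k)) := by
  set E₁ := Real.exp (5 / 2 * κ) with hE₁
  set E₂ := Real.exp (6 * a + κ / 2) with hE₂
  -- `E₁` bounds `exp (κ * |x + 2|)` for `|x| < 1 / 2`, and `E₂` contains the loss `exp (-6 * m)` of the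
  -- Gaussian factor under the shift from `x` to `x + 2`
  set L := 1 + E₁ + E₂ with hL
  have hE₁0 : 0 < E₁ := Real.exp_pos _
  have hE₂0 : 0 < E₂ := Real.exp_pos _
  obtain ⟨β, hβ0, hβ⟩ : ∃ β : ℝ, 0 ≤ β ∧ L ≤ Real.cosh (β / 2) := by
    refine ⟨2 * Real.log (2 * L), by have := Real.log_nonneg (x := 2 * L) (by linarith); linarith,
      ?_⟩
    rw [mul_div_cancel_left₀ _ two_ne_zero, Real.cosh_eq, Real.exp_log (by positivity)]
    have := Real.exp_pos (-Real.log (2 * L))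
    linarith
  refine ⟨β, fun V m k hm hma => ?_⟩
  have hhalf : Real.exp (κ / 2) < Real.cosh (β / 2) := by
    have : Real.exp (κ / 2) ≤ E₁ := Real.exp_le_exp.2 (by linarith)
    linarith
  have hgap : ∀ x y, siteGap (coshWeight m β k) (cuspWeight κ (m k)) x y =
      Real.exp (-(m k * x ^ 2) - m k * y ^ 2) * (Real.cosh (β * x) * Real.exp (κ * |y|) -
        Real.cosh (β * y) * Real.exp (κ * |x|)) := fun x y => by
    simp only [siteGap, coshWeight, cuspWeight, sub_eq_add_neg, Real.exp_add]
    ring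
  have habs : ∀ x, Real.cosh (β * |x|) = Real.cosh (β * x) := fun x => by
    rw [← Real.cosh_abs (β * x), abs_mul, abs_of_nonneg hβ0]
  refine siteDominates_of_shift hm (confinedSite_coshWeight m β k) (confinedSite_cuspWeight κ _)
    (fun r => by simp [coshWeight]) (fun r => by simp [cuspWeight]) ?_ ?_
  · intro x y hyx hx
    rw [hgap]
    refine mul_nonneg (Real.exp_pos _).le (sub_nonneg.2 ?_)
    have := cosh_mul_exp_le hhalf (abs_nonneg y) hyx hx
    rwa [habs, habs] at this
  · intro x y hx hy
    have hx' := abs_lt.1 hx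
    have hcosh : ∀ u v : ℝ, |u| ≤ v → Real.cosh (β * u) ≤ Real.cosh (β * v) := fun u v huv => by
      rw [Real.cosh_le_cosh, abs_mul, abs_mul]
      exact mul_le_mul_of_nonneg_left (huv.trans (le_abs_self v)) (abs_nonneg _)
    set c := Real.cosh (β / 2) with hc
    have hc1 : ∀ u : ℝ, |u| < 1 / 2 → Real.cosh (β * u) ≤ c := fun u hu => by
      have := hcosh u (1 / 2) hu.le
      rwa [mul_one_div] at this
    have hc0 : 0 < c := Real.cosh_pos _
    have he1 : ∀ u : ℝ, |u| < 1 / 2 → Real.exp (κ * |u|) ≤ Real.exp (κ / 2) := fun u hu =>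
      Real.exp_le_exp.2 (by nlinarith)
    have hbound : ∀ u v : ℝ, |u| < 1 / 2 → |v| < 1 / 2 →
        Real.cosh (β * u) * Real.exp (κ * |v|) ≤ c * Real.exp (κ / 2) := fun u v hu hv =>
      mul_le_mul (hc1 u hu) (he1 v hv) (Real.exp_pos _).le hc0.le
    have h1 : |Real.cosh (β * x) * Real.exp (κ * |y|) - Real.cosh (β * y) * Real.exp (κ * |x|)| ≤
        c * Real.exp (κ / 2) := by
      have hp : ∀ u v : ℝ, 0 ≤ Real.cosh (β * u) * Real.exp (κ * |v|) := fun u v =>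
        mul_nonneg (Real.cosh_pos _).le (Real.exp_pos _).le
      rw [abs_le]
      constructor <;> linarith [hbound x y hx hy, hbound y x hy hx, hp x y, hp y x]
    -- `x + 2 ≥ 3 / 2`, and `cosh (3 * t)` exceeds `cosh t` by the large factor `4 * cosh t ^ 2 - 3`
    have h3 : c * (4 * c ^ 2 - 3) ≤ Real.cosh (β * (x + 2)) := by
      have h4 : Real.cosh (3 * (β / 2)) = c * (4 * c ^ 2 - 3) := by
        rw [Real.cosh_three_mul]; ring
      have h5 := hcosh (3 / 2) (x + 2) (by rw [abs_of_pos (by norm_num)]; linarith)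
      rw [← h4]
      convert h5 using 2
      ring
    have h6 : Real.exp (κ * |x + 2|) ≤ E₁ := Real.exp_le_exp.2 (by
      rw [abs_of_pos (by linarith)]
      nlinarith)
    have h7 : c * E₂ ≤ Real.cosh (β * (x + 2)) * Real.exp (κ * |y|) -
        Real.cosh (β * y) * Real.exp (κ * |x + 2|) := by
      have h8 : Real.cosh (β * y) * Real.exp (κ * |x + 2|) ≤ c * E₁ :=
        mul_le_mul (hc1 y hy) h6 (Real.exp_pos _).le hc0.le
      have h9 : Real.cosh (β * (x + 2)) ≤ Real.cosh (β * (x + 2)) * Real.exp (κ * |y|) :=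
        le_mul_of_one_le_right (Real.cosh_pos _).le
          (Real.one_le_exp (mul_nonneg hκ (abs_nonneg _)))
      have h10 : E₁ + E₂ ≤ 4 * c ^ 2 - 3 := by nlinarith
      have h11 := mul_le_mul_of_nonneg_left h10 hc0.le
      linarith
    rw [hgap, hgap, abs_mul, abs_of_pos (Real.exp_pos _)]
    calc Real.exp (-(m k * x ^ 2) - m k * y ^ 2) * _
        ≤ Real.exp (-(m k * x ^ 2) - m k * y ^ 2) * (c * Real.exp (κ / 2)) :=
          mul_le_mul_of_nonneg_left h1 (Real.exp_pos _).le
      _ = c * Real.exp (-(m k * x ^ 2) - m k * y ^ 2 + κ / 2) := by rw [Real.exp_add]; ring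
      _ ≤ c * Real.exp (-(m k * (x + 2) ^ 2) - m k * y ^ 2 + (6 * a + κ / 2)) := by
          refine mul_le_mul_of_nonneg_left (Real.exp_le_exp.2 ?_) hc0.le
          nlinarith
      _ = Real.exp (-(m k * (x + 2) ^ 2) - m k * y ^ 2) * (c * E₂) := by
          rw [Real.exp_add _ (6 * a + κ / 2)]; ring
      _ ≤ _ := mul_le_mul_of_nonneg_left h7 (Real.exp_pos _).le

end Site

/-! ### Decay for even single-site weights -/

section EvenWeights

variable {V : Type} [Fintype V] {d : ℝ} {m : V → ℝ} {J : V → V → ℝ} {f : V → ℝ → ℝ}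

lemma Confined.integrable_mul_siteDensity (hf : Confined m f) (h : Dominant d m J) (hd : 0 < d)
    {F : (V → ℝ) → ℝ} (hF : Continuous F) {C c : ℝ} (hFC : ∀ p, |F p| ≤ C * Real.exp (c * ∑ k, |p k|)) :
    Integrable (fun p => F p * siteDensity f J p) := by
  obtain ⟨C', c', hC', hb⟩ := hf.exists_prod_le
  have hcont : Continuous (siteDensity f J) :=
    hf.continuous_prod.mul (Real.continuous_exp.comp (continuous_coupling J))
  refine integrable_of_abs_le_exp (C := C * C') (c := c + c') (hF.mul hcont).aestronglyMeasurable hd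
    fun p => ?_
  have h1 : Real.exp (coupling J p) ≤ Real.exp (∑ k, (m k - d) * p k ^ 2) :=
    Real.exp_le_exp.2 ((le_abs_self _).trans (h.abs_coupling_le p))
  have h2 : 0 ≤ siteDensity f J p := mul_nonneg (hf.prod_nonneg p) (Real.exp_pos _).le
  have h3 := (abs_nonneg _).trans (hFC p)
  rw [abs_mul, abs_of_nonneg h2]
  calc |F p| * siteDensity f J p
      ≤ (C * Real.exp (c * ∑ k, |p k|)) * ((C' * Real.exp (c' * ∑ k, |p k| - ∑ k, m k * p k ^ 2)) *
          Real.exp (∑ k, (m k - d) * p k ^ 2)) :=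
        mul_le_mul (hFC p) (mul_le_mul (hb p) h1 (Real.exp_pos _).le (by positivity)) h2 h3
    _ = C * C' * (Real.exp (c * ∑ k, |p k|) * Real.exp (c' * ∑ k, |p k| - ∑ k, m k * p k ^ 2) *
          Real.exp (∑ k, (m k - d) * p k ^ 2)) := by ring
    _ = _ := by
        rw [← Real.exp_add, ← Real.exp_add]
        simp only [sub_mul, Finset.sum_sub_distrib, ← Finset.mul_sum]
        congr 2
        ring

lemma Confined.integrable_siteDensity (hf : Confined m f) (h : Dominant d m J) (hd : 0 < d) :
    Integrable (siteDensity f J) := by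
  have := hf.integrable_mul_siteDensity h hd (F := fun _ => 1) continuous_const (C := 1) (c := 0)
    (by simp)
  simpa using this

lemma Confined.integrable_coord (hf : Confined m f) (h : Dominant d m J) (hd : 0 < d) (i : V) :
    Integrable (fun p => p i * siteDensity f J p) :=
  hf.integrable_mul_siteDensity h hd (continuous_apply i) (C := 1) (c := 1)
    (fun p => by rw [one_mul]; exact exp_abs_le_exp_sum p i)

lemma Confined.integrable_coord_mul (hf : Confined m f) (h : Dominant d m J) (hd : 0 < d)
    (i j : V) : Integrable (fun p => p i * p j * siteDensity f J p) :=
  hf.integrable_mul_siteDensity h hd ((continuous_apply i).mul (continuous_apply j)) (C := 1) (c := 2)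
    (fun p => by
      have e : Real.exp (2 * ∑ k, |p k|) = Real.exp (1 * ∑ k, |p k|) * Real.exp (1 * ∑ k, |p k|) := by
        rw [← Real.exp_add]; congr 1; ring
      rw [one_mul, e, abs_mul]
      exact mul_le_mul (exp_abs_le_exp_sum p i) (exp_abs_le_exp_sum p j) (abs_nonneg _)
        (Real.exp_pos _).le)

lemma Confined.integral_siteDensity_pos (hf : Confined m f) (h : Dominant d m J) (hd : 0 < d)
    (hpos : ∀ k r, 0 < f k r) : 0 < ∫ p, siteDensity f J p := by
  have h0 : ∀ p, 0 < siteDensity f J p := fun p =>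
    mul_pos (Finset.prod_pos fun k _ => hpos k _) (Real.exp_pos _)
  rw [integral_pos_iff_support_of_nonneg (fun p => (h0 p).le) (hf.integrable_siteDensity h hd)]
  have : Function.support (siteDensity f J) = Set.univ := by
    ext p
    simpa using (h0 p).ne'
  rw [this]
  exact NeZero.pos _

lemma Dominant.abs (h : Dominant d m J) : Dominant d m (fun k l => |J k l|) where
  symm k l := by rw [h.symm]
  diag k := by rw [h.diag, abs_zero]
  row k := by simpa only [abs_abs] using h.row k

/-- Algebraic decay of the two-point function for even single-site weights that are dominated by
`cuspWeight`, uniformly in the weights. -/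
theorem exists_even_decay {s d a A κ : ℝ} (hs : 2 < s) (hd : 0 < d) (ha : d ≤ a) (hA : 0 ≤ A)
    (hκ : 0 ≤ κ) :
    ∃ C : ℝ, 0 < C ∧ ∀ (V : Type) [Fintype V] [DecidableEq V] (x : V → ℤ), Function.Injective x →
      ∀ (m : V → ℝ) (J : V → V → ℝ), Dominant d m J → (∀ k, m k ≤ a) →
      (∀ k l, |J k l| ≤ A * algWeight s (x k - x l)) → ∀ f : V → ℝ → ℝ, Confined m f →
      (∀ k r, f k (-r) = f k r) →
      (∀ k x y, |y| ≤ |x| → cuspWeight κ (m k) y * f k x ≤ cuspWeight κ (m k) x * f k y) → ∀ i j,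
      |∫ p, p i * p j * siteDensity f J p| ≤
        C * algWeight s (x i - x j) * ∫ p, siteDensity f J p := by
  obtain ⟨β, hβ⟩ := exists_siteDominates_coshWeight hκ a
  obtain ⟨C, hC, hdec⟩ := exists_cosh_decay β hs hd ha hA
  refine ⟨C, hC, ?_⟩
  intro V _ _ x hx m J h hma hJ f hf heven hratio i j
  have hm : ∀ k, 0 < m k := fun k => by linarith [h.nonneg_sub k]
  have hf1 : Confined m (fun k => cuspWeight κ (m k)) := fun k => confinedSite_cuspWeight κ (m k)
  have hf2 : Confined m (coshWeight m β) := fun k => confinedSite_coshWeight m β k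
  -- first the weights `cuspWeight` and the couplings `|J|`, then the weights `coshWeight`
  have h1 := abs_integral_coord_mul_le hd h h.abs hf hf1
    (fun k => siteDominates_of_ratio (hm k) (hf1 k) (hf k) (fun r => by simp [cuspWeight])
      (heven k) (hratio k)) (fun k l => le_rfl) i j
  have h2 := abs_integral_coord_mul_le hd h.abs h.abs hf1 hf2
    (fun k => hβ V m k (hm k) (hma k)) (fun k l => (abs_abs _).le) i j
  have h3 := hdec V x hx m _ h.abs (fun k l => abs_nonneg _) hma hJ i j
  have hZ1 := hf1.integral_siteDensity_pos h.abs hd (fun k r => Real.exp_pos _)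
  have hZ2 := hf2.integral_siteDensity_pos h.abs hd
    (fun k r => mul_pos (Real.exp_pos _) (Real.cosh_pos _))
  have hZ : 0 ≤ ∫ p, siteDensity f J p := integral_nonneg fun p =>
    mul_nonneg (hf.prod_nonneg p) (Real.exp_pos _).le
  have h4 : (∫ p, p i * p j * siteDensity (fun k => cuspWeight κ (m k)) (fun k l => |J k l|) p) ≤
      C * algWeight s (x i - x j) *
        ∫ p, siteDensity (fun k => cuspWeight κ (m k)) (fun k l => |J k l|) p := by
    refine le_of_mul_le_mul_right ?_ hZ2
    refine (mul_le_mul_of_nonneg_right (le_abs_self _) hZ2.le).trans (h2.trans ?_)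
    refine (mul_le_mul_of_nonneg_right h3 hZ1.le).trans_eq ?_
    ring
  refine le_of_mul_le_mul_right ?_ hZ1
  refine h1.trans ((mul_le_mul_of_nonneg_right h4 hZ).trans_eq ?_)
  ring

end EvenWeights

/-! ### Perturbed convex potentials -/

section Potential

/-- A single-site potential that is the sum of a convex function and a function which is bounded by `K`
together with its derivative. -/
def PerturbedConvexSite (K : ℝ) (ψ : ℝ → ℝ) : Prop :=
  ∃ ψc ψb : ℝ → ℝ, (∀ z, ψ z = ψc z + ψb z) ∧ Differentiable ℝ ψc ∧ ConvexOn ℝ Set.univ ψc ∧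
    Differentiable ℝ ψb ∧ ∀ z, |ψb z| + |deriv ψb z| ≤ K

namespace PerturbedConvexSite

variable {K : ℝ} {ψ : ℝ → ℝ}

lemma add_linear (h : PerturbedConvexSite K ψ) (b : ℝ) :
    PerturbedConvexSite K (fun z => ψ z + b * z) := by
  obtain ⟨ψc, ψb, hψ, hc, hconv, hb, hK⟩ := h
  refine ⟨fun z => ψc z + b * z, ψb, fun z => by simp only [hψ]; ring, by fun_prop, hconv.add ?_, hb, hK⟩
  exact (LinearMap.mulLeft ℝ b).convexOn convex_univ

lemma continuous (h : PerturbedConvexSite K ψ) : Continuous ψ := by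
  obtain ⟨ψc, ψb, hψ, hc, -, hb, -⟩ := h
  rw [funext hψ]
  exact hc.continuous.add hb.continuous

lemma exists_lower_bound (h : PerturbedConvexSite K ψ) :
    ∃ C c : ℝ, ∀ r, -ψ r ≤ C + c * |r| := by
  obtain ⟨ψc, ψb, hψ, hc, hconv, hb, hK⟩ := h
  refine ⟨K - ψc 0, |deriv ψc 0|, fun r => ?_⟩
  have hder := (hc 0).hasDerivAt
  have h1 : ψc 0 + deriv ψc 0 * r ≤ ψc r := by
    rcases lt_trichotomy r 0 with hr | rfl | hr
    · have := hconv.slope_le_of_hasDerivAt (Set.mem_univ r) (Set.mem_univ 0) hr hder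
      rw [slope_def_field, div_le_iff₀ (by linarith)] at this
      linarith
    · simp
    · have := hconv.le_slope_of_hasDerivAt (Set.mem_univ 0) (Set.mem_univ r) hr hder
      rw [slope_def_field, le_div_iff₀ (by linarith)] at this
      linarith
  have h2 : -(|deriv ψc 0| * |r|) ≤ deriv ψc 0 * r := by
    rw [← abs_mul]; exact neg_abs_le _
  have h3 := hK r
  have h4 := neg_abs_le (ψb r)
  have h5 := abs_nonneg (deriv ψb r)
  rw [hψ]
  linarith

/-- The even part of the potential around `q` decreases at most linearly in the distance. -/
lemma even_sub_le (h : PerturbedConvexSite K ψ) (q : ℝ) {x y : ℝ} (hxy : |y| ≤ |x|) :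
    (ψ (q + y / 2) + ψ (q - y / 2)) - (ψ (q + x / 2) + ψ (q - x / 2)) ≤ K * |x| - K * |y| := by
  obtain ⟨ψc, ψb, hψ, hc, hconv, hb, hK⟩ := h
  have hlip : ∀ u v, ψb v - ψb u ≤ K * |v - u| := fun u v => by
    have := Convex.norm_image_sub_le_of_norm_deriv_le (f := ψb) (C := K) (s := Set.univ)
      (fun z _ => hb z) (fun z _ => by
        rw [Real.norm_eq_abs]
        linarith [hK z, abs_nonneg (ψb z)]) convex_univ (Set.mem_univ u) (Set.mem_univ v)
    exact (le_abs_self _).trans this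
  have heven : ∀ (g : ℝ → ℝ) (r : ℝ),
      g (q + |r| / 2) + g (q - |r| / 2) = g (q + r / 2) + g (q - r / 2) := fun g r => by
    rcases abs_cases r with ⟨h, -⟩ | ⟨h, -⟩ <;> rw [h]
    rw [neg_div, sub_neg_eq_add, ← sub_eq_add_neg, add_comm]
  have h1 : ψb (q + y / 2) + ψb (q - y / 2) - (ψb (q + x / 2) + ψb (q - x / 2)) ≤
      K * |x| - K * |y| := by
    rw [← heven ψb x, ← heven ψb y]
    have e1 := hlip (q + |x| / 2) (q + |y| / 2)
    have e2 := hlip (q - |x| / 2) (q - |y| / 2)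
    have h0 : 0 ≤ (|x| - |y|) / 2 := by linarith
    rw [show q + |y| / 2 - (q + |x| / 2) = -((|x| - |y|) / 2) by ring, abs_neg,
      abs_of_nonneg h0] at e1
    rw [show q - |y| / 2 - (q - |x| / 2) = (|x| - |y|) / 2 by ring,
      abs_of_nonneg h0] at e2
    linarith
  have hconv2 : ConvexOn ℝ Set.univ fun r : ℝ => ψc (q + r / 2) + ψc (q - r / 2) := by
    refine ⟨convex_univ, fun u _ v _ a b ha hb hab => ?_⟩
    have e1 := hconv.2 (Set.mem_univ (q + u / 2)) (Set.mem_univ (q + v / 2)) ha hb hab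
    have e2 := hconv.2 (Set.mem_univ (q - u / 2)) (Set.mem_univ (q - v / 2)) ha hb hab
    simp only [smul_eq_mul] at e1 e2 ⊢
    have hq : q = a * q + b * q := by rw [← add_mul, hab, one_mul]
    rw [show a * (q + u / 2) + b * (q + v / 2) = q + (a * u + b * v) / 2 by
      rw [eq_comm]; nth_rewrite 1 [hq]; ring] at e1
    rw [show a * (q - u / 2) + b * (q - v / 2) = q - (a * u + b * v) / 2 by
      rw [eq_comm]; nth_rewrite 1 [hq]; ring] at e2
    linarith
  have h2 : ψc (q + y / 2) + ψc (q - y / 2) ≤ ψc (q + x / 2) + ψc (q - x / 2) := by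
    have := hconv2.le_max_of_mem_Icc (Set.mem_univ (-|x|)) (Set.mem_univ |x|) (z := y)
      (abs_le.1 hxy)
    have e : ψc (q + -|x| / 2) + ψc (q - -|x| / 2) = ψc (q + |x| / 2) + ψc (q - |x| / 2) := by
      rw [neg_div, sub_neg_eq_add, ← sub_eq_add_neg, add_comm]
    rw [e, max_self, heven] at this
    exact this
  simp only [hψ]
  linarith

end PerturbedConvexSite

/-- The single-site weight for the potential `ψ r + m * r ^ 2`. -/
def potentialWeight (ψ : ℝ → ℝ) (m r : ℝ) : ℝ := Real.exp (-ψ r - m * r ^ 2)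

/-- The weight of the difference `r` of two independent copies of a spin with mean `q`. -/
def doubledWeight (ψ : ℝ → ℝ) (m q r : ℝ) : ℝ :=
  potentialWeight ψ m (q + r / 2) * potentialWeight ψ m (q - r / 2)

lemma doubledWeight_eq (ψ : ℝ → ℝ) (m q r : ℝ) : doubledWeight ψ m q r =
    Real.exp (-(ψ (q + r / 2) + ψ (q - r / 2)) - 2 * m * q ^ 2 - m / 2 * r ^ 2) := by
  rw [doubledWeight, potentialWeight, potentialWeight, ← Real.exp_add]
  congr 1
  ring

lemma doubledWeight_neg (ψ : ℝ → ℝ) (m q r : ℝ) :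
    doubledWeight ψ m q (-r) = doubledWeight ψ m q r := by
  rw [doubledWeight_eq, doubledWeight_eq, neg_div, sub_neg_eq_add, ← sub_eq_add_neg, neg_sq,
    add_comm (ψ (q - r / 2))]

namespace PerturbedConvexSite

variable {K : ℝ} {ψ : ℝ → ℝ}

lemma confinedSite (h : PerturbedConvexSite K ψ) (m : ℝ) :
    ConfinedSite m (potentialWeight ψ m) where
  cont := by have := h.continuous; unfold potentialWeight; fun_prop
  nonneg _ := (Real.exp_pos _).le
  bound := by
    obtain ⟨C, c, hb⟩ := h.exists_lower_bound
    refine ⟨Real.exp C, c, fun r => ?_⟩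
    rw [potentialWeight, ← Real.exp_add, Real.exp_le_exp]
    linarith [hb r]

lemma cuspWeight_mul_doubledWeight_le (h : PerturbedConvexSite K ψ) (m q : ℝ)
    {x y : ℝ} (hxy : |y| ≤ |x|) :
    cuspWeight K (m / 2) y * doubledWeight ψ m q x ≤
      cuspWeight K (m / 2) x * doubledWeight ψ m q y := by
  rw [doubledWeight_eq, doubledWeight_eq, cuspWeight, cuspWeight, ← Real.exp_add, ← Real.exp_add,
    Real.exp_le_exp]
  linarith [h.even_sub_le q hxy]

lemma confinedSite_doubledWeight (h : PerturbedConvexSite K ψ) (m q : ℝ) :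
    ConfinedSite (m / 2) (doubledWeight ψ m q) where
  cont := by
    have := (h.confinedSite m).cont
    unfold doubledWeight
    fun_prop
  nonneg _ := mul_nonneg (Real.exp_pos _).le (Real.exp_pos _).le
  bound := ⟨doubledWeight ψ m q 0, K, fun r => by
    have := h.cuspWeight_mul_doubledWeight_le m q (x := r) (y := 0) (by simp)
    rw [show cuspWeight K (m / 2) 0 = 1 by simp [cuspWeight], one_mul, mul_comm] at this
    exact this⟩

end PerturbedConvexSite

end Potential

/-! ### Duplication of the spins -/

section Doubling

variable {V : Type} [Fintype V] {d : ℝ} {m : V → ℝ} {J : V → V → ℝ}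

/-- The mean `q` and the difference `p` of two configurations are volume preserving coordinates. -/
lemma measurePreserving_mean_difference :
    MeasurePreserving (fun z : (V → ℝ) × (V → ℝ) =>
      (z.1 + (1 / 2 : ℝ) • z.2, z.1 - (1 / 2 : ℝ) • z.2)) := by
  have h1 : MeasurePreserving (fun z : (V → ℝ) × (V → ℝ) => (z.1, z.1 + z.2)) :=
    (MeasurePreserving.id volume).skew_product (g := fun y p => y + p)
      (measurable_fst.add measurable_snd)
      (Filter.Eventually.of_forall fun y => (measurePreserving_add_left volume y).map_eq)
  have h2 : MeasurePreserving (fun z : (V → ℝ) × (V → ℝ) => (z.1, z.2 - (1 / 2 : ℝ) • z.1)) :=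
    (MeasurePreserving.id volume).skew_product (g := fun p q => q - (1 / 2 : ℝ) • p)
      (by unfold Function.uncurry; fun_prop)
      (Filter.Eventually.of_forall fun p => (measurePreserving_sub_right volume _).map_eq)
  have hs : MeasurePreserving (Prod.swap : (V → ℝ) × (V → ℝ) → _) := Measure.measurePreserving_swap
  have h3 := hs.comp (h1.comp (hs.comp (h2.comp hs)))
  convert h3 using 1
  funext z
  simp only [Function.comp_apply, Prod.swap_prod_mk, Prod.fst_swap, Prod.snd_swap, Prod.mk.injEq,
    and_true]
  ext k
  simp only [Pi.add_apply, Pi.sub_apply, Pi.smul_apply, smul_eq_mul]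
  ring

/-- In terms of the mean `q` and the difference `p`, two copies of the system become for fixed `q` a
system with the even single-site weights `doubledWeight` and halved couplings. -/
lemma siteDensity_mul_siteDensity (ψ : V → ℝ → ℝ) (m : V → ℝ) (J : V → V → ℝ) (q p : V → ℝ) :
    siteDensity (fun k => potentialWeight (ψ k) (m k)) J (q + (1 / 2 : ℝ) • p) *
      siteDensity (fun k => potentialWeight (ψ k) (m k)) J (q - (1 / 2 : ℝ) • p) =
    Real.exp (2 * coupling J q) *
      siteDensity (fun k => doubledWeight (ψ k) (m k) (q k)) (fun k l => J k l / 2) p := by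
  have h1 : coupling J (q + (1 / 2 : ℝ) • p) + coupling J (q - (1 / 2 : ℝ) • p) =
      2 * coupling J q + coupling (fun k l => J k l / 2) p := by
    simp only [coupling, Finset.mul_sum, ← Finset.sum_add_distrib, Pi.add_apply, Pi.sub_apply,
      Pi.smul_apply, smul_eq_mul]
    exact Finset.sum_congr rfl fun k _ => Finset.sum_congr rfl fun l _ => by ring
  simp only [siteDensity, doubledWeight, Pi.add_apply, Pi.sub_apply, Pi.smul_apply, smul_eq_mul,
    Finset.prod_mul_distrib]
  rw [mul_mul_mul_comm, ← Real.exp_add, h1, Real.exp_add]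
  have e : ∀ k, 1 / 2 * p k = p k / 2 := fun k => by ring
  simp only [e]
  ring

lemma Dominant.half (h : Dominant d m J) :
    Dominant (d / 2) (fun k => m k / 2) (fun k l => J k l / 2) where
  symm k l := by rw [h.symm]
  diag k := by rw [h.diag, zero_div]
  row k := by
    simp only [abs_div, abs_two, ← Finset.sum_div]
    linarith [h.row k]

/-- Algebraic decay of the truncated two-point function for perturbed convex potentials. -/
theorem exists_truncated_decay {s d a A K : ℝ} (hs : 2 < s) (hd : 0 < d) (ha : d ≤ a) (hA : 0 ≤ A)
    (hK : 0 ≤ K) :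
    ∃ C : ℝ, 0 < C ∧ ∀ (V : Type) [Fintype V] [DecidableEq V] (x : V → ℤ), Function.Injective x →
      ∀ (m : V → ℝ) (J : V → V → ℝ), Dominant d m J → (∀ k, m k ≤ a) →
      (∀ k l, |J k l| ≤ A * algWeight s (x k - x l)) → ∀ ψ : V → ℝ → ℝ,
      (∀ k, PerturbedConvexSite K (ψ k)) → ∀ ρ : (V → ℝ) → ℝ,
      ρ = siteDensity (fun k => potentialWeight (ψ k) (m k)) J → ∀ i j,
      |(∫ p, p i * p j * ρ p) * (∫ p, ρ p) - (∫ p, p i * ρ p) * ∫ p, p j * ρ p| ≤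
        C * algWeight s (x i - x j) * (∫ p, ρ p) ^ 2 := by
  obtain ⟨C, hC, hdec⟩ := exists_even_decay (s := s) (d := d / 2) (a := a / 2) (A := A / 2) (κ := K)
    hs (by positivity) (by linarith) (by positivity) hK
  refine ⟨C / 2, by positivity, ?_⟩
  intro V _ _ x hx m J h hma hJ ψ hψ ρ hρ i j
  have hf : Confined m (fun k => potentialWeight (ψ k) (m k)) := fun k => (hψ k).confinedSite _
  have I0 : Integrable ρ := hρ ▸ hf.integrable_siteDensity h hd
  have I1 : ∀ i, Integrable (fun p => p i * ρ p) := fun i => hρ ▸ hf.integrable_coord h hd i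
  have I2 : ∀ i j, Integrable (fun p => p i * p j * ρ p) := fun i j =>
    hρ ▸ hf.integrable_coord_mul h hd i j
  set T : (V → ℝ) × (V → ℝ) → (V → ℝ) × (V → ℝ) := fun z =>
    (z.1 + (1 / 2 : ℝ) • z.2, z.1 - (1 / 2 : ℝ) • z.2) with hT
  have hTm : MeasurePreserving T := measurePreserving_mean_difference
  -- the truncated two-point function in terms of two copies
  set G : (V → ℝ) × (V → ℝ) → ℝ := fun z => ρ z.1 * ρ z.2 with hG
  set F : (V → ℝ) × (V → ℝ) → ℝ := fun z => (z.1 i - z.2 i) * (z.1 j - z.2 j) * G z with hF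
  have hGint : Integrable G := I0.mul_prod I0
  have hFeq : F = fun z => ((z.1 i * z.1 j * ρ z.1) * ρ z.2 - (z.1 i * ρ z.1) * (z.2 j * ρ z.2)) -
      ((z.1 j * ρ z.1) * (z.2 i * ρ z.2) - ρ z.1 * (z.2 i * z.2 j * ρ z.2)) := by
    funext z
    simp only [hF, hG]
    ring
  have a1 := (I2 i j).mul_prod I0
  have a2 := (I1 i).mul_prod (I1 j)
  have a3 := (I1 j).mul_prod (I1 i)
  have a4 := I0.mul_prod (I2 i j)
  have hFint : Integrable F := by
    rw [hFeq]
    exact (a1.sub a2).sub (a3.sub a4)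
  have hFval : ∫ z, F z =
      2 * ((∫ p, p i * p j * ρ p) * (∫ p, ρ p) - (∫ p, p i * ρ p) * ∫ p, p j * ρ p) := by
    rw [hFeq]
    have e1 := integral_sub (a1.sub a2) (a3.sub a4)
    simp only [Pi.sub_apply] at e1
    refine e1.trans ?_
    rw [integral_sub a1 a2, integral_sub a3 a4, integral_prod_mul (fun p : V → ℝ => p i * p j * ρ p) ρ, integral_prod_mul
      (fun p : V → ℝ => p i * ρ p) (fun p : V → ℝ => p j * ρ p), integral_prod_mul
      (fun p : V → ℝ => p j * ρ p) (fun p : V → ℝ => p i * ρ p),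
      integral_prod_mul ρ (fun p : V → ℝ => p i * p j * ρ p)]
    ring
  have hGval : ∫ z, G z = (∫ p, ρ p) ^ 2 := by
    rw [sq]
    exact integral_prod_mul ρ ρ
  -- change of variables to mean and difference
  have hchange : ∀ H : (V → ℝ) × (V → ℝ) → ℝ, Integrable H →
      Integrable (fun z => H (T z)) ∧ ∫ z, H z = ∫ q, ∫ p, H (T (q, p)) := fun H hH => by
    have hi : Integrable (fun z => H (T z)) :=
      (hTm.integrable_comp hH.aestronglyMeasurable).2 hH
    refine ⟨hi, ?_⟩
    have e1 := integral_map hTm.measurable.aemeasurable (f := H)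
      (by rw [hTm.map_eq]; exact hH.aestronglyMeasurable)
    rw [hTm.map_eq] at e1
    exact e1.trans (integral_prod _ hi)
  obtain ⟨hGi, hGc⟩ := hchange G hGint
  obtain ⟨-, hFc⟩ := hchange F hFint
  have hfix : ∀ q : V → ℝ, |∫ p, F (T (q, p))| ≤
      C * algWeight s (x i - x j) * ∫ p, G (T (q, p)) := fun q => by
    have e1 : ∀ p : V → ℝ, G (T (q, p)) = Real.exp (2 * coupling J q) *
        siteDensity (fun k => doubledWeight (ψ k) (m k) (q k)) (fun k l => J k l / 2) p := fun p => by
      simp only [hG, hT, hρ]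
      exact siteDensity_mul_siteDensity ψ m J q p
    have e2 : ∀ p : V → ℝ, F (T (q, p)) = Real.exp (2 * coupling J q) * (p i * p j *
        siteDensity (fun k => doubledWeight (ψ k) (m k) (q k)) (fun k l => J k l / 2) p) := fun p => by
      have e3 : ∀ k, (T (q, p)).1 k - (T (q, p)).2 k = p k := fun k => by
        simp only [hT, Pi.add_apply, Pi.sub_apply, Pi.smul_apply, smul_eq_mul]
        ring
      simp only [hF]
      rw [e1, e3, e3]
      ring
    simp_rw [e1, e2]
    rw [integral_const_mul, integral_const_mul, abs_mul, abs_of_pos (Real.exp_pos _), mul_left_comm]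
    refine mul_le_mul_of_nonneg_left ?_ (Real.exp_pos _).le
    exact hdec V x hx _ _ h.half (fun k => by linarith [hma k])
      (fun k l => by
        rw [abs_div, abs_two]
        linarith [hJ k l])
      _ (fun k => (hψ k).confinedSite_doubledWeight _ _) (fun k r => doubledWeight_neg _ _ _ _)
      (fun k u v huv => (hψ k).cuspWeight_mul_doubledWeight_le _ _ huv) i j
  have hfinal : |∫ z, F z| ≤ C * algWeight s (x i - x j) * ∫ z, G z := by
    rw [hFc, hGc, ← integral_const_mul]
    exact norm_integral_le_of_norm_le (f := fun q => ∫ p, F (T (q, p)))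
      (hGi.integral_prod_left.const_mul (C * algWeight s (x i - x j)))
      (Filter.Eventually.of_forall hfix)
  rw [hFval, hGval, abs_mul, abs_two] at hfinal
  linarith

end Doubling

/-! ### The finite-volume Gibbs measure -/

section Gibbs

/-- The exponent is lowered from `2 + α` to `2 + α / 2`. -/
lemma inv_le_algWeight {α : ℝ} (hα : 0 ≤ α) (n : ℤ) :
    1 / (|(n : ℝ)| ^ (2 + α) + 1) ≤ 2 ^ (2 + α / 2) * algWeight (2 + α / 2) n := by
  set r := |(n : ℝ)| with hr
  have hr0 : 0 ≤ r := abs_nonneg _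
  have h0 : 0 ≤ r ^ (2 + α) := Real.rpow_nonneg hr0 _
  have h1 : (1 + r) ^ (2 + α / 2) ≤ 2 ^ (2 + α / 2) * (r ^ (2 + α) + 1) := by
    have h2 : (0 : ℝ) < 2 ^ (2 + α / 2) := by positivity
    rcases le_total r 1 with h | h
    · calc (1 + r) ^ (2 + α / 2) ≤ 2 ^ (2 + α / 2) :=
            Real.rpow_le_rpow (by linarith) (by linarith) (by linarith)
        _ ≤ _ := le_mul_of_one_le_right h2.le (by linarith)
    · calc (1 + r) ^ (2 + α / 2) ≤ (2 * r) ^ (2 + α / 2) :=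
            Real.rpow_le_rpow (by linarith) (by linarith) (by linarith)
        _ = 2 ^ (2 + α / 2) * r ^ (2 + α / 2) := Real.mul_rpow (by norm_num) hr0
        _ ≤ 2 ^ (2 + α / 2) * (r ^ (2 + α) + 1) := by
            have : r ^ (2 + α / 2) ≤ r ^ (2 + α) :=
              Real.rpow_le_rpow_of_exponent_le h (by linarith)
            exact mul_le_mul_of_nonneg_left (by linarith) h2.le
  rw [algWeight, ← hr, Real.rpow_neg (by linarith), ← div_eq_mul_inv,
    div_le_div_iff₀ (by linarith) (by positivity), one_mul]
  exact h1

lemma algWeight_le_inv {s : ℝ} (hs : 1 ≤ s) (n : ℤ) : algWeight s n ≤ 1 / (|(n : ℝ)| ^ s + 1) := by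
  have h0 : 0 ≤ |(n : ℝ)| ^ s := Real.rpow_nonneg (abs_nonneg _) _
  have h1 := Real.add_rpow_le_rpow_add zero_le_one (abs_nonneg (n : ℝ)) hs
  rw [Real.one_rpow] at h1
  rw [algWeight, Real.rpow_neg (by positivity), ← one_div]
  exact one_div_le_one_div_of_le (by linarith) (by linarith)

lemma PerturbedConvex.site {K : ℝ} {ψ : ℤ → ℝ → ℝ} (h : PerturbedConvex K ψ) {K' : ℝ}
    (hK : K ≤ K') (i : ℤ) : PerturbedConvexSite K' (ψ i) := by
  obtain ⟨ψc, ψb, h⟩ := h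
  obtain ⟨h1, h2, h3, h4, h5, h6⟩ := h i
  exact ⟨ψc i, ψb i, h1, h2, convexOn_univ_of_deriv2_nonneg h2 h3 h4, h5, fun z => (h6 z).trans hK⟩

/-- The linear field produced by the boundary values. -/
def boundaryField (M : ℤ → ℤ → ℝ) (Λ : Finset ℤ) (y : {j : ℤ // j ∉ Λ} → ℝ) (i : ℤ) : ℝ :=
  1 / 2 * ∑' j : {j : ℤ // j ∉ Λ}, (M i j + M j i) * y j

/-- The off-diagonal couplings of the Gibbs measure. -/
def offDiagonal (M : ℤ → ℤ → ℝ) (Λ : Finset ℤ) (k l : Λ) : ℝ := if k = l then 0 else -(M k l / 2)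

lemma exp_neg_hamiltonian (ψ : ℤ → ℝ → ℝ) (M : ℤ → ℤ → ℝ) (Λ : Finset ℤ)
    (y : {j : ℤ // j ∉ Λ} → ℝ) (x : Λ → ℝ) :
    Real.exp (-hamiltonian ψ M Λ y x) =
      siteDensity (fun k : Λ => potentialWeight (fun z => ψ k z + boundaryField M Λ y k * z) (M k k / 2))
        (offDiagonal M Λ) x := by
  have h1 : ∑ i : Λ, ∑' j : {j : ℤ // j ∉ Λ}, (M i j + M j i) * x i * y j =
      2 * ∑ i : Λ, boundaryField M Λ y i * x i := by
    rw [Finset.mul_sum]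
    refine Finset.sum_congr rfl fun i _ => ?_
    have e : ∀ S : ℝ, 2 * (1 / 2 * S * x i) = x i * S := fun S => by ring
    rw [boundaryField, e, ← tsum_mul_left]
    exact tsum_congr fun j => by ring
  have h2 : ∑ i : Λ, ∑ j : Λ, M i j * x i * x j =
      2 * (∑ i : Λ, M i i / 2 * x i ^ 2 - coupling (offDiagonal M Λ) x) := by
    rw [coupling, ← Finset.sum_sub_distrib, Finset.mul_sum]
    refine Finset.sum_congr rfl fun i _ => ?_
    have h3 : M i i / 2 * x i ^ 2 = ∑ j : Λ, if i = j then M i i / 2 * x i ^ 2 else 0 := by simp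
    rw [h3, ← Finset.sum_sub_distrib, Finset.mul_sum]
    refine Finset.sum_congr rfl fun j _ => ?_
    rw [offDiagonal]
    split_ifs with hij
    · rw [← hij]; ring
    · ring
  rw [siteDensity, hamiltonian, h1, h2]
  simp only [potentialWeight]
  rw [← Real.exp_sum, ← Real.exp_add]
  congr 1
  simp only [neg_add, Finset.sum_sub_distrib, Finset.sum_add_distrib, Finset.sum_neg_distrib]
  ring

lemma dominant_offDiagonal {δ : ℝ} {M : ℤ → ℤ → ℝ} (hsymm : SymmetricInteraction M)
    (hdom : StrictlyDiagDominant δ M) (Λ : Finset ℤ) :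
    Dominant (δ / 2) (fun k : Λ => M k k / 2) (offDiagonal M Λ) where
  symm k l := by simp only [offDiagonal, hsymm k l, eq_comm (a := k)]
  diag k := by simp [offDiagonal]
  row k := by
    obtain ⟨h1, h2⟩ := hdom k
    have h3 : ∑ l : Λ, |offDiagonal M Λ k l| =
        (∑ l ∈ Λ.subtype (· ≠ (k : ℤ)), |M k l|) / 2 := by
      rw [Finset.sum_subtype_eq_sum_filter (f := fun l : ℤ => |M k l|), Finset.sum_filter,
        ← Finset.sum_coe_sort Λ, Finset.sum_div]
      refine Finset.sum_congr rfl fun l _ => ?_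
      by_cases hkl : k = l
      · simp [offDiagonal, hkl]
      · have : (l : ℤ) ≠ k := fun h => hkl (Subtype.ext h.symm)
        rw [offDiagonal, if_neg hkl, if_pos this, abs_neg, abs_div, abs_two]
    have h4 := h1.sum_le_tsum (Λ.subtype (· ≠ (k : ℤ))) (fun _ _ => abs_nonneg _)
    rw [h3]
    linarith

end Gibbs

end SpinLattice

end

theorem theorem1 (α δ K A : ℝ) (hα : 0 < α) (hδ : 0 < δ) :
    ∃ α' : ℝ, 0 < α' ∧ α' < α ∧ ∃ C : ℝ,
      ∀ (ψ : ℤ → ℝ → ℝ) (M : ℤ → ℤ → ℝ),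
        SpinLattice.PerturbedConvex K ψ →
        SpinLattice.SymmetricInteraction M →
        SpinLattice.StrictlyDiagDominant δ M →
        SpinLattice.AlgebraicDecay A α M →
        ∀ (Λ : Finset ℤ) (y : {j : ℤ // j ∉ Λ} → ℝ),
          SpinLattice.Tempered M Λ y →
          MeasureTheory.IsProbabilityMeasure (SpinLattice.gibbsMeasure ψ M Λ y) ∧
          (∀ i : Λ, MeasureTheory.MemLp (fun x : Λ → ℝ => x i) 2
            (SpinLattice.gibbsMeasure ψ M Λ y)) ∧
          ∀ i j : Λ,
            |ProbabilityTheory.covariance (fun x : Λ → ℝ => x i) (fun x : Λ → ℝ => x j)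
              (SpinLattice.gibbsMeasure ψ M Λ y)|
              ≤ C / (|((i : ℤ) : ℝ) - ((j : ℤ) : ℝ)| ^ (2 + α') + 1) := by
  open SpinLattice MeasureTheory in
  -- the diagonal entries of `M` lie between `δ` and `A`; the maxima only ensure the side conditions of
  -- the lemma when no such `M` exists
  obtain ⟨C, hC, hdec⟩ := exists_truncated_decay (s := 2 + α / 2) (d := δ / 2)
    (a := max A δ / 2) (A := max A 0 * 2 ^ (2 + α / 2)) (K := max K 0) (by linarith) (by linarith)
    (by linarith [le_max_right A δ]) (by positivity) (le_max_right _ _)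
  refine ⟨α / 2, by linarith, by linarith, C, ?_⟩
  intro ψ M hψ hsymm hdom hM Λ y _
  set m : Λ → ℝ := fun k => M k k / 2 with hm
  -- the quadratic form `1 / 2 * M` has diagonal `m` and off-diagonal part `-J`
  set J := offDiagonal M Λ with hJ
  set φ : Λ → ℝ → ℝ := fun k z => ψ k z + boundaryField M Λ y k * z with hφdef
  have hφ : ∀ k, PerturbedConvexSite (max K 0) (φ k) := fun k =>
    (hψ.site (le_max_left K 0) k).add_linear _
  have hdomJ : Dominant (δ / 2) m J := dominant_offDiagonal hsymm hdom Λ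
  have hMabs : ∀ k l : ℤ, |M k l| ≤ max A 0 * (1 / (|((k - l : ℤ) : ℝ)| ^ (2 + α) + 1)) :=
    fun k l => by
      have h0 : 0 ≤ |(k : ℝ) - l| ^ (2 + α) := Real.rpow_nonneg (abs_nonneg _) _
      rw [mul_one_div, Int.cast_sub]
      exact (hM k l).trans (div_le_div_of_nonneg_right (le_max_left _ _) (by linarith))
  have hma : ∀ k, m k ≤ max A δ / 2 := fun k => by
    have h1 := hM k k
    rw [sub_self, abs_zero, Real.zero_rpow (by linarith), zero_add, div_one] at h1
    simp only [hm]
    linarith [le_abs_self (M k k), le_max_left A δ]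
  have hJw : ∀ k l : Λ, |J k l| ≤ max A 0 * 2 ^ (2 + α / 2) *
      algWeight (2 + α / 2) ((k : ℤ) - l) := fun k l => by
    have h1 := (hMabs k l).trans (mul_le_mul_of_nonneg_left (inv_le_algWeight hα.le ((k : ℤ) - l))
      (le_max_right A 0))
    rw [← mul_assoc] at h1
    refine le_trans ?_ h1
    simp only [hJ, offDiagonal]
    split_ifs
    · simp
    · rw [abs_neg, abs_div, abs_two]
      linarith [abs_nonneg (M k l)]
  set ρ : (Λ → ℝ) → ℝ := siteDensity (fun k => potentialWeight (φ k) (m k)) J with hρ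
  have hexp : ∀ x, Real.exp (-hamiltonian ψ M Λ y x) = ρ x := exp_neg_hamiltonian ψ M Λ y
  have hconf : Confined m (fun k => potentialWeight (φ k) (m k)) := fun k => (hφ k).confinedSite _
  have hd2 : 0 < δ / 2 := half_pos hδ
  have I0 : Integrable ρ := hconf.integrable_siteDensity hdomJ hd2
  have I2 : ∀ i j, Integrable (fun x => x i * x j * ρ x) := hconf.integrable_coord_mul hdomJ hd2
  have hZ : 0 < ∫ x, ρ x := hconf.integral_siteDensity_pos hdomJ hd2 fun k r => Real.exp_pos _
  have hI : Integrable (fun x => Real.exp (-hamiltonian ψ M Λ y x)) := by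
    simpa only [hexp] using I0
  have hprob : IsProbabilityMeasure (gibbsMeasure ψ M Λ y) := isProbabilityMeasure_tilted hI
  have hL2 : ∀ i : Λ, MemLp (fun x : Λ → ℝ => x i) 2 (gibbsMeasure ψ M Λ y) := fun i => by
    rw [memLp_two_iff_integrable_sq (continuous_apply i).aestronglyMeasurable, gibbsMeasure,
      integrable_tilted_iff hI]
    refine (I2 i i).congr (Filter.Eventually.of_forall fun x => ?_)
    simp only [hexp, smul_eq_mul]
    ring
  refine ⟨hprob, hL2, fun i j => ?_⟩
  have hint : ∀ g : (Λ → ℝ) → ℝ, ∫ x, g x ∂(gibbsMeasure ψ M Λ y) =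
      (∫ x, g x * ρ x) / ∫ x, ρ x := fun g => by
    rw [gibbsMeasure, integral_tilted]
    simp only [hexp, smul_eq_mul]
    rw [← integral_div]
    exact integral_congr_ae (Filter.Eventually.of_forall fun x => by ring)
  have hcov := hdec Λ (fun k => (k : ℤ)) Subtype.val_injective m J hdomJ hma hJw φ hφ ρ hρ i j
  rw [ProbabilityTheory.covariance_eq_sub (hL2 i) (hL2 j), hint, hint, hint]
  simp only [Pi.mul_apply]
  have h1 : (∫ x, x i * x j * ρ x) / (∫ x, ρ x) - (∫ x, x i * ρ x) / (∫ x, ρ x) *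
      ((∫ x, x j * ρ x) / ∫ x, ρ x) = ((∫ x, x i * x j * ρ x) * (∫ x, ρ x) -
        (∫ x, x i * ρ x) * ∫ x, x j * ρ x) / (∫ x, ρ x) ^ 2 := by
    field_simp
  rw [h1, abs_div, abs_of_pos (pow_pos hZ 2), div_le_iff₀ (pow_pos hZ 2)]
  refine hcov.trans (mul_le_mul_of_nonneg_right ?_ (sq_nonneg _))
  have h2 := mul_le_mul_of_nonneg_left
    (algWeight_le_inv (s := 2 + α / 2) (by linarith) ((i : ℤ) - j)) hC.le
  rwa [mul_one_div, Int.cast_sub] at h2
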